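/- For $N\ge 1$ consider the toy model system $$\partial_t b_j=-i|b_j|^2b_j+2i\,\overline{b_j}\,\bigl(b_{j-1}^2+b_{j+1}^2\bigr),\qquad 1\le j\le N,\qquad b_0=b_{N+1}=0,$$ for $b=(b_1,\dots,b_N)\in\mathbb C^N$. Let $\Sigma=\{x\in\mathbb C^N:\ |x_1|^2+\dots+|x_N|^2=1\}$ be the unit-mass sphere, with the metric inherited from $\mathbb C^N$, and for $1\le j\le N$ let $\mathbb T_j=\{x\in\Sigma:\ |x_j|=1,\ x_k=0 \text{ for all } k\ne j\}$. There are absolute constants $0<c\le C$ such that for every integer $N\ge 6$ and every $\varepsilon>0$ there exist a global solution $b:\mathbb R\to\mathbb C^N$ of the system and a time $T\ge 0$ for which $b(0)\in\Sigma$ lies within distance $\varepsilon$ of $\mathbb T_3$ and $b(T)\in\Sigma$ lies within distance $\varepsilon$ of $\mathbb T_{N-2}$. Moreover, this solution satisfies $$|b_3(0)|\ge 1-\varepsilon,\quad |b_j(0)|\le\varepsilon\ (j\ne 3),\qquad |b_{N-2}(T)|\ge 1-\varepsilon,\quad |b_j(T)|\le\varepsilon\ (j\ne N-2),$$ and $c\le\max_{1\le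 j\le N}|b_j(t)|\le C$ for all $0\le t\le T$. -/

import Mathlib

namespace ToyModel

/-- The phase space `ℂ^N` with its Euclidean (Hermitian) norm. -/
abbrev Phase (N : ℕ) : Type := EuclideanSpace ℂ (Fin N)

/-- The mode `b_j` of `b = (b_1, …, b_N)`, extended by zero: `b_j = 0` unless `1 ≤ j ≤ N`. -/
noncomputable def mode {N : ℕ} (b : Phase N) (j : ℕ) : ℂ :=
  if h : 1 ≤ j ∧ j ≤ N then b ⟨j - 1, by omega⟩ else 0

/-- The right-hand side of the equation for the mode `b_j` (used for `j ≥ 1` only):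
`-i |b_j|² b_j + 2 i conj(b_j) (b_{j-1}² + b_{j+1}²)`. -/
noncomputable def modeVelocity {N : ℕ} (b : Phase N) (j : ℕ) : ℂ :=
  -Complex.I * ((‖mode b j‖ ^ 2 : ℝ) : ℂ) * mode b j
    + 2 * Complex.I * (starRingEnd ℂ) (mode b j) * (mode b (j - 1) ^ 2 + mode b (j + 1) ^ 2)

/-- The toy model vector field on `ℂ^N`; the entry with index `i : Fin N` belongs to the
mode `j = i + 1`. -/
noncomputable def vectorField {N : ℕ} (b : Phase N) : Phase N :=
  WithLp.toLp 2 fun i : Fin N => modeVelocity b ((i : ℕ) + 1)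

/-- `b` is a global solution of the toy model system. -/
def IsSolution {N : ℕ} (b : ℝ → Phase N) : Prop :=
  ∀ t : ℝ, HasDerivAt b (vectorField (b t)) t

/-- The unit-mass sphere `Σ ⊂ ℂ^N`, with the metric inherited from `ℂ^N`. -/
abbrev massSphere (N : ℕ) : Set (Phase N) := Metric.sphere (0 : Phase N) 1

/-- The circle `𝕋_j ⊂ Σ`. -/
def circle (N j : ℕ) : Set (massSphere N) :=
  {x | ‖mode (x : Phase N) j‖ = 1 ∧ ∀ k : ℕ, k ≠ j → mode (x : Phase N) k = 0}

/-- The `ℓ^∞` norm of a point of `ℂ^N` (the norm of the function space `Fin N → ℂ` is the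
maximum of the moduli of the entries). -/
noncomputable def supNorm {N : ℕ} (b : Phase N) : ℝ := ‖WithLp.ofLp b‖

end ToyModel

/-
Near the circle `𝕋_k` the bond `b_k conj(b_{k+1})` has an unstable and a stable component; a
heteroclinic orbit leaves `𝕋_k` along the stable manifold of `𝕋_{k+1}`. To shadow the chain of
these connections, one carries along a path of data near `𝕋_k`, supported on the first `k` modes,
on which the incoming bond crosses the cone where its stable component dominates. Each datum of the
path is given a second parameter `a ∈ [-1, 1]`: a tiny mass is inserted in the mode `k + 1`, with
bond components proportional to `(a, 1)`. In the resulting parameter rectangle, the data whose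
incoming bond leaves the stable cone on one side before the outgoing bond has taken over are
separated from those leaving on the other side. Hence, by a Poincaré–Miranda argument, some path of
data joins the sides `a = -1` and `a = 1` while staying near `𝕋_k` until the outgoing bond grows and
carries the mass over to `𝕋_{k+1}`. The product of the two components of this bond is nearly
conserved, so that the sides `a = ±1` end on different sides of its cone: the path crosses the cone
of the next circle, and the construction can be repeated.
-/

namespace ToyModel

open Set Filter Topology

/-! ### Planar topology -/

section PlanarTopology

lemma abs_sub_lt_of_antiperiodic {X : Type*} [TopologicalSpace X] {A : Set X}
    (hA : IsPreconnected A) {θ : X → ℝ} (hθ : ContinuousOn θ A) {s : ℝ → ℝ} {c : ℝ} (hc : 0 < c)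
    (hs : Function.Antiperiodic s c) (hpos : ∀ x ∈ A, 0 < s (θ x)) {x y : X} (hx : x ∈ A)
    (hy : y ∈ A) : |θ x - θ y| < c := by
  have key : ∀ x ∈ A, ∀ y ∈ A, θ y - θ x < c := by
    intro x hx y hy
    by_contra! h
    obtain ⟨z, hz, hzx⟩ := hA.intermediate_value hx hy hθ
      (show θ x + c ∈ Icc (θ x) (θ y) from ⟨by linarith, by linarith⟩)
    have hsz := hpos z hz
    rw [hzx, hs] at hsz
    linarith [hpos x hx]
  exact abs_lt.2 ⟨by linarith [key x hx y hy], key y hy x hx⟩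

lemma lt_of_cos_pos_of_sin_neg_of_sin_pos {X : Type*} [TopologicalSpace X] {A : Set X}
    (hA : IsPreconnected A) {θ : X → ℝ} (hθ : ContinuousOn θ A)
    (hcos : ∀ x ∈ A, 0 < Real.cos (θ x)) {x y : X} (hx : x ∈ A) (hy : y ∈ A)
    (hsx : Real.sin (θ x) < 0) (hsy : 0 < Real.sin (θ y)) : θ x < θ y := by
  have hclose := abs_lt.1
    (abs_sub_lt_of_antiperiodic hA hθ Real.pi_pos Real.cos_antiperiodic hcos hx hy)
  have hsin : 0 < Real.sin (θ y - θ x) := by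
    rw [Real.sin_sub]
    nlinarith [mul_pos hsy (hcos x hx), mul_pos (neg_pos.2 hsx) (hcos y hy)]
  by_contra! h
  linarith [Real.sin_nonpos_of_nonpos_of_neg_pi_le (sub_nonpos.2 h) (by linarith)]

lemma exists_polar_coordinates {X : Type*} [TopologicalSpace X] [SimplyConnectedSpace X]
    [LocallyPathConnectedSpace X] {f g : X → ℝ} (hf : Continuous f) (hg : Continuous g)
    (hfg : ∀ x, f x = 0 → g x ≠ 0) :
    ∃ r θ : X → ℝ, Continuous θ ∧ (∀ x, 0 < r x) ∧ (∀ x, f x = r x * Real.cos (θ x)) ∧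
      ∀ x, g x = r x * Real.sin (θ x) := by
  let F : C(X, ℂ) := ⟨fun x => f x + g x * Complex.I, by fun_prop⟩
  have hre : ∀ x, (F x).re = f x := fun x => by simp [F]
  have him : ∀ x, (F x).im = g x := fun x => by simp [F]
  have hF : ∀ x, F x ≠ 0 := fun x hx =>
    hfg x (by rw [← hre, hx, Complex.zero_re]) (by rw [← him, hx, Complex.zero_im])
  obtain ⟨x₀⟩ : Nonempty X := inferInstance
  obtain ⟨G, ⟨-, hG⟩, -⟩ := Complex.isCoveringMapOn_exp.existsUnique_continuousMap_lifts F
    (Complex.exp_log (hF x₀)) hF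
  have hexp : ∀ x, Complex.exp (G x) = F x := congrFun hG
  refine ⟨fun x => Real.exp (G x).re, fun x => (G x).im, by fun_prop, fun x => Real.exp_pos _,
    fun x => ?_, fun x => ?_⟩
  · rw [← hre, ← hexp, Complex.exp_re]
  · rw [← him, ← hexp, Complex.exp_im]

lemma not_forall_angle_quadrants {θ : ℝ × ℝ → ℝ} (hθ : Continuous θ) {a b c d : ℝ}
    (hleft : ∀ z : ℝ × ℝ, z.1 ≤ a → Real.cos (θ z) < 0)
    (hright : ∀ z : ℝ × ℝ, b ≤ z.1 → 0 < Real.cos (θ z))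
    (hbot : ∀ z : ℝ × ℝ, z.2 ≤ c → Real.sin (θ z) < 0) :
    ¬∀ z : ℝ × ℝ, d ≤ z.2 → 0 < Real.sin (θ z) := by
  -- The angle would increase along each of the four sides of a rectangle.
  intro htop
  have right_side : θ (b, c) < θ (b, d) :=
    lt_of_cos_pos_of_sin_neg_of_sin_pos (A := Ici b ×ˢ univ)
      (isPreconnected_Ici.prod isPreconnected_univ) hθ.continuousOn
      (fun z hz => hright z hz.1) ⟨self_mem_Ici, trivial⟩ ⟨self_mem_Ici, trivial⟩ (hbot _ le_rfl)
      (htop _ le_rfl)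
  have top_side : θ (b, d) - Real.pi / 2 < θ (a, d) - Real.pi / 2 :=
    lt_of_cos_pos_of_sin_neg_of_sin_pos (A := univ ×ˢ Ici d) (θ := fun z => θ z - Real.pi / 2)
      (isPreconnected_univ.prod isPreconnected_Ici) (by fun_prop)
      (fun z hz => by simpa only [Real.cos_sub_pi_div_two] using htop z hz.2)
      ⟨trivial, self_mem_Ici⟩ ⟨trivial, self_mem_Ici⟩
      (by simpa [Real.sin_sub_pi_div_two] using hright (b, d) le_rfl)
      (by simpa [Real.sin_sub_pi_div_two] using hleft (a, d) le_rfl)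
  have left_side : θ (a, d) - Real.pi < θ (a, c) - Real.pi :=
    lt_of_cos_pos_of_sin_neg_of_sin_pos (A := Iic a ×ˢ univ) (θ := fun z => θ z - Real.pi)
      (isPreconnected_Iic.prod isPreconnected_univ) (by fun_prop)
      (fun z hz => by simpa using hleft z hz.1) ⟨self_mem_Iic, trivial⟩ ⟨self_mem_Iic, trivial⟩
      (by simpa using htop (a, d) le_rfl) (by simpa using hbot (a, c) le_rfl)
  have bottom_side : θ (a, c) + Real.pi / 2 < θ (b, c) + Real.pi / 2 :=
    lt_of_cos_pos_of_sin_neg_of_sin_pos (A := univ ×ˢ Iic c) (θ := fun z => θ z + Real.pi / 2)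
      (isPreconnected_univ.prod isPreconnected_Iic) (by fun_prop)
      (fun z hz => by simpa [Real.cos_add_pi_div_two] using hbot z hz.2)
      ⟨trivial, self_mem_Iic⟩ ⟨trivial, self_mem_Iic⟩
      (by simpa [Real.sin_add_pi_div_two] using hleft (a, c) le_rfl)
      (by simpa [Real.sin_add_pi_div_two] using hright (b, c) le_rfl)
  linarith

/-- The two-dimensional Poincaré–Miranda theorem, for functions on the whole plane. -/
theorem exists_common_zero {f g : ℝ × ℝ → ℝ} (hf : Continuous f) (hg : Continuous g) {a b c d : ℝ}
    (hleft : ∀ z : ℝ × ℝ, z.1 ≤ a → f z < 0) (hright : ∀ z : ℝ × ℝ, b ≤ z.1 → 0 < f z)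
    (hbot : ∀ z : ℝ × ℝ, z.2 ≤ c → g z < 0) (htop : ∀ z : ℝ × ℝ, d ≤ z.2 → 0 < g z) :
    ∃ z, f z = 0 ∧ g z = 0 := by
  by_contra! hne
  obtain ⟨r, θ, hθ, hr, hfθ, hgθ⟩ := exists_polar_coordinates hf hg hne
  exact not_forall_angle_quadrants hθ
    (fun z hz => neg_of_mul_neg_right (hfθ z ▸ hleft z hz) (hr z).le)
    (fun z hz => pos_of_mul_pos_right (hfθ z ▸ hright z hz) (hr z).le)
    (fun z hz => neg_of_mul_neg_right (hgθ z ▸ hbot z hz) (hr z).le)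
    (fun z hz => pos_of_mul_pos_right (hgθ z ▸ htop z hz) (hr z).le)

lemma exists_continuous_neg_pos {X : Type*} [PseudoMetricSpace X] {U V : Set X} (hU : IsOpen U)
    (hV : IsOpen V) (hUV : Disjoint U V) (hU' : U.Nonempty) (hV' : V.Nonempty) :
    ∃ f : X → ℝ, Continuous f ∧ (∀ x ∈ U, f x < 0) ∧ ∀ x ∈ V, 0 < f x := by
  have infDist_pos : ∀ {W : Set X}, IsOpen W → Wᶜ.Nonempty → ∀ x ∈ W, 0 < Metric.infDist x Wᶜ :=
    fun hW hne x hx => (hW.isClosed_compl.notMem_iff_infDist_pos hne).1 (not_not_intro hx)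
  refine ⟨fun x => Metric.infDist x Vᶜ - Metric.infDist x Uᶜ,
    (Metric.continuous_infDist_pt _).sub (Metric.continuous_infDist_pt _), fun x hx => ?_,
    fun x hx => ?_⟩
  · have hx' : Metric.infDist x Vᶜ = 0 := Metric.infDist_zero_of_mem (disjoint_left.1 hUV hx)
    simp only [hx', zero_sub, neg_lt_zero]
    exact infDist_pos hU (hV'.mono (subset_compl_iff_disjoint_left.2 hUV)) x hx
  · have hx' : Metric.infDist x Uᶜ = 0 := Metric.infDist_zero_of_mem (disjoint_right.1 hUV hx)
    simp only [hx', sub_zero]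
    exact infDist_pos hV (hU'.mono (subset_compl_iff_disjoint_right.2 hUV)) x hx

lemma exists_isOpen_separation_of_not_joinedIn {X : Type*} [TopologicalSpace X]
    [LocallyPathConnectedSpace X] {O B T : Set X} (hO : IsOpen O)
    (h : ∀ x ∈ B, ∀ y ∈ T, ¬JoinedIn O x y) :
    ∃ U V : Set X, IsOpen U ∧ IsOpen V ∧ Disjoint U V ∧ O ⊆ U ∪ V ∧ Disjoint T U ∧
      Disjoint (O ∩ B) V := by
  let U : Set X := ⋃ x ∈ B, pathComponentIn O x
  have mem_U : ∀ {z}, z ∈ U ↔ ∃ x ∈ B, JoinedIn O x z := by simp [U, pathComponentIn]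
  have mem_V : ∀ {z}, z ∈ ⋃ y ∈ O \ U, pathComponentIn O y ↔ z ∈ O ∧ z ∉ U := by
    intro z
    simp only [mem_iUnion, exists_prop]
    refine ⟨fun ⟨y, ⟨_, hyU⟩, hyz⟩ => ⟨hyz.target_mem, fun hz => hyU ?_⟩, fun hz =>
      ⟨z, hz, JoinedIn.refl hz.1⟩⟩
    obtain ⟨x, hx, hxz⟩ := mem_U.1 hz
    exact mem_U.2 ⟨x, hx, hxz.trans hyz.symm⟩
  refine ⟨U, ⋃ y ∈ O \ U, pathComponentIn O y, isOpen_biUnion fun x _ => hO.pathComponentIn x,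
    isOpen_biUnion fun y _ => hO.pathComponentIn y, ?_, fun z hz => ?_, ?_, ?_⟩
  · exact disjoint_left.2 fun z hz hz' => (mem_V.1 hz').2 hz
  · exact (em (z ∈ U)).imp_right fun hzU => mem_V.2 ⟨hz, hzU⟩
  · exact disjoint_left.2 fun z hz hz' =>
      let ⟨x, hx, hxz⟩ := mem_U.1 hz'
      h x hx z hz hxz
  · exact disjoint_left.2 fun z hz hz' =>
      (mem_V.1 hz').2 (mem_U.2 ⟨z, hz.2, JoinedIn.refl hz.1⟩)

theorem exists_joinedIn_of_separates {L R O : Set (ℝ × ℝ)} (hL : IsOpen L) (hR : IsOpen R)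
    (hO : IsOpen O) (hLR : Disjoint L R) (hcover : (L ∪ R)ᶜ ⊆ O) {a b c d : ℝ} (hcd : c < d)
    (hleft : ∀ z : ℝ × ℝ, z.1 ≤ a → z ∈ L) (hright : ∀ z : ℝ × ℝ, b ≤ z.1 → z ∈ R) :
    ∃ x y : ℝ × ℝ, x.2 ≤ c ∧ d ≤ y.2 ∧ JoinedIn O x y := by
  by_contra! hno
  obtain ⟨U, V, hU, hV, hUV, hOUV, hTU, hBV⟩ :=
    exists_isOpen_separation_of_not_joinedIn hO
      (B := {z : ℝ × ℝ | z.2 ≤ c}) (T := {z : ℝ × ℝ | d ≤ z.2}) fun x hx y hy => hno x y hx hy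
  let Z : Set (ℝ × ℝ) := (L ∪ R)ᶜ
  have hZ : IsClosed Z := (hL.union hR).isClosed_compl
  let C₀ : Set (ℝ × ℝ) := (Z ∩ Vᶜ) ∪ {z | z.2 ≤ c}
  let C₁ : Set (ℝ × ℝ) := (Z ∩ Uᶜ) ∪ {z | d ≤ z.2}
  have hC₀ : IsClosed C₀ :=
    (hZ.inter hV.isClosed_compl).union (isClosed_le continuous_snd continuous_const)
  have hC₁ : IsClosed C₁ :=
    (hZ.inter hU.isClosed_compl).union (isClosed_le continuous_const continuous_snd)
  have hC : Disjoint C₀ C₁ := by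
    rw [disjoint_left]
    rintro z (⟨hz, hzV⟩ | hz) (⟨hz', hzU⟩ | hz')
    · exact (hOUV (hcover hz)).elim hzU hzV
    · exact (hOUV (hcover hz)).elim (disjoint_left.1 hTU hz') hzV
    · exact (hOUV (hcover hz')).elim hzU (disjoint_left.1 hBV ⟨hcover hz', hz⟩)
    · exact (hcd.trans_le hz').not_ge hz
  obtain ⟨f, hf, hfL, hfR⟩ := exists_continuous_neg_pos hL hR hLR
    ⟨(a, 0), hleft _ le_rfl⟩ ⟨(b, 0), hright _ le_rfl⟩
  obtain ⟨g, hg₀, hg₁, -⟩ := exists_continuous_zero_one_of_isClosed hC₀ hC₁ hC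
  obtain ⟨z, hfz, hgz⟩ := exists_common_zero (g := fun z => g z - 1 / 2) (c := c) (d := d) hf
    (by fun_prop)
    (fun z hz => hfL z (hleft z hz)) (fun z hz => hfR z (hright z hz))
    (fun z hz => by norm_num [hg₀ (Or.inr hz : z ∈ C₀)])
    (fun z hz => by norm_num [hg₁ (Or.inr hz : z ∈ C₁)])
  have hzZ : z ∈ Z := fun h => h.elim (fun h => (hfL z h).ne hfz) fun h => (hfR z h).ne' hfz
  rcases hOUV (hcover hzZ) with hzU | hzV
  · norm_num [hg₀ (Or.inl ⟨hzZ, disjoint_left.1 hUV hzU⟩ : z ∈ C₀)] at hgz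
  · norm_num [hg₁ (Or.inl ⟨hzZ, disjoint_right.1 hUV hzV⟩ : z ∈ C₁)] at hgz

end PlanarTopology

/-! ### Global flows -/

section GlobalFlow

variable {E : Type*} [NormedAddCommGroup E] [NormedSpace ℝ E]

lemma exists_isIntegralCurve_of_hasCompactSupport [CompleteSpace E] {f : E → E}
    (hf : ContDiff ℝ 1 f) (hc : HasCompactSupport f) (x : E) :
    ∃ γ : ℝ → E, γ 0 = x ∧ IsIntegralCurve γ fun _ => f := by
  obtain ⟨K, hK⟩ := hf.lipschitzWith_of_hasCompactSupport hc one_ne_zero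
  obtain ⟨L, hL⟩ := hc.exists_bound_of_continuous hf.continuous
  have hloc : ∀ y : E, ∃ γ : ℝ → E, γ 0 = y ∧
      IsMIntegralCurveOn (I := modelWithCornersSelf ℝ E) γ f (Ioo (-1) 1) := by
    intro y
    have hpl : IsPicardLindelof (fun _ => f) (⟨0, by simp⟩ : Icc (-1 : ℝ) 1) y L.toNNReal 0
        L.toNNReal K :=
      .of_time_independent (fun z _ => (hL z).trans (Real.le_coe_toNNReal L))
        (hK.lipschitzOnWith) (by simp)
    obtain ⟨γ, hγ0, hγ⟩ := hpl.exists_eq_forall_mem_Icc_hasDerivWithinAt₀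
    refine ⟨γ, hγ0, fun t ht => HasFDerivWithinAt.hasMFDerivWithinAt ?_⟩
    exact ((hγ t (Ioo_subset_Icc_self ht)).mono Ioo_subset_Icc_self).hasFDerivWithinAt
  obtain ⟨γ, hγ0, hγ⟩ := exists_isMIntegralCurve_of_isMIntegralCurveOn
    (contMDiff_vectorSpace_iff_contDiff.2 hf) one_pos hloc x
  refine ⟨γ, hγ0, fun t => ?_⟩
  have hderiv : HasFDerivAt γ ((1 : ℝ →L[ℝ] ℝ).smulRight (f (γ t))) t := (hγ t).hasFDerivAt
  simpa using hderiv.hasDerivAt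

lemma dist_le_of_isIntegralCurve {f : E → E} {K : NNReal} (hf : LipschitzWith K f) {γ δ : ℝ → E}
    (hγ : IsIntegralCurve γ fun _ => f) (hδ : IsIntegralCurve δ fun _ => f) (t : ℝ) :
    dist (γ t) (δ t) ≤ dist (γ 0) (δ 0) * Real.exp (K * |t|) := by
  have forward : ∀ {f : E → E}, LipschitzWith K f → ∀ {γ δ : ℝ → E},
      IsIntegralCurve γ (fun _ => f) → IsIntegralCurve δ (fun _ => f) → ∀ t, 0 ≤ t →
      dist (γ t) (δ t) ≤ dist (γ 0) (δ 0) * Real.exp (K * t) := by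
    intro f hf γ δ hγ hδ t ht
    simpa using dist_le_of_trajectories_ODE (v := fun _ => f) (fun _ => hf)
      hγ.continuous.continuousOn (fun s _ => (hγ s).hasDerivWithinAt)
      hδ.continuous.continuousOn (fun s _ => (hδ s).hasDerivWithinAt) le_rfl t ⟨ht, le_rfl⟩
  rcases le_total 0 t with ht | ht
  · rw [abs_of_nonneg ht]
    exact forward hf hγ hδ t ht
  · rw [abs_of_nonpos ht]
    have reverse : ∀ {γ : ℝ → E}, IsIntegralCurve γ (fun _ => f) →
        IsIntegralCurve (fun t => γ (-t)) fun _ => -f := fun hγ => by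
      simpa [Function.comp_def, Pi.neg_def] using hγ.comp_mul (-1)
    simpa using forward hf.neg (reverse hγ) (reverse hδ) (-t) (by linarith)

lemma exists_flow_of_forall_isIntegralCurve {f : E → E} {K : NNReal} (hf : LipschitzWith K f)
    (hex : ∀ x, ∃ γ : ℝ → E, γ 0 = x ∧ IsIntegralCurve γ fun _ => f) :
    ∃ φ : Flow ℝ E, ∀ x, IsIntegralCurve (fun t => φ t x) fun _ => f := by
  choose γ hγ0 hγ using hex
  have hdist : ∀ t x y, dist (γ x t) (γ y t) ≤ dist x y * Real.exp (K * |t|) := fun t x y => by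
    simpa only [hγ0] using dist_le_of_isIntegralCurve hf (hγ x) (hγ y) t
  refine ⟨⟨fun t x => γ x t, ?_, fun s t x => ?_, hγ0⟩, hγ⟩
  · refine continuous_iff_continuousAt.2 fun ⟨t₀, x₀⟩ => tendsto_iff_dist_tendsto_zero.2 ?_
    have hbound : Tendsto (fun z : ℝ × E => dist z.2 x₀ * Real.exp (K * |z.1|)
        + dist (γ x₀ z.1) (γ x₀ t₀)) (𝓝 (t₀, x₀)) (𝓝 0) := by
      have := (hγ x₀).continuous
      exact (show Continuous _ by fun_prop).tendsto' _ _ (by simp)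
    refine squeeze_zero (fun _ => dist_nonneg) (fun z => ?_) hbound
    exact (dist_triangle _ (γ x₀ z.1) _).trans (add_le_add (hdist _ _ _) le_rfl)
  · have hshift : IsIntegralCurve (fun s => γ x (s + t)) fun _ => f := (hγ x).comp_add t
    simpa [hγ0] using dist_le_of_isIntegralCurve hf hshift (hγ (γ x t)) s

end GlobalFlow

/-! ### The toy model flow -/

section Modes

variable {N : ℕ}

/-- The mode `x ↦ b_j` as a continuous linear functional. -/
noncomputable def modeCLM (N j : ℕ) : Phase N →L[ℂ] ℂ :=
  if h : 1 ≤ j ∧ j ≤ N then EuclideanSpace.proj ⟨j - 1, by omega⟩ else 0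

lemma modeCLM_apply (j : ℕ) (x : Phase N) : modeCLM N j x = mode x j := by
  by_cases h : 1 ≤ j ∧ j ≤ N <;> simp [modeCLM, mode, h]

lemma mode_add (x y : Phase N) (j : ℕ) : mode (x + y) j = mode x j + mode y j := by
  simp only [← modeCLM_apply, map_add]

lemma mode_smul (c : ℂ) (x : Phase N) (j : ℕ) : mode (c • x) j = c * mode x j := by
  simp only [← modeCLM_apply, map_smul, smul_eq_mul]

lemma mode_real_smul (r : ℝ) (x : Phase N) (j : ℕ) : mode (r • x) j = r * mode x j := by
  rw [← Complex.coe_smul, mode_smul]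

lemma contDiff_mode (j : ℕ) : ContDiff ℝ 1 fun x : Phase N => mode x j := by
  simpa only [ContinuousLinearMap.coe_restrictScalars', funext (modeCLM_apply j)] using
    ((modeCLM N j).restrictScalars ℝ).contDiff

@[fun_prop]
lemma continuous_mode (j : ℕ) : Continuous fun x : Phase N => mode x j :=
  (contDiff_mode j).continuous

lemma hasDerivAt_mode {b : ℝ → Phase N} {v : Phase N} {t : ℝ} (hb : HasDerivAt b v t) (j : ℕ) :
    HasDerivAt (fun s => mode (b s) j) (mode v j) t := by
  simpa only [Function.comp_def, ContinuousLinearMap.coe_restrictScalars', modeCLM_apply] using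
    ((modeCLM N j).restrictScalars ℝ).hasFDerivAt.comp_hasDerivAt t hb

lemma mode_zero (x : Phase N) : mode x 0 = 0 := by simp [mode]

lemma mode_of_lt (x : Phase N) {j : ℕ} (h : N < j) : mode x j = 0 := by
  simp [mode, h.not_ge]

lemma mode_succ (x : Phase N) (i : Fin N) : mode x (i + 1) = x i := by
  simp [mode]

lemma norm_mode_le (x : Phase N) (j : ℕ) : ‖mode x j‖ ≤ ‖x‖ := by
  by_cases h : 1 ≤ j ∧ j ≤ N
  · simpa [mode, h] using PiLp.norm_apply_le x _
  · simp [mode, h]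

lemma mode_vectorField (x : Phase N) (j : ℕ) : mode (vectorField x) j = modeVelocity x j := by
  by_cases h : 1 ≤ j ∧ j ≤ N
  · simp [mode, h, vectorField]
  · have hmode : ∀ y : Phase N, mode y j = 0 := fun y => by simp [mode, h]
    simp [modeVelocity, hmode]

lemma contDiff_vectorField : ContDiff ℝ 1 (vectorField : Phase N → Phase N) := by
  have hconj : ∀ j, ContDiff ℝ 1 fun x : Phase N => (starRingEnd ℂ) (mode x j) := fun j =>
    Complex.conjCLE.contDiff.comp (contDiff_mode j)
  have hsq : ∀ j, ContDiff ℝ 1 fun x : Phase N => ((‖mode x j‖ ^ 2 : ℝ) : ℂ) := fun j =>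
    Complex.ofRealCLM.contDiff.comp ((contDiff_mode j).norm_sq ℝ)
  rw [contDiff_piLp]
  intro i
  simp only [vectorField, modeVelocity]
  exact ((contDiff_const.mul (hsq _)).mul (contDiff_mode _)).add
    ((contDiff_const.mul (hconj _)).mul (((contDiff_mode _).pow 2).add ((contDiff_mode _).pow 2)))

/-- The mass `|b_k|²` of a mode. -/
noncomputable def mass (k : ℕ) (x : Phase N) : ℝ := ‖mode x k‖ ^ 2

/-- The bond `b_k conj(b_{k+1})`. -/
noncomputable def bond (k : ℕ) (x : Phase N) : ℂ := mode x k * (starRingEnd ℂ) (mode x (k + 1))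

/-- The component of the bond that carries mass from mode `k + 1` to mode `k`. -/
noncomputable def bondU (k : ℕ) (x : Phase N) : ℝ := √3 * (bond k x).re + (bond k x).im

/-- The component of the bond that carries mass from mode `k` to mode `k + 1`. -/
noncomputable def bondV (k : ℕ) (x : Phase N) : ℝ := √3 * (bond k x).re - (bond k x).im

/-- The rate at which mass passes from mode `k + 1` to mode `k`. -/
noncomputable def flux (k : ℕ) (x : Phase N) : ℝ := 8 * (bond k x).re * (bond k x).im

lemma mass_nonneg (k : ℕ) (x : Phase N) : 0 ≤ mass k x := sq_nonneg _

lemma mass_eq_zero {k : ℕ} {x : Phase N} : mass k x = 0 ↔ mode x k = 0 := by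
  simp [mass]

@[fun_prop]
lemma continuous_mass (k : ℕ) : Continuous (mass k : Phase N → ℝ) :=
  (continuous_mode k).norm.pow 2

lemma continuous_bond (k : ℕ) : Continuous (bond k : Phase N → ℂ) :=
  (continuous_mode k).mul (Complex.continuous_conj.comp (continuous_mode (k + 1)))

@[fun_prop]
lemma continuous_bondU (k : ℕ) : Continuous (bondU k : Phase N → ℝ) :=
  (continuous_const.mul (Complex.continuous_re.comp (continuous_bond k))).add
    (Complex.continuous_im.comp (continuous_bond k))

@[fun_prop]
lemma continuous_bondV (k : ℕ) : Continuous (bondV k : Phase N → ℝ) :=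
  (continuous_const.mul (Complex.continuous_re.comp (continuous_bond k))).sub
    (Complex.continuous_im.comp (continuous_bond k))

lemma mass_eq_re_sq_add_im_sq (k : ℕ) (x : Phase N) :
    mass k x = (mode x k).re ^ 2 + (mode x k).im ^ 2 := by
  rw [mass, Complex.sq_norm, Complex.normSq_apply]
  ring

lemma norm_sq_eq_sum_mass (x : Phase N) : ‖x‖ ^ 2 = ∑ k ∈ Finset.range N, mass (k + 1) x := by
  rw [EuclideanSpace.norm_sq_eq, ← Fin.sum_univ_eq_sum_range fun k => mass (k + 1) x]
  simp only [mass, mode_succ]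

lemma sum_mass_le (x : Phase N) (s : Finset ℕ) : ∑ k ∈ s, mass k x ≤ ‖x‖ ^ 2 := by
  have hsupp : ∀ k ∉ (Finset.range N).image Nat.succ, mass k x = 0 := fun k hk => by
    simp only [Finset.mem_image, Finset.mem_range, not_exists, not_and] at hk
    rw [mass_eq_zero]
    rcases k with - | k
    · exact mode_zero x
    · exact mode_of_lt x (Nat.lt_succ_of_le (not_lt.1 fun h => hk k h rfl))
  calc ∑ k ∈ s, mass k x ≤ ∑ k ∈ s ∪ (Finset.range N).image Nat.succ, mass k x :=
        Finset.sum_le_sum_of_subset_of_nonneg Finset.subset_union_left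
          fun _ _ _ => mass_nonneg _ _
    _ = ∑ k ∈ (Finset.range N).image Nat.succ, mass k x :=
        (Finset.sum_subset Finset.subset_union_right fun k _ hk => hsupp k hk).symm
    _ = ‖x‖ ^ 2 := by
        rw [norm_sq_eq_sum_mass, Finset.sum_image Nat.succ_injective.injOn]

lemma sum_four_mass_le (x : Phase N) (k : ℕ) :
    mass k x + mass (k + 1) x + mass (k + 2) x + mass (k + 3) x ≤ ‖x‖ ^ 2 := by
  simpa [Finset.sum_Ico_eq_sum_range, Finset.sum_range_succ] using
    sum_mass_le x (Finset.Ico k (k + 4))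

private lemma hasDerivAt_re {z : ℝ → ℂ} {z' : ℂ} {t : ℝ} (h : HasDerivAt z z' t) :
    HasDerivAt (fun s => (z s).re) z'.re t :=
  Complex.reCLM.hasFDerivAt.comp_hasDerivAt t h

private lemma hasDerivAt_im {z : ℝ → ℂ} {z' : ℂ} {t : ℝ} (h : HasDerivAt z z' t) :
    HasDerivAt (fun s => (z s).im) z'.im t :=
  Complex.imCLM.hasFDerivAt.comp_hasDerivAt t h

lemma hasDerivAt_mass_of_smul {b : ℝ → Phase N} {r t : ℝ}
    (hb : HasDerivAt b (r • vectorField (b t)) t) (k : ℕ) :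
    HasDerivAt (fun s => mass (k + 1) (b s)) (r * (flux (k + 1) (b t) - flux k (b t))) t := by
  have hmode := hasDerivAt_mode hb (k + 1)
  simp only [mass_eq_re_sq_add_im_sq]
  refine (((hasDerivAt_re hmode).fun_pow 2).fun_add
    ((hasDerivAt_im hmode).fun_pow 2)).congr_deriv ?_
  rw [mode_real_smul, mode_vectorField]
  simp only [flux, bond, modeVelocity, Complex.sq_norm, Complex.normSq_apply, Nat.add_sub_cancel]
  simp [pow_two]
  ring

lemma hasDerivAt_norm_sq {b : ℝ → Phase N} {r t : ℝ}
    (hb : HasDerivAt b (r • vectorField (b t)) t) :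
    HasDerivAt (fun s => ‖b s‖ ^ 2) 0 t := by
  simp only [norm_sq_eq_sum_mass]
  refine (HasDerivAt.fun_sum fun k _ => hasDerivAt_mass_of_smul hb k).congr_deriv ?_
  rw [← Finset.mul_sum, Finset.sum_range_sub fun k => flux k (b t)]
  simp [flux, bond, mode_zero, mode_of_lt (b t) (Nat.lt_succ_self N)]

/-- A global flow on `ℂ^N` that solves the toy model system on the unit-mass sphere, separating
points at the rate `K`. Off the sphere the vector field is cut off to make the flow global, so
nothing is said about the orbits there. -/
structure IsSphereFlow (K : ℝ) (φ : Flow ℝ (Phase N)) : Prop where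
  dist_le : ∀ t x y, dist (φ t x) (φ t y) ≤ dist x y * Real.exp (K * |t|)
  norm_eq : ∀ t x, ‖x‖ = 1 → ‖φ t x‖ = 1
  isSolution : ∀ x, ‖x‖ = 1 → IsSolution fun t => φ t x

lemma exists_isSphereFlow (N : ℕ) :
    ∃ (K : ℝ) (φ : Flow ℝ (Phase N)), 0 ≤ K ∧ IsSphereFlow K φ := by
  let χ : ContDiffBump (0 : Phase N) := ⟨1, 2, one_pos, one_lt_two⟩
  let f : Phase N → Phase N := fun x => χ x • vectorField x
  have hf : ContDiff ℝ 1 f := χ.contDiff.smul contDiff_vectorField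
  have hcompact : HasCompactSupport f := χ.hasCompactSupport.smul_right
  obtain ⟨K, hK⟩ := hf.lipschitzWith_of_hasCompactSupport hcompact one_ne_zero
  obtain ⟨φ, hφ⟩ := exists_flow_of_forall_isIntegralCurve hK
    (exists_isIntegralCurve_of_hasCompactSupport hf hcompact)
  have hnorm : ∀ t x, ‖x‖ = 1 → ‖φ t x‖ = 1 := fun t x hx => by
    have hderiv := fun t => hasDerivAt_norm_sq (hφ x t)
    have hconst := is_const_of_deriv_eq_zero (fun t => (hderiv t).differentiableAt)
      (fun t => (hderiv t).deriv) t 0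
    rw [Flow.map_zero_apply, hx] at hconst
    exact (pow_left_inj₀ (norm_nonneg _) zero_le_one two_ne_zero).1 hconst
  refine ⟨K, φ, K.2, fun t x y => ?_, hnorm, fun x hx t => (hφ x t).congr_deriv ?_⟩
  · simpa only [Flow.map_zero_apply] using dist_le_of_isIntegralCurve hK (hφ x) (hφ y) t
  · have hχ : χ (φ t x) = 1 := χ.one_of_mem_closedBall (by simp [χ, hnorm t x hx])
    simp only [f, hχ, one_smul]

lemma flux_eq (k : ℕ) (x : Phase N) :
    flux k x = 2 / √3 * (bondU k x ^ 2 - bondV k x ^ 2) := by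
  have h3 : √3 ≠ 0 := by positivity
  unfold flux bondU bondV
  field_simp
  ring

lemma hasDerivAt_mass {b : ℝ → Phase N} {t : ℝ} (hb : HasDerivAt b (vectorField (b t)) t)
    (k : ℕ) :
    HasDerivAt (fun s => mass (k + 1) (b s)) (flux (k + 1) (b t) - flux k (b t)) t := by
  simpa only [one_mul] using hasDerivAt_mass_of_smul (r := 1) (by simpa only [one_smul] using hb) k

lemma bond_re_sq_add_im_sq (k : ℕ) (x : Phase N) :
    (bond k x).re ^ 2 + (bond k x).im ^ 2 = mass k x * mass (k + 1) x := by
  rw [mass, mass, ← mul_pow, ← Complex.norm_conj (mode x (k + 1)), ← norm_mul, Complex.sq_norm,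
    Complex.normSq_apply]
  simp only [bond, pow_two]

lemma bondU_sq_add_bondV_sq (k : ℕ) (x : Phase N) :
    bondU k x ^ 2 + bondV k x ^ 2 = 6 * (bond k x).re ^ 2 + 2 * (bond k x).im ^ 2 := by
  have h3 : √3 ^ 2 = (3 : ℝ) := Real.sq_sqrt (by norm_num)
  unfold bondU bondV
  linear_combination 2 * (bond k x).re ^ 2 * h3

lemma two_mul_mass_mul_mass_le (k : ℕ) (x : Phase N) :
    2 * (mass k x * mass (k + 1) x) ≤ bondU k x ^ 2 + bondV k x ^ 2 := by
  rw [bondU_sq_add_bondV_sq, ← bond_re_sq_add_im_sq]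
  linarith [sq_nonneg (bond k x).re]

lemma bondU_sq_add_bondV_sq_le (k : ℕ) (x : Phase N) :
    bondU k x ^ 2 + bondV k x ^ 2 ≤ 6 * (mass k x * mass (k + 1) x) := by
  rw [bondU_sq_add_bondV_sq, ← bond_re_sq_add_im_sq]
  linarith [sq_nonneg (bond k x).im]

lemma abs_flux_le (k : ℕ) (x : Phase N) : |flux k x| ≤ 4 * (mass k x * mass (k + 1) x) := by
  rw [flux, ← bond_re_sq_add_im_sq, abs_le]
  constructor <;>
  linarith [sq_nonneg ((bond k x).re + (bond k x).im), sq_nonneg ((bond k x).re - (bond k x).im)]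

/-- The influence of the modes `k` and `k + 3` on the bond between `k + 1` and `k + 2`. -/
noncomputable def bondForcing (k : ℕ) (x : Phase N) : ℂ :=
  2 * Complex.I * ((starRingEnd ℂ) (mode x (k + 1)) * (starRingEnd ℂ) (mode x (k + 2))
      * mode x k ^ 2
    - mode x (k + 1) * mode x (k + 2) * (starRingEnd ℂ) (mode x (k + 3)) ^ 2)

lemma norm_bondForcing_le (k : ℕ) (x : Phase N) :
    ‖bondForcing k x‖
      ≤ 2 * (‖mode x (k + 1)‖ * ‖mode x (k + 2)‖) * (mass k x + mass (k + 3) x) := by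
  unfold bondForcing mass
  rw [norm_mul, norm_mul, Complex.norm_I, mul_one, Complex.norm_ofNat]
  refine (mul_le_mul_of_nonneg_left (norm_sub_le _ _) (by norm_num)).trans_eq ?_
  simp only [norm_mul, norm_pow, Complex.norm_conj]
  ring

lemma norm_bondForcing_sq_le (k : ℕ) (x : Phase N) :
    (bondForcing k x).re ^ 2 + (bondForcing k x).im ^ 2
      ≤ 2 * (bondU (k + 1) x ^ 2 + bondV (k + 1) x ^ 2) * (mass k x + mass (k + 3) x) ^ 2 :=
  calc (bondForcing k x).re ^ 2 + (bondForcing k x).im ^ 2 = ‖bondForcing k x‖ ^ 2 := by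
        rw [Complex.sq_norm, Complex.normSq_apply]
        ring
    _ ≤ (2 * (‖mode x (k + 1)‖ * ‖mode x (k + 2)‖) * (mass k x + mass (k + 3) x)) ^ 2 :=
        pow_le_pow_left₀ (norm_nonneg _) (norm_bondForcing_le k x) 2
    _ = 2 * (2 * (mass (k + 1) x * mass (k + 2) x)) * (mass k x + mass (k + 3) x) ^ 2 := by
        unfold mass
        ring
    _ ≤ _ := by gcongr; exact two_mul_mass_mul_mass_le (k + 1) x

lemma hasDerivAt_bond {b : ℝ → Phase N} {t : ℝ} (hb : HasDerivAt b (vectorField (b t)) t)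
    (k : ℕ) :
    HasDerivAt (fun s => bond (k + 1) (b s))
      (Complex.I * ((mass (k + 2) (b t) : ℂ) - mass (k + 1) (b t))
        * (bond (k + 1) (b t) + 2 * (starRingEnd ℂ) (bond (k + 1) (b t)))
        + bondForcing k (b t)) t := by
  refine ((hasDerivAt_mode hb (k + 1)).mul (hasDerivAt_mode hb (k + 2)).star).congr_deriv ?_
  simp only [mode_vectorField, modeVelocity, bond, bondForcing, mass, Nat.add_sub_cancel,
    show k + 2 - 1 = k + 1 by omega, show k + 2 + 1 = k + 3 by omega,
    show k + 1 + 1 = k + 2 by omega, Complex.star_def]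
  push_cast
  simp only [← Complex.mul_conj', map_add, map_mul, map_neg, map_pow, Complex.conj_I,
    Complex.conj_conj, map_ofNat]
  ring

lemma hasDerivAt_bondU {b : ℝ → Phase N} {t : ℝ} (hb : HasDerivAt b (vectorField (b t)) t)
    (k : ℕ) :
    HasDerivAt (fun s => bondU (k + 1) (b s))
      (√3 * (mass (k + 2) (b t) - mass (k + 1) (b t)) * bondU (k + 1) (b t)
        + (√3 * (bondForcing k (b t)).re + (bondForcing k (b t)).im)) t := by
  have h3 : √3 ^ 2 = (3 : ℝ) := Real.sq_sqrt (by norm_num)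
  have hbond := hasDerivAt_bond hb k
  refine (((hasDerivAt_re hbond).const_mul √3).fun_add (hasDerivAt_im hbond)).congr_deriv ?_
  simp [bondU]
  linear_combination (-(mass (k + 2) (b t) - mass (k + 1) (b t)) * (bond (k + 1) (b t)).re) * h3

lemma hasDerivAt_bondV {b : ℝ → Phase N} {t : ℝ} (hb : HasDerivAt b (vectorField (b t)) t)
    (k : ℕ) :
    HasDerivAt (fun s => bondV (k + 1) (b s))
      (-(√3 * (mass (k + 2) (b t) - mass (k + 1) (b t)) * bondV (k + 1) (b t))
        + (√3 * (bondForcing k (b t)).re - (bondForcing k (b t)).im)) t := by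
  have h3 : √3 ^ 2 = (3 : ℝ) := Real.sq_sqrt (by norm_num)
  have hbond := hasDerivAt_bond hb k
  refine (((hasDerivAt_re hbond).const_mul √3).fun_sub (hasDerivAt_im hbond)).congr_deriv ?_
  simp [bondV]
  linear_combination ((mass (k + 2) (b t) - mass (k + 1) (b t)) * (bond (k + 1) (b t)).re) * h3

end Modes

/-! ### Differential inequalities -/

section DifferentialInequalities

variable {f : ℝ → ℝ} {a c s T : ℝ}

lemma le_mul_exp_of_deriv_le (hsT : s ≤ T) (hf : DifferentiableOn ℝ f (Icc s T))
    (h : ∀ t ∈ Ioo s T, deriv f t ≤ a * f t) : f T ≤ f s * Real.exp (a * (T - s)) := by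
  have hexp : Differentiable ℝ fun t => Real.exp (-a * (t - s)) := by fun_prop
  have hanti : AntitoneOn (fun t => f t * Real.exp (-a * (t - s))) (Icc s T) := by
    have hdiff := hf.fun_mul hexp.differentiableOn
    refine antitoneOn_of_deriv_nonpos (convex_Icc s T) hdiff.continuousOn
      (hdiff.mono interior_subset) fun t ht => ?_
    rw [interior_Icc] at ht
    have hft := (hf.differentiableAt (Icc_mem_nhds ht.1 ht.2)).hasDerivAt
    rw [(hft.fun_mul ((((hasDerivAt_id' t).sub_const s).const_mul (-a)).exp)).deriv]
    nlinarith [h t ht, Real.exp_pos (-a * (t - s))]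
  calc f T = f T * Real.exp (-a * (T - s)) * Real.exp (a * (T - s)) := by
        rw [mul_assoc, ← Real.exp_add]
        simp
    _ ≤ f s * Real.exp (-a * (s - s)) * Real.exp (a * (T - s)) :=
        mul_le_mul_of_nonneg_right (hanti (left_mem_Icc.2 hsT) (right_mem_Icc.2 hsT) hsT)
          (Real.exp_pos _).le
    _ = f s * Real.exp (a * (T - s)) := by simp

lemma mul_exp_le_of_le_deriv (hsT : s ≤ T) (hf : DifferentiableOn ℝ f (Icc s T))
    (h : ∀ t ∈ Ioo s T, a * f t ≤ deriv f t) : f s * Real.exp (a * (T - s)) ≤ f T := by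
  have := le_mul_exp_of_deriv_le (a := a) hsT hf.fun_neg fun t ht => by
    rw [deriv.fun_neg]
    linarith [h t ht]
  linarith

lemma le_add_mul_of_deriv_le (hsT : s ≤ T) (hf : DifferentiableOn ℝ f (Icc s T))
    (h : ∀ t ∈ Ioo s T, deriv f t ≤ a) : f T ≤ f s + a * (T - s) := by
  have := (convex_Icc s T).image_sub_le_mul_sub_of_deriv_le hf.continuousOn
    (hf.mono interior_subset) (by rwa [interior_Icc])
    s (left_mem_Icc.2 hsT) T (right_mem_Icc.2 hsT) hsT
  linarith

lemma add_mul_le_of_le_deriv (hsT : s ≤ T) (hf : DifferentiableOn ℝ f (Icc s T))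
    (h : ∀ t ∈ Ioo s T, a ≤ deriv f t) : f s + a * (T - s) ≤ f T := by
  have := (convex_Icc s T).mul_sub_le_image_sub_of_le_deriv hf.continuousOn
    (hf.mono interior_subset) (by rwa [interior_Icc])
    s (left_mem_Icc.2 hsT) T (right_mem_Icc.2 hsT) hsT
  linarith

lemma le_of_deriv_nonneg (hsT : s ≤ T) (hf : DifferentiableOn ℝ f (Icc s T))
    (h : ∀ t ∈ Ioo s T, 0 ≤ deriv f t) : f s ≤ f T := by
  simpa using add_mul_le_of_le_deriv hsT hf h

lemma abs_sub_le_of_abs_deriv_le (hsT : s ≤ T) (hf : DifferentiableOn ℝ f (Icc s T))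
    (h : ∀ t ∈ Ioo s T, |deriv f t| ≤ a) : |f T - f s| ≤ a * (T - s) := by
  have hupper := le_add_mul_of_deriv_le hsT hf fun t ht => (abs_le.1 (h t ht)).2
  have hlower := add_mul_le_of_le_deriv hsT hf fun t ht => (abs_le.1 (h t ht)).1
  rw [abs_le]
  constructor <;> linarith

lemma exists_first_eq (hf : ContinuousOn f (Icc s T)) (hsT : s ≤ T) (hs : f s ≤ c) (hT : c ≤ f T) :
    ∃ t ∈ Icc s T, f t = c ∧ ∀ r ∈ Ico s t, f r < c := by
  have hcompact : IsCompact (Icc s T ∩ f ⁻¹' Ici c) :=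
    isCompact_Icc.of_isClosed_subset (hf.preimage_isClosed_of_isClosed isClosed_Icc isClosed_Ici)
      inter_subset_left
  obtain ⟨t, ⟨htI, htc⟩, hmin⟩ := hcompact.exists_isLeast ⟨T, right_mem_Icc.2 hsT, hT⟩
  obtain ⟨r, hr, hrc⟩ := intermediate_value_Icc htI.1
    (hf.mono (Icc_subset_Icc_right htI.2)) ⟨hs, htc⟩
  have hrt : r = t := hr.2.antisymm (hmin ⟨⟨hr.1, hr.2.trans htI.2⟩, hrc.ge⟩)
  refine ⟨t, htI, hrt ▸ hrc, fun r' hr' => ?_⟩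
  by_contra! hle
  exact hr'.2.not_ge (hmin ⟨⟨hr'.1, hr'.2.le.trans htI.2⟩, hle⟩)

lemma forall_lt_of_bootstrap (hf : Continuous f) (hs : c < f s)
    (h : ∀ t ∈ Icc s T, (∀ r ∈ Ico s t, c < f r) → f t ≠ c) : ∀ t ∈ Icc s T, c < f t := by
  intro t ht
  by_contra! hle
  obtain ⟨r, hr, hrc, hbefore⟩ := exists_first_eq (f := fun t => -f t) (c := -c)
    hf.neg.continuousOn ht.1 (neg_le_neg hs.le) (neg_le_neg hle)
  exact h r ⟨hr.1, hr.2.trans ht.2⟩ (fun r' hr' => neg_lt_neg_iff.1 (hbefore r' hr'))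
    (neg_inj.1 hrc)

end DifferentialInequalities

/-! ### Perturbed hyperbolic pairs -/

/-- `f` is expanded and `g` contracted at the rate `μ`, up to a relative error `√12 X`. -/
structure HyperbolicPair (f g μ X : ℝ → ℝ) : Prop where
  differentiable_left : Differentiable ℝ f
  differentiable_right : Differentiable ℝ g
  nonneg : ∀ t, 0 ≤ X t
  error_le : ∀ t, (deriv f t - μ t * f t) ^ 2 + (deriv g t + μ t * g t) ^ 2
    ≤ 12 * (f t ^ 2 + g t ^ 2) * X t ^ 2

lemma abs_mul_add_mul_le {x y e₁ e₂ X : ℝ} (hX : 0 ≤ X)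
    (h : e₁ ^ 2 + e₂ ^ 2 ≤ 12 * (x ^ 2 + y ^ 2) * X ^ 2) :
    |x * e₁ + y * e₂| ≤ 4 * (x ^ 2 + y ^ 2) * X := by
  refine abs_le_of_sq_le_sq ?_ (by positivity)
  have hcauchy : (x * e₁ + y * e₂) ^ 2 ≤ (x ^ 2 + y ^ 2) * (e₁ ^ 2 + e₂ ^ 2) := by
    linarith [sq_nonneg (x * e₂ - y * e₁)]
  linarith [mul_le_mul_of_nonneg_left h (by positivity : 0 ≤ x ^ 2 + y ^ 2),
    sq_nonneg ((x ^ 2 + y ^ 2) * X)]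

namespace HyperbolicPair

variable {f g μ X : ℝ → ℝ} {s T : ℝ}

lemma swap (h : HyperbolicPair f g μ X) : HyperbolicPair g f (fun t => -μ t) X where
  differentiable_left := h.differentiable_right
  differentiable_right := h.differentiable_left
  nonneg := h.nonneg
  error_le t := by linarith [h.error_le t]

lemma neg_left (h : HyperbolicPair f g μ X) : HyperbolicPair (fun t => -f t) g μ X where
  differentiable_left := h.differentiable_left.fun_neg
  differentiable_right := h.differentiable_right
  nonneg := h.nonneg
  error_le t := by
    rw [deriv.fun_neg]
    linarith [h.error_le t]

lemma two_mul_le_deriv_sq_sub_sq (h : HyperbolicPair f g μ X) (t : ℝ) :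
    2 * (μ t - 4 * X t) * (f t ^ 2 + g t ^ 2) ≤ deriv (fun t => f t ^ 2 - g t ^ 2) t := by
  rw [(((h.differentiable_left t).hasDerivAt.fun_pow 2).fun_sub
    ((h.differentiable_right t).hasDerivAt.fun_pow 2)).deriv]
  have herror := abs_mul_add_mul_le (x := f t) (y := -g t) (h.nonneg t)
    (by simpa only [neg_sq] using h.error_le t)
  norm_num
  linarith [(abs_le.1 herror).1]

lemma deriv_sq_add_sq_le (h : HyperbolicPair f g μ X) (t : ℝ) :
    deriv (fun t => f t ^ 2 + g t ^ 2) t ≤ 2 * (|μ t| + 4 * X t) * (f t ^ 2 + g t ^ 2) := by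
  rw [(((h.differentiable_left t).hasDerivAt.fun_pow 2).fun_add
    ((h.differentiable_right t).hasDerivAt.fun_pow 2)).deriv]
  have herror := abs_mul_add_mul_le (h.nonneg t) (h.error_le t)
  norm_num
  linarith [(abs_le.1 herror).2, mul_le_mul_of_nonneg_right (le_abs_self (μ t)) (sq_nonneg (f t)),
    mul_le_mul_of_nonneg_right (neg_abs_le (μ t)) (sq_nonneg (g t))]

lemma abs_deriv_mul_le (h : HyperbolicPair f g μ X) (t : ℝ) :
    |deriv (fun t => f t * g t) t| ≤ 4 * (f t ^ 2 + g t ^ 2) * X t := by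
  rw [((h.differentiable_left t).hasDerivAt.fun_mul (h.differentiable_right t).hasDerivAt).deriv]
  have herror : |g t * (deriv f t - μ t * f t) + f t * (deriv g t + μ t * g t)|
      ≤ 4 * (g t ^ 2 + f t ^ 2) * X t :=
    abs_mul_add_mul_le (h.nonneg t) (by linarith [h.error_le t])
  convert herror using 2 <;> ring

lemma abs_deriv_sq_sub_le (h : HyperbolicPair f g μ X) {t : ℝ} (hg : g t ^ 2 ≤ 2 * f t ^ 2) :
    |deriv (fun t => f t ^ 2) t - 2 * μ t * f t ^ 2| ≤ 12 * X t * f t ^ 2 := by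
  rw [((h.differentiable_left t).hasDerivAt.fun_pow 2).deriv]
  have hX := h.nonneg t
  have herror : (deriv f t - μ t * f t) ^ 2 ≤ 36 * f t ^ 2 * X t ^ 2 := by
    linarith [h.error_le t, sq_nonneg (deriv g t + μ t * g t),
      mul_le_mul_of_nonneg_right hg (sq_nonneg (X t))]
  refine abs_le_of_sq_le_sq ?_ (by positivity)
  norm_num
  linarith [mul_le_mul_of_nonneg_right herror (sq_nonneg (2 * f t))]

lemma deriv_sq_le (h : HyperbolicPair f g μ X) {t : ℝ} (hg : g t ^ 2 ≤ 2 * f t ^ 2) :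
    deriv (fun t => f t ^ 2) t ≤ 2 * (μ t + 6 * X t) * f t ^ 2 := by
  linarith [(abs_le.1 (h.abs_deriv_sq_sub_le hg)).2]

lemma le_deriv_sq (h : HyperbolicPair f g μ X) {t : ℝ} (hg : g t ^ 2 ≤ 2 * f t ^ 2) :
    2 * (μ t - 6 * X t) * f t ^ 2 ≤ deriv (fun t => f t ^ 2) t := by
  linarith [(abs_le.1 (h.abs_deriv_sq_sub_le hg)).1]

lemma sq_sub_sq_le (h : HyperbolicPair f g μ X) (hsT : s ≤ T)
    (hμ : ∀ t ∈ Ioo s T, 4 * X t ≤ μ t) : f s ^ 2 - g s ^ 2 ≤ f T ^ 2 - g T ^ 2 := by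
  refine le_of_deriv_nonneg (f := fun t => f t ^ 2 - g t ^ 2) hsT
    ((h.differentiable_left.pow 2).sub (h.differentiable_right.pow 2)).differentiableOn
    fun t ht => le_trans ?_ (h.two_mul_le_deriv_sq_sub_sq t)
  have hrate : 0 ≤ μ t - 4 * X t := sub_nonneg.2 (hμ t ht)
  positivity

lemma abs_lt_of_abs_lt (h : HyperbolicPair f g μ X) (hsT : s ≤ T)
    (hμ : ∀ t ∈ Ioo s T, 4 * X t ≤ μ t) (hs : |g s| < f s) : |g T| < f T := by
  have hsq : ∀ t ∈ Icc s T, g t ^ 2 < f t ^ 2 := fun t ht => by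
    have hmono := h.sq_sub_sq_le ht.1 fun r hr => hμ r ⟨hr.1, hr.2.trans_le ht.2⟩
    linarith [sq_lt_sq' (neg_lt.1 ((neg_le_abs (g s)).trans_lt hs)) ((le_abs_self _).trans_lt hs)]
  have hpos : ∀ t ∈ Icc s T, 0 < f t := forall_lt_of_bootstrap h.differentiable_left.continuous
    ((abs_nonneg _).trans_lt hs) fun t ht _ h0 => by
      have := hsq t ht
      rw [h0] at this
      linarith [sq_nonneg (g t)]
  exact abs_lt_of_sq_lt_sq (hsq T (right_mem_Icc.2 hsT)) (hpos T (right_mem_Icc.2 hsT)).le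

end HyperbolicPair

/-! ### Passage from one circle to the next -/

/-- The quantities that govern the passage from one circle to the next one: `A, B, M, J` are the
masses of four consecutive modes, `u, v` the components of the bond between the second and the
third mode, and `p, q` those of the bond between the third and the fourth mode. Here `A` is the
mass of the second mode and `B` that of the first one, and the fourth mode is the last one that is
excited. -/
structure Passage (A B M J u v p q : ℝ → ℝ) : Prop where
  A_nonneg : ∀ t, 0 ≤ A t
  B_nonneg : ∀ t, 0 ≤ B t
  M_nonneg : ∀ t, 0 ≤ M t
  J_nonneg : ∀ t, 0 ≤ J t
  mass_le : ∀ t, A t + B t + M t + J t ≤ 1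
  differentiable_A : Differentiable ℝ A
  differentiable_M : Differentiable ℝ M
  differentiable_J : Differentiable ℝ J
  abs_deriv_A_le : ∀ t, |deriv A t| ≤ 4 * A t * (B t + M t)
  deriv_M : ∀ t, deriv M t = 2 / √3 * (p t ^ 2 - q t ^ 2) - 2 / √3 * (u t ^ 2 - v t ^ 2)
  deriv_J : ∀ t, deriv J t = -(2 / √3 * (p t ^ 2 - q t ^ 2))
  left : HyperbolicPair u v (fun t => √3 * (M t - A t)) (fun t => B t + J t)
  right : HyperbolicPair p q (fun t => √3 * (J t - M t)) A
  left_ge : ∀ t, 2 * (A t * M t) ≤ u t ^ 2 + v t ^ 2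
  left_le : ∀ t, u t ^ 2 + v t ^ 2 ≤ 6 * (A t * M t)
  right_ge : ∀ t, 2 * (M t * J t) ≤ p t ^ 2 + q t ^ 2
  right_le : ∀ t, p t ^ 2 + q t ^ 2 ≤ 6 * (M t * J t)

lemma sqrt_three_bounds : 1.73 < √3 ∧ √3 < 1.74 :=
  ⟨Real.lt_sqrt_of_sq_lt (by norm_num), (Real.sqrt_lt' (by norm_num)).2 (by norm_num)⟩

lemma two_div_sqrt_three_bounds : 1.1 < 2 / √3 ∧ 2 / √3 < 1.2 := by
  obtain ⟨h1, h2⟩ := sqrt_three_bounds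
  constructor
  · rw [lt_div_iff₀ (by linarith)]
    linarith
  · rw [div_lt_iff₀ (by linarith)]
    linarith

lemma abs_two_div_sqrt_three_mul_le (x y : ℝ) :
    |2 / √3 * (x ^ 2 - y ^ 2)| ≤ 1.2 * (x ^ 2 + y ^ 2) := by
  rw [abs_mul, abs_of_pos (by positivity)]
  have habs : |x ^ 2 - y ^ 2| ≤ x ^ 2 + y ^ 2 := by
    rw [abs_le]
    constructor <;> linarith [sq_nonneg x, sq_nonneg y]
  exact mul_le_mul two_div_sqrt_three_bounds.2.le habs (abs_nonneg _) (by norm_num)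

lemma two_mul_abs_lt_of_abs_mul_le {x y k : ℝ} (hle : |x| ≤ y) (hk : |x * y| ≤ 2 * k)
    (hlarge : 8 * k < x ^ 2 + y ^ 2) : 2 * |x| < y := by
  have hy : 0 ≤ y := (abs_nonneg _).trans hle
  rw [abs_mul, abs_of_nonneg hy] at hk
  by_contra! hcon
  have hy2 : y ^ 2 ≤ 2 * (|x| * y) := by linarith [mul_le_mul_of_nonneg_right hcon hy]
  linarith [sq_le_sq' (by linarith [abs_nonneg x, neg_abs_le x]) ((le_abs_self x).trans hle)]

namespace Passage

variable {A B M J u v p q : ℝ → ℝ} {s t T a ρ δ : ℝ}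

lemma neg_p (h : Passage A B M J u v p q) : Passage A B M J u v (fun t => -p t) q :=
  { h with
    deriv_M := by simpa using h.deriv_M
    deriv_J := by simpa using h.deriv_J
    right := h.right.neg_left
    right_ge := by simpa using h.right_ge
    right_le := by simpa using h.right_le }

lemma neg_u (h : Passage A B M J u v p q) : Passage A B M J (fun t => -u t) v p q :=
  { h with
    deriv_M := by simpa using h.deriv_M
    left := h.left.neg_left
    left_ge := by simpa using h.left_ge
    left_le := by simpa using h.left_le }

lemma left_sq_add_sq_le (h : Passage A B M J u v p q) (t : ℝ) : u t ^ 2 + v t ^ 2 ≤ 6 * A t := by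
  have hM : M t ≤ 1 := by linarith [h.mass_le t, h.A_nonneg t, h.B_nonneg t, h.J_nonneg t]
  linarith [h.left_le t, mul_le_of_le_one_right (h.A_nonneg t) hM]

lemma right_sq_add_sq_le (h : Passage A B M J u v p q) (t : ℝ) :
    p t ^ 2 + q t ^ 2 ≤ 6 * J t := by
  have hM : M t ≤ 1 := by linarith [h.mass_le t, h.A_nonneg t, h.B_nonneg t, h.J_nonneg t]
  linarith [h.right_le t, mul_le_of_le_one_left (h.J_nonneg t) hM]

lemma J_le_one (h : Passage A B M J u v p q) (t : ℝ) : J t ≤ 1 := by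
  linarith [h.mass_le t, h.A_nonneg t, h.B_nonneg t, h.M_nonneg t]

lemma abs_deriv_J_le (h : Passage A B M J u v p q) (t : ℝ) : |deriv J t| ≤ 8 * J t := by
  rw [h.deriv_J, abs_neg]
  linarith [abs_two_div_sqrt_three_mul_le (p t) (q t), h.right_sq_add_sq_le t, h.J_nonneg t]

lemma deriv_M_add_J (h : Passage A B M J u v p q) (t : ℝ) :
    deriv (fun t => M t + J t) t = -(2 / √3 * (u t ^ 2 - v t ^ 2)) := by
  rw [deriv_fun_add (h.differentiable_M t) (h.differentiable_J t), h.deriv_M, h.deriv_J]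
  ring

lemma differentiable_M_add_J (h : Passage A B M J u v p q) :
    Differentiable ℝ fun t => M t + J t :=
  h.differentiable_M.add h.differentiable_J

lemma J_le_mul_exp (h : Passage A B M J u v p q) (hsT : s ≤ T) :
    J s ≤ J T * Real.exp (8 * (T - s)) := by
  have hdecay := mul_exp_le_of_le_deriv (a := -8) hsT h.differentiable_J.differentiableOn
    fun t _ => by linarith [(abs_le.1 (h.abs_deriv_J_le t)).1]
  calc J s = J s * Real.exp (-8 * (T - s)) * Real.exp (8 * (T - s)) := by
        rw [mul_assoc, ← Real.exp_add]
        simp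
    _ ≤ _ := mul_le_mul_of_nonneg_right hdecay (Real.exp_pos _).le

lemma A_le_mul_exp (h : Passage A B M J u v p q) (hsT : s ≤ T)
    (hδ : ∀ t ∈ Ioo s T, B t + M t ≤ δ) : A T ≤ A s * Real.exp (4 * δ * (T - s)) :=
  le_mul_exp_of_deriv_le hsT h.differentiable_A.differentiableOn fun t ht => by
    linarith [(le_abs_self _).trans (h.abs_deriv_A_le t),
      mul_le_mul_of_nonneg_left (hδ t ht) (h.A_nonneg t)]

lemma abs_mul_sub_mul_le (h : Passage A B M J u v p q) (hsT : s ≤ T)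
    (hA : ∀ t ∈ Ioo s T, A t ≤ a) : |p T * q T - p s * q s| ≤ 24 * a * (T - s) :=
  abs_sub_le_of_abs_deriv_le (f := fun t => p t * q t) hsT
    (h.right.differentiable_left.mul h.right.differentiable_right).differentiableOn fun t ht => by
      have hsix : p t ^ 2 + q t ^ 2 ≤ 6 := by
        linarith [h.right_sq_add_sq_le t, h.J_le_one t]
      have hbound : (p t ^ 2 + q t ^ 2) * A t ≤ 6 * a :=
        mul_le_mul hsix (hA t ht) (h.A_nonneg t) (by norm_num)
      linarith [h.right.abs_deriv_mul_le t]

lemma M_add_J_sub_le (h : Passage A B M J u v p q) (hsT : s ≤ T)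
    (hA : ∀ t ∈ Ioo s T, A t ≤ a) : M s + J s - 8 * a * (T - s) ≤ M T + J T := by
  have := add_mul_le_of_le_deriv (a := -(8 * a)) hsT h.differentiable_M_add_J.differentiableOn
    fun t ht => by
      rw [h.deriv_M_add_J]
      linarith [(abs_le.1 (abs_two_div_sqrt_three_mul_le (u t) (v t))).2, h.left_sq_add_sq_le t,
        h.A_nonneg t, hA t ht]
  linarith

lemma M_add_J_le_of_contracting (h : Passage A B M J u v p q) (hsT : s ≤ T)
    (hcone : ∀ t ∈ Ioo s T, u t ^ 2 ≤ v t ^ 2) : M s + J s ≤ M T + J T :=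
  le_of_deriv_nonneg hsT h.differentiable_M_add_J.differentiableOn fun t ht => by
    rw [h.deriv_M_add_J]
    have hflux : 0 ≤ 2 / √3 * (v t ^ 2 - u t ^ 2) :=
      mul_nonneg (by positivity) (sub_nonneg.2 (hcone t ht))
    linarith

/-! #### Stay near the circle of the third mode -/

lemma A_lt_of_lt_M (h : Passage A B M J u v p q) (hM : 1 - ρ < M t) : A t < ρ := by
  linarith [h.mass_le t, h.B_nonneg t, h.J_nonneg t]

lemma B_add_J_lt_of_lt_M (h : Passage A B M J u v p q) (hM : 1 - ρ < M t) : B t + J t < ρ := by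
  linarith [h.mass_le t, h.A_nonneg t]

lemma abs_v_lt_u (h : Passage A B M J u v p q) (hsT : s ≤ T)
    (hM : ∀ t ∈ Ioo s T, 99 / 100 < M t) (hs : |v s| < u s) : |v T| < u T := by
  refine h.left.abs_lt_of_abs_lt hsT (fun t ht => ?_) hs
  have hM' : 1 - 1 / 100 < M t := by linarith [hM t ht]
  nlinarith [sqrt_three_bounds.1, h.A_lt_of_lt_M hM', h.B_add_J_lt_of_lt_M hM']

lemma abs_v_lt_neg_u (h : Passage A B M J u v p q) (hsT : s ≤ T)
    (hM : ∀ t ∈ Ioo s T, 99 / 100 < M t) (hs : |v s| < -u s) : |v T| < -u T :=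
  h.neg_u.abs_v_lt_u hsT hM hs

lemma right_growth (h : Passage A B M J u v p q) (hsT : s ≤ T)
    (hM : ∀ t ∈ Ioo s T, 1 - ρ < M t) :
    p T ^ 2 + q T ^ 2 ≤ (p s ^ 2 + q s ^ 2) * Real.exp ((2 * √3 + 8 * ρ) * (T - s)) := by
  refine le_mul_exp_of_deriv_le (f := fun t => p t ^ 2 + q t ^ 2) hsT
    ((h.right.differentiable_left.pow 2).add (h.right.differentiable_right.pow 2)).differentiableOn
    fun t ht => (h.right.deriv_sq_add_sq_le t).trans ?_
  have hrate : |√3 * (J t - M t)| ≤ √3 * 1 := by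
    rw [abs_mul, abs_of_pos (by positivity : 0 < √3)]
    refine mul_le_mul_of_nonneg_left (abs_le.2 ?_) (by positivity)
    constructor <;>
    linarith [h.mass_le t, h.A_nonneg t, h.B_nonneg t, h.M_nonneg t, h.J_nonneg t]
  exact mul_le_mul_of_nonneg_right (by linarith [h.A_lt_of_lt_M (hM t ht)]) (by positivity)

/-- Before `T₀`, the last mode is small because it grows at a bounded rate backwards in time; after
`T₀` its size follows that of the right bond. -/
lemma J_le_of_lt_M (h : Passage A B M J u v p q) {T₀ T₁ : ℝ} (ht : t ∈ Icc 0 T₁)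
    (hρ : 0 < ρ) (hρ1 : ρ ≤ 1 / 100) (hJ : J T₀ * Real.exp (8 * T₀) ≤ ρ / 4)
    (hQ : (p T₀ ^ 2 + q T₀ ^ 2) * Real.exp ((2 * √3 + 8 * ρ) * (T₁ - T₀)) ≤ ρ / 4)
    (hM : ∀ r ∈ Ico T₀ t, 1 - ρ < M r) (hMt : 1 - ρ ≤ M t) : J t ≤ ρ / 3 := by
  rcases le_total t T₀ with htT | htT
  · have hexp : Real.exp (8 * (T₀ - t)) ≤ Real.exp (8 * T₀) :=
      Real.exp_le_exp.2 (by linarith [ht.1])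
    linarith [h.J_le_mul_exp htT, mul_le_mul_of_nonneg_left hexp (h.J_nonneg T₀)]
  · have hexp : Real.exp ((2 * √3 + 8 * ρ) * (t - T₀))
        ≤ Real.exp ((2 * √3 + 8 * ρ) * (T₁ - T₀)) :=
      Real.exp_le_exp.2 (mul_le_mul_of_nonneg_left (by linarith [ht.2]) (by positivity))
    have hbond : p t ^ 2 + q t ^ 2 ≤ ρ / 4 :=
      (h.right_growth htT fun r hr => hM r (Ioo_subset_Ico_self hr)).trans
        ((mul_le_mul_of_nonneg_left hexp (by positivity)).trans hQ)
    nlinarith [h.right_ge t, h.J_nonneg t]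

lemma forall_M_gt_of_contracting (h : Passage A B M J u v p q) {T₀ T₁ : ℝ} (hT₀ : 0 ≤ T₀)
    (hρ : 0 < ρ) (hρ1 : ρ ≤ 1 / 100) (hM0 : 1 - ρ / 4 ≤ M 0)
    (hJ : J T₀ * Real.exp (8 * T₀) ≤ ρ / 4)
    (hQ : (p T₀ ^ 2 + q T₀ ^ 2) * Real.exp ((2 * √3 + 8 * ρ) * (T₁ - T₀)) ≤ ρ / 4)
    (hcone : ∀ t ∈ Icc 0 T₁, (∀ r ∈ Icc 0 t, 1 - ρ < M r) → u t ^ 2 ≤ v t ^ 2) :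
    ∀ t ∈ Icc 0 T₁, 1 - ρ < M t := by
  refine forall_lt_of_bootstrap h.differentiable_M.continuous (by linarith)
    fun t ht hlt heq => ?_
  have hJt : J t ≤ ρ / 3 :=
    h.J_le_of_lt_M ht hρ hρ1 hJ hQ (fun r hr => hlt r ⟨hT₀.trans hr.1, hr.2⟩) heq.ge
  have hMJ : M 0 + J 0 ≤ M t + J t := h.M_add_J_le_of_contracting ht.1 fun r hr =>
    hcone r ⟨hr.1.le, hr.2.le.trans ht.2⟩ fun r' hr' => hlt r' ⟨hr'.1, hr'.2.trans_lt hr.2⟩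
  linarith [h.J_nonneg 0]

lemma v_sq_le_mul_exp (h : Passage A B M J u v p q) (hsT : s ≤ T)
    (hM : ∀ t ∈ Ioo s T, 1 - ρ < M t) (hcone : ∀ t ∈ Ioo s T, u t ^ 2 < 2 * v t ^ 2) :
    v T ^ 2 ≤ v s ^ 2 * Real.exp (-(2 * √3 - 20 * ρ) * (T - s)) :=
  le_mul_exp_of_deriv_le (f := fun t => v t ^ 2) hsT
    (h.left.differentiable_right.pow 2).differentiableOn fun t ht => by
      refine (h.left.swap.deriv_sq_le (hcone t ht).le).trans
        (mul_le_mul_of_nonneg_right ?_ (sq_nonneg _))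
      have hA := h.A_lt_of_lt_M (hM t ht)
      have hρ : 0 ≤ ρ := (h.A_nonneg t).trans hA.le
      have hdom : 1 - 2 * ρ ≤ M t - A t := by linarith [hM t ht]
      linarith [mul_le_mul_of_nonneg_left hdom (Real.sqrt_nonneg 3),
        mul_le_mul_of_nonneg_right sqrt_three_bounds.2.le hρ, h.B_add_J_lt_of_lt_M (hM t ht)]

lemma A_le_of_contracting (h : Passage A B M J u v p q) (hρ1 : ρ ≤ 1 / 100)
    (hM : ∀ t ∈ Icc 0 T, 1 - ρ < M t) (hcone : ∀ t ∈ Icc 0 T, u t ^ 2 < 2 * v t ^ 2)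
    (ht : t ∈ Icc 0 T) : A t ≤ 2 * Real.exp (-((2 * √3 - 20 * ρ) * t)) := by
  have hsub : ∀ r ∈ Ioo 0 t, r ∈ Icc 0 T := fun r hr => ⟨hr.1.le, hr.2.le.trans ht.2⟩
  have hv0 : v 0 ^ 2 ≤ 1 := by
    linarith [h.left_sq_add_sq_le 0, sq_nonneg (u 0),
      h.A_lt_of_lt_M (hM 0 (left_mem_Icc.2 (ht.1.trans ht.2)))]
  have hvt : v t ^ 2 ≤ Real.exp (-((2 * √3 - 20 * ρ) * t)) := by
    have hdecay := h.v_sq_le_mul_exp ht.1 (fun r hr => hM r (hsub r hr))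
      fun r hr => hcone r (hsub r hr)
    rw [sub_zero, neg_mul] at hdecay
    exact hdecay.trans (mul_le_of_le_one_left (Real.exp_pos _).le hv0)
  nlinarith [h.left_ge t, hcone t ht, hM t ht, h.A_nonneg t]

lemma p_sq_le_q_sq (h : Passage A B M J u v p q) (hρ1 : ρ ≤ 1 / 100) (hsT : s ≤ T)
    (hM : ∀ t ∈ Icc s T, 1 - ρ < M t) (hpq : p s ^ 2 ≤ q s ^ 2) : p T ^ 2 ≤ q T ^ 2 := by
  have := h.right.swap.sq_sub_sq_le hsT fun t ht => by
    have hMt := hM t (Ioo_subset_Icc_self ht)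
    nlinarith [sqrt_three_bounds.1, h.A_lt_of_lt_M hMt, h.mass_le t, h.A_nonneg t, h.B_nonneg t]
  linarith

lemma q_pos (h : Passage A B M J u v p q) (hρ1 : ρ ≤ 1 / 100) (hsT : s ≤ T)
    (hM : ∀ t ∈ Icc s T, 1 - ρ < M t) (hJ : ∀ t, 0 < J t) (hq : 0 < q s)
    (hpq : p s ^ 2 ≤ q s ^ 2) : 0 < q T := by
  refine forall_lt_of_bootstrap h.right.differentiable_right.continuous hq
    (fun t ht _ h0 => ?_) T (right_mem_Icc.2 hsT)
  have hcone := h.p_sq_le_q_sq hρ1 ht.1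
    (fun r hr => hM r ⟨hr.1, hr.2.trans ht.2⟩) hpq
  have hMJ : 0 < M t * J t := mul_pos (by linarith [hM t ht]) (hJ t)
  rw [h0] at hcone
  linarith [h.right_ge t, congrArg (· ^ 2) h0]

lemma q_sq_mul_exp_le (h : Passage A B M J u v p q) (hρ1 : ρ ≤ 1 / 100) (hsT : s ≤ T)
    (hM : ∀ t ∈ Icc s T, 1 - ρ < M t) (hpq : p s ^ 2 ≤ q s ^ 2) :
    q s ^ 2 * Real.exp ((2 * √3 - 20 * ρ) * (T - s)) ≤ q T ^ 2 :=
  mul_exp_le_of_le_deriv (f := fun t => q t ^ 2) hsT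
    (h.right.differentiable_right.pow 2).differentiableOn fun t ht => by
      have hMt := hM t (Ioo_subset_Icc_self ht)
      have hcone := h.p_sq_le_q_sq hρ1 ht.1.le
        (fun r hr => hM r ⟨hr.1, hr.2.trans ht.2.le⟩) hpq
      refine le_trans (mul_le_mul_of_nonneg_right ?_ (sq_nonneg _))
        (h.right.swap.le_deriv_sq (by linarith [sq_nonneg (q t)]))
      have hA := h.A_lt_of_lt_M hMt
      have hρ : 0 ≤ ρ := (h.A_nonneg t).trans hA.le
      have hdom : 1 - 2 * ρ ≤ M t - J t := by
        linarith [h.mass_le t, h.A_nonneg t, h.B_nonneg t]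
      linarith [mul_le_mul_of_nonneg_left hdom (Real.sqrt_nonneg 3),
        mul_le_mul_of_nonneg_right sqrt_three_bounds.2.le hρ]

/-- The derivative of `p q` is bounded by the product of the growing right bond and of the decaying
second mass. -/
lemma abs_mul_sub_mul_le_of_decay (h : Passage A B M J u v p q) {T₀ T₁ : ℝ} (hT : T₀ ≤ T₁)
    (hρ : 0 < ρ) (hM : ∀ t ∈ Icc T₀ T₁, 1 - ρ < M t)
    (hA : ∀ t ∈ Icc T₀ T₁, A t ≤ 2 * Real.exp (-((2 * √3 - 20 * ρ) * t)))
    (hpq : p T₀ ^ 2 ≤ q T₀ ^ 2)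
    (hT₁ : 16 * (T₁ - T₀) * Real.exp (-((2 * √3 - 20 * ρ) * T₀) + 28 * ρ * (T₁ - T₀)) ≤ 1 / 4) :
    |p T₁ * q T₁ - p T₀ * q T₀| ≤ q T₀ ^ 2 / 4 := by
  have hdrift := abs_sub_le_of_abs_deriv_le (f := fun t => p t * q t) hT
    (a := q T₀ ^ 2 * (16 * Real.exp (-((2 * √3 - 20 * ρ) * T₀) + 28 * ρ * (T₁ - T₀))))
    (h.right.differentiable_left.mul h.right.differentiable_right).differentiableOn fun t ht => by
      have hbond : p t ^ 2 + q t ^ 2 ≤ 2 * q T₀ ^ 2 * Real.exp ((2 * √3 + 8 * ρ) * (t - T₀)) :=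
        (h.right_growth ht.1.le fun r hr => hM r ⟨hr.1.le, hr.2.le.trans ht.2.le⟩).trans
          (mul_le_mul_of_nonneg_right (by linarith) (Real.exp_pos _).le)
      have hexp : Real.exp ((2 * √3 + 8 * ρ) * (t - T₀)) * Real.exp (-((2 * √3 - 20 * ρ) * t))
          ≤ Real.exp (-((2 * √3 - 20 * ρ) * T₀) + 28 * ρ * (T₁ - T₀)) := by
        rw [← Real.exp_add]
        refine Real.exp_le_exp.2 ?_
        linarith [mul_le_mul_of_nonneg_left ht.2.le hρ.le]
      linarith [h.right.abs_deriv_mul_le t, mul_le_mul_of_nonneg_left hexp (sq_nonneg (q T₀)),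
        mul_le_mul hbond (hA t (Ioo_subset_Icc_self ht)) (h.A_nonneg t) (by positivity)]
  linarith [mul_le_mul_of_nonneg_left hT₁ (sq_nonneg (q T₀))]

/-! #### Transit along the heteroclinic connection -/

lemma le_deriv_J (h : Passage A B M J u v p q) (hpq : 2 * |p t| ≤ q t) :
    1.2 * (M t * J t) ≤ deriv J t := by
  have hsq : 4 * p t ^ 2 ≤ q t ^ 2 := by
    linarith [pow_le_pow_left₀ (by positivity) hpq 2, sq_abs (p t)]
  rw [h.deriv_J]
  nlinarith [two_div_sqrt_three_bounds.1, h.right_ge t]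

lemma transit_cone (h : Passage A B M J u v p q) {k j : ℝ}
    (hM : ∀ t ∈ Icc s T, δ / 4 ≤ M t) (hpq : ∀ t ∈ Icc s T, |p t * q t| ≤ 2 * k)
    (hq : 0 < q s) (hcone : p s ^ 2 ≤ q s ^ 2) (hj : 0 < j) (hjJ : j ≤ J s)
    (hkj : 8 * k < δ / 2 * j) : ∀ t ∈ Icc s T, 2 * |p t| < q t := by
  have hlarge : ∀ t ∈ Icc s T, j ≤ J t → 8 * k < p t ^ 2 + q t ^ 2 := fun t ht hjt => by
    linarith [h.right_ge t, mul_le_mul (hM t ht) hjt hj.le (h.M_nonneg t)]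
  have hcont : Continuous fun t => q t - 2 * |p t| := by
    have := h.right.differentiable_left.continuous
    have := h.right.differentiable_right.continuous
    fun_prop
  intro t₀ ht₀
  have hs : s ∈ Icc s T := left_mem_Icc.2 (ht₀.1.trans ht₀.2)
  have hinit : 2 * |p s| < q s := two_mul_abs_lt_of_abs_mul_le
    (abs_le_of_sq_le_sq hcone hq.le) (hpq s hs) (hlarge s hs hjJ)
  refine sub_pos.1 (forall_lt_of_bootstrap hcont (sub_pos.2 hinit) (fun t ht hlt h0 => ?_) t₀ ht₀)
  have hmono : J s ≤ J t :=
    le_of_deriv_nonneg ht.1 h.differentiable_J.differentiableOn fun r hr =>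
      (mul_nonneg (by norm_num) (mul_nonneg (h.M_nonneg r) (h.J_nonneg r))).trans
        (h.le_deriv_J (sub_pos.1 (hlt r (Ioo_subset_Ico_self hr))).le)
  have := two_mul_abs_lt_of_abs_mul_le (by linarith [abs_nonneg (p t)]) (hpq t ht)
    (hlarge t ht (hjJ.trans hmono))
  linarith

lemma J_mul_exp_le (h : Passage A B M J u v p q) (hsT : s ≤ T)
    (hM : ∀ t ∈ Icc s T, δ / 4 ≤ M t) (hcone : ∀ t ∈ Icc s T, 2 * |p t| < q t) :
    J s * Real.exp (δ / 4 * (T - s)) ≤ J T :=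
  mul_exp_le_of_le_deriv hsT h.differentiable_J.differentiableOn fun t ht => by
    have ht' := Ioo_subset_Icc_self ht
    linarith [h.le_deriv_J (hcone t ht').le, mul_le_mul_of_nonneg_right (hM t ht') (h.J_nonneg t),
      mul_nonneg (h.M_nonneg t) (h.J_nonneg t)]

lemma exists_transit (h : Passage A B M J u v p q) {w k j : ℝ} (hw : 0 ≤ w)
    (hδ : 0 < δ) (hMJ : ∀ t ∈ Icc s (s + w), 1 - δ / 4 ≤ M t + J t)
    (hpq : ∀ t ∈ Icc s (s + w), |p t * q t| ≤ 2 * k)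
    (hq : 0 < q s) (hcone : p s ^ 2 ≤ q s ^ 2) (hj : 0 < j) (hjJ : j ≤ J s)
    (hkj : 8 * k < δ / 2 * j) (hwj : 1 < j * Real.exp (δ / 4 * w)) (hJ : J s < 1 - δ / 2) :
    ∃ t ∈ Icc s (s + w), 1 - δ < J t ∧ ∀ r ∈ Icc s t, 2 * |p r| < q r := by
  have grow : ∀ t ∈ Icc s (s + w), (∀ r ∈ Icc s t, J r ≤ 1 - δ / 2) →
      (∀ r ∈ Icc s t, 2 * |p r| < q r) ∧ J s * Real.exp (δ / 4 * (t - s)) ≤ J t := by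
    intro t ht hJt
    have hsub : Icc s t ⊆ Icc s (s + w) := Icc_subset_Icc_right ht.2
    have hM : ∀ r ∈ Icc s t, δ / 4 ≤ M r := fun r hr => by
      linarith [hMJ r (hsub hr), hJt r hr]
    have hcone := h.transit_cone hM (fun r hr => hpq r (hsub hr)) hq hcone hj hjJ hkj
    exact ⟨hcone, h.J_mul_exp_le ht.1 hM hcone⟩
  have hsw : s ≤ s + w := le_add_of_nonneg_right hw
  obtain ⟨t₀, ht₀, hJt₀⟩ : ∃ t ∈ Icc s (s + w), 1 - δ / 2 < J t := by
    by_contra! hle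
    have hJw := (grow (s + w) (right_mem_Icc.2 hsw) hle).2
    rw [add_sub_cancel_left] at hJw
    linarith [hle _ (right_mem_Icc.2 hsw),
      mul_le_mul_of_nonneg_right hjJ (Real.exp_pos (δ / 4 * w)).le]
  obtain ⟨t, ht, hJt, hbefore⟩ :=
    exists_first_eq h.differentiable_J.continuous.continuousOn ht₀.1 hJ.le hJt₀.le
  have htw : t ∈ Icc s (s + w) := ⟨ht.1, ht.2.trans ht₀.2⟩
  refine ⟨t, htw, by linarith, (grow t htw fun r hr => ?_).1⟩
  rcases hr.2.eq_or_lt with rfl | hrt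
  · exact hJt.le
  · exact (hbefore r ⟨hr.1, hrt⟩).le

/-! #### Exit near the circle of the last mode -/

lemma pos_of_near_next_circle (h : Passage A B M J u v p q) {τ k : ℝ} (hsT : s ≤ T)
    (hTτ : T ≤ s + 2 * τ) (hδ : 0 ≤ δ) (ha : A s ≤ a) (hk : 0 < k)
    (hpq : 2 * k ≤ p s * q s) (hq : 0 < q s)
    (hτ : 48 * τ * (a * Real.exp (8 * δ * τ)) ≤ k) (hJ : ∀ t ∈ Ico s T, 1 - δ < J t) :
    k ≤ p T * q T ∧ 0 < q T ∧ 0 < p T := by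
  have ha0 : 0 ≤ a := (h.A_nonneg s).trans ha
  have hA : ∀ t ∈ Icc s T, A t ≤ a * Real.exp (8 * δ * τ) := fun t ht => by
    have hexp : Real.exp (4 * δ * (t - s)) ≤ Real.exp (8 * δ * τ) :=
      Real.exp_le_exp.2 (by
        linarith [mul_le_mul_of_nonneg_left (by linarith [ht.2] : t - s ≤ 2 * τ) hδ])
    refine (h.A_le_mul_exp ht.1 (δ := δ) fun r hr => ?_).trans
      (mul_le_mul ha hexp (Real.exp_pos _).le ha0)
    linarith [h.mass_le r, h.A_nonneg r, hJ r ⟨hr.1.le, hr.2.trans_le ht.2⟩]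
  have hkt : ∀ t ∈ Icc s T, k ≤ p t * q t := fun t ht => by
    have hdrift := h.abs_mul_sub_mul_le ht.1
      fun r hr => hA r ⟨hr.1.le, hr.2.le.trans ht.2⟩
    have htime : 24 * (a * Real.exp (8 * δ * τ)) * (t - s)
        ≤ 24 * (a * Real.exp (8 * δ * τ)) * (2 * τ) :=
      mul_le_mul_of_nonneg_left (by linarith [ht.2]) (by positivity)
    linarith [(abs_le.1 hdrift).1]
  have hqT : 0 < q T := forall_lt_of_bootstrap h.right.differentiable_right.continuous hq
    (fun t ht _ h0 => by
      have := hkt t ht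
      rw [h0, mul_zero] at this
      linarith) T (right_mem_Icc.2 hsT)
  have hkT := hkt T (right_mem_Icc.2 hsT)
  exact ⟨hkT, hqT, pos_of_mul_pos_left (hk.trans_le hkT) hqT.le⟩

lemma forall_J_gt_of_p_le_q (h : Passage A B M J u v p q) {τ k : ℝ}
    (hTτ : T ≤ s + 2 * τ) (hδ : 0 ≤ δ) (ha : A s ≤ a) (hk : 0 < k)
    (hpq : 2 * k ≤ p s * q s) (hq : 0 < q s) (hJ : 1 - δ < J s)
    (hτ : 48 * τ * (a * Real.exp (8 * δ * τ)) ≤ k)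
    (hcone : ∀ t ∈ Ico s T, (∀ r ∈ Icc s t, 1 - δ < J r) → p t ≤ q t) :
    ∀ t ∈ Icc s T, 1 - δ < J t := by
  refine forall_lt_of_bootstrap h.differentiable_J.continuous hJ fun t ht hlt => ?_
  refine (hJ.trans_le (le_of_deriv_nonneg ht.1 h.differentiable_J.differentiableOn
    fun r hr => ?_)).ne'
  have hJr : ∀ r' ∈ Icc s r, 1 - δ < J r' := fun r' hr' => hlt r' ⟨hr'.1, hr'.2.trans_lt hr.2⟩
  obtain ⟨-, -, hp⟩ := h.pos_of_near_next_circle hr.1.le (by linarith [hr.2, ht.2]) hδ ha hk hpq hq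
    hτ fun r' hr' => hJr r' (Ico_subset_Icc_self hr')
  have hsq : p r ^ 2 ≤ q r ^ 2 :=
    pow_le_pow_left₀ hp.le (hcone r ⟨hr.1.le, hr.2.trans_le ht.2⟩ hJr) 2
  rw [h.deriv_J]
  linarith [mul_nonneg (by positivity : 0 ≤ 2 / √3) (sub_nonneg.2 hsq)]

lemma q_sq_le_mul_exp_of_p_le_q (h : Passage A B M J u v p q) (hsT : s ≤ T) (hδ1 : δ ≤ 1 / 100)
    (hJ : ∀ t ∈ Ioo s T, 1 - δ < J t) (hcone : ∀ t ∈ Ioo s T, p t ^ 2 ≤ q t ^ 2) :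
    q T ^ 2 ≤ q s ^ 2 * Real.exp (-3 * (T - s)) :=
  le_mul_exp_of_deriv_le (f := fun t => q t ^ 2) hsT
    (h.right.differentiable_right.pow 2).differentiableOn fun t ht => by
      refine (h.right.swap.deriv_sq_le (by linarith [hcone t ht, sq_nonneg (q t)])).trans
        (mul_le_mul_of_nonneg_right ?_ (sq_nonneg _))
      nlinarith [sqrt_three_bounds.1, hJ t ht, h.mass_le t, h.A_nonneg t, h.B_nonneg t,
        h.M_nonneg t]

/-- While the right bond stays in the contracting cone, its component `q` decays; since `p q` stays
above `k`, this cannot last longer than `2 τ`. -/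
lemma exists_exit (h : Passage A B M J u v p q) {τ k : ℝ} (hτ0 : 0 ≤ τ) (hδ : 0 ≤ δ)
    (hδ1 : δ ≤ 1 / 100) (ha : A s ≤ a) (hk : 0 < k) (hpq : 2 * k ≤ p s * q s)
    (hq : 0 < q s) (hJ : 1 - δ < J s)
    (hτ : 48 * τ * (a * Real.exp (8 * δ * τ)) ≤ k) (hkτ : 6 * Real.exp (-(6 * τ)) < k) :
    ∃ t, s ≤ t ∧ (∀ r ∈ Icc s t, 1 - δ < J r) ∧ |q t| < p t := by
  have control : ∀ t, s ≤ t → t ≤ s + 2 * τ → (∀ r ∈ Icc s t, 1 - δ < J r) →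
      k ≤ p t * q t ∧ 0 < q t ∧ 0 < p t := fun t hst htτ hJt =>
    h.pos_of_near_next_circle hst htτ hδ ha hk hpq hq hτ fun r hr => hJt r (Ico_subset_Icc_self hr)
  by_contra! hnone
  have hcone : ∀ t ∈ Icc s (s + 2 * τ), (∀ r ∈ Icc s t, 1 - δ < J r) → p t ≤ q t :=
    fun t ht hJt => (hnone t ht.1 hJt).trans_eq (abs_of_pos (control t ht.1 ht.2 hJt).2.1)
  have hJt := h.forall_J_gt_of_p_le_q le_rfl hδ ha hk hpq hq hJ hτ
    fun t ht => hcone t (Ico_subset_Icc_self ht)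
  have hJt' : ∀ t ∈ Icc s (s + 2 * τ), ∀ r ∈ Icc s t, 1 - δ < J r :=
    fun t ht r hr => hJt r ⟨hr.1, hr.2.trans ht.2⟩
  have hend : s + 2 * τ ∈ Icc s (s + 2 * τ) := right_mem_Icc.2 (by linarith)
  have hdecay := h.q_sq_le_mul_exp_of_p_le_q hend.1 hδ1
    (fun t ht => hJt t (Ioo_subset_Icc_self ht)) fun t ht => by
      have ht' := Ioo_subset_Icc_self ht
      exact pow_le_pow_left₀ (control t ht'.1 ht'.2 (hJt' t ht')).2.2.le
        (hcone t ht' (hJt' t ht')) 2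
  obtain ⟨hkp, hqpos, -⟩ := control _ hend.1 le_rfl (hJt' _ hend)
  have hqs : q s ^ 2 ≤ 6 := by
    linarith [h.right_sq_add_sq_le s, h.J_le_one s, sq_nonneg (p s)]
  rw [show -3 * (s + 2 * τ - s) = -(6 * τ) by ring] at hdecay
  linarith [mul_le_mul_of_nonneg_right (hcone _ hend (hJt' _ hend)) hqpos.le,
    mul_le_mul_of_nonneg_right hqs (Real.exp_pos (-(6 * τ))).le]

end Passage

/-! ### Choice of the scales -/

/-- The scales of the passage past one circle, for a flow with Lipschitz exponent `K`: mass is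
inserted in the next mode at the time `T₀`, with a bond of size `η`; the left bond stays in the
contracting cone up to the time `T₀ + τ`, when the mass of the next mode is at least `j`; the
transit to the next circle takes a time at most `w`, during which the mass left behind is at most
`a`. The orbit stays `ρ`-close to the old circle before the transit, gets `δ`-close to the new one,
and its initial datum is displaced by less than `R`. -/
structure Scales (K δ ρ R : ℝ) where
  (T₀ τ w η a j : ℝ)
  ρ_pos : 0 < ρ
  ρ_le : ρ ≤ δ / 8
  δ_le : δ ≤ 1 / 100
  T₀_nonneg : 0 ≤ T₀
  τ_nonneg : 0 ≤ τ
  w_nonneg : 0 ≤ w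
  η_pos : 0 < η
  η_le : η ≤ 1 / 10
  j_pos : 0 < j
  next_mass_le : η ^ 2 * Real.exp (8 * T₀) ≤ ρ / 4
  next_bond_le : 2 * η ^ 2 * Real.exp ((2 * √3 + 8 * ρ) * τ) ≤ ρ / 4
  drift_le : 16 * τ * Real.exp (-((2 * √3 - 20 * ρ) * T₀) + 28 * ρ * τ) ≤ 1 / 4
  left_mass_le : 2 * Real.exp (-((2 * √3 - 20 * ρ) * (T₀ + τ))) * Real.exp (4 * w) ≤ a
  mass_loss_le : 8 * a * w ≤ ρ
  transit_drift_le : 24 * a * w ≤ η ^ 2 / 16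
  exit_drift_le : 48 * τ * (a * Real.exp (8 * δ * τ)) ≤ η ^ 2 / 16
  exit_decay_lt : 6 * Real.exp (-(6 * τ)) < η ^ 2 / 16
  j_le : j ≤ η ^ 2 / 24 * Real.exp ((2 * √3 - 20 * ρ) * τ)
  lt_j : 8 * η ^ 2 < δ / 2 * j
  one_lt_j_mul_exp : 1 < j * Real.exp (δ / 4 * w)
  displacement_lt : 2 * η * Real.exp (K * T₀) < R

/-- The time `T` is so long that, with `τ = (K + 8) T`, all error terms of the passage past a
circle are negligible. -/
structure LongTime (K δ ρ R T τ : ℝ) : Prop where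
  K_nonneg : 0 ≤ K
  ρ_pos : 0 < ρ
  ρ_mul : ρ * (8000 * (K + 8)) = δ
  δ_mul_le : δ * (100 * (K + 8)) ≤ 1
  τ_eq : τ = (K + 8) * T
  T_nonneg : 0 ≤ T
  mul_exp_le : τ * Real.exp (-T) ≤ ρ / 12288
  exp_lt : Real.exp (-T) < ρ / 768
  exp_lt_radius : Real.exp (-T) < R / 2
  lt_exp : 192 / ρ < Real.exp (δ / 64 * T)

/-- The size of the bond inserted in the next mode: growing at the rate `√3 + 4ρ`, it reaches the
size `√(ρ / 8)` after the time `τ`. -/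
noncomputable def bondScale (ρ τ : ℝ) : ℝ := √(ρ / 8) * Real.exp (-((√3 + 4 * ρ) * τ))

lemma bondScale_sq {ρ : ℝ} (hρ : 0 ≤ ρ) (τ : ℝ) :
    bondScale ρ τ ^ 2 = ρ / 8 * Real.exp (-((2 * √3 + 8 * ρ) * τ)) := by
  rw [bondScale, mul_pow, Real.sq_sqrt (by positivity), ← Real.exp_nat_mul]
  congr 2
  push_cast
  ring

lemma bondScale_sq_mul_exp {ρ : ℝ} (hρ : 0 ≤ ρ) (τ c : ℝ) :
    bondScale ρ τ ^ 2 * Real.exp c = ρ / 8 * Real.exp (-((2 * √3 + 8 * ρ) * τ) + c) := by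
  rw [bondScale_sq hρ, mul_assoc, ← Real.exp_add]

lemma two_mul_bondScale_sq_mul_exp {ρ : ℝ} (hρ : 0 ≤ ρ) (τ : ℝ) :
    2 * bondScale ρ τ ^ 2 * Real.exp ((2 * √3 + 8 * ρ) * τ) = ρ / 4 := by
  rw [mul_assoc, bondScale_sq_mul_exp hρ, neg_add_cancel, Real.exp_zero]
  ring

lemma bondScale_sq_div_mul_exp {ρ : ℝ} (hρ : 0 ≤ ρ) (τ : ℝ) :
    bondScale ρ τ ^ 2 / 24 * Real.exp ((2 * √3 - 20 * ρ) * τ)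
      = ρ / 192 * Real.exp (-(28 * ρ * τ)) := by
  rw [div_mul_eq_mul_div, bondScale_sq_mul_exp hρ]
  ring_nf

lemma exists_longTime {K δ ρ R : ℝ} (hK : 0 ≤ K) (hρ : 0 < ρ) (hρδ : ρ * (8000 * (K + 8)) = δ)
    (hδ : δ * (100 * (K + 8)) ≤ 1) (hR : 0 < R) : ∃ T τ, LongTime K δ ρ R T τ := by
  have hδ0 : 0 < δ := by rw [← hρδ]; positivity
  have hexp : ∀ c : ℝ, 0 < c → ∀ᶠ T : ℝ in atTop, Real.exp (-T) < c := fun c hc =>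
    Real.tendsto_exp_neg_atTop_nhds_zero.eventually (gt_mem_nhds hc)
  have hmul : Tendsto (fun T : ℝ => (K + 8) * T * Real.exp (-T)) atTop (𝓝 0) := by
    simpa [mul_assoc] using
      (Real.tendsto_pow_mul_exp_neg_atTop_nhds_zero 1).const_mul (K + 8)
  have hbig : Tendsto (fun T : ℝ => Real.exp (δ / 64 * T)) atTop atTop :=
    Real.tendsto_exp_atTop.comp (tendsto_id.const_mul_atTop (by positivity))
  obtain ⟨T, hT, h1, h2, h3, h4⟩ := ((eventually_ge_atTop (0 : ℝ)).and
    ((hmul.eventually (gt_mem_nhds (by positivity : 0 < ρ / 12288))).and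
    ((hexp (ρ / 768) (by positivity)).and ((hexp (R / 2) (by positivity)).and
    (hbig.eventually (eventually_gt_atTop (192 / ρ))))))).exists
  exact ⟨T, (K + 8) * T, hK, hρ, hρδ, hδ, rfl, hT, h1.le, h2, h3, h4⟩

namespace LongTime

variable {K δ ρ R T τ : ℝ}

lemma δ_pos (h : LongTime K δ ρ R T τ) : 0 < δ := by
  have := h.K_nonneg
  have := h.ρ_pos
  rw [← h.ρ_mul]
  positivity

lemma ρ_le (h : LongTime K δ ρ R T τ) : ρ ≤ 1 / 10000 := by
  nlinarith [h.ρ_mul, h.δ_mul_le, h.K_nonneg, h.ρ_pos, h.δ_pos]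

lemma τ_nonneg (h : LongTime K δ ρ R T τ) : 0 ≤ τ := by
  rw [h.τ_eq]
  exact mul_nonneg (by linarith [h.K_nonneg]) h.T_nonneg

lemma mul_τ_eq (h : LongTime K δ ρ R T τ) : 8000 * (ρ * τ) = δ * T := by
  rw [h.τ_eq, ← h.ρ_mul]
  ring

lemma δ_mul_τ_le (h : LongTime K δ ρ R T τ) : 100 * (δ * τ) ≤ T := by
  have := mul_le_mul_of_nonneg_right h.δ_mul_le h.T_nonneg
  rw [h.τ_eq]
  linarith

lemma mul_T_le_τ (h : LongTime K δ ρ R T τ) : 8 * T ≤ τ := by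
  rw [h.τ_eq]
  nlinarith [mul_nonneg h.K_nonneg h.T_nonneg]

lemma ρ_mul_τ_le (h : LongTime K δ ρ R T τ) : 800000 * (ρ * τ) ≤ T := by
  linarith [h.mul_τ_eq, h.δ_mul_τ_le, mul_le_mul_of_nonneg_left h.mul_T_le_τ h.δ_pos.le,
    mul_nonneg h.δ_pos.le h.T_nonneg]

lemma sqrt_three_mul_τ_ge (h : LongTime K δ ρ R T τ) : 1.73 * τ ≤ √3 * τ :=
  mul_le_mul_of_nonneg_right sqrt_three_bounds.1.le h.τ_nonneg

lemma sqrt_three_mul_τ_le (h : LongTime K δ ρ R T τ) : √3 * τ ≤ 1.74 * τ :=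
  mul_le_mul_of_nonneg_right sqrt_three_bounds.2.le h.τ_nonneg

lemma sqrt_three_mul_T_ge (h : LongTime K δ ρ R T τ) : 1.73 * T ≤ √3 * T :=
  mul_le_mul_of_nonneg_right sqrt_three_bounds.1.le h.T_nonneg

lemma ρ_mul_T_le (h : LongTime K δ ρ R T τ) : ρ * T ≤ 1 / 10000 * T :=
  mul_le_mul_of_nonneg_right h.ρ_le h.T_nonneg

lemma ρ_mul_τ_nonneg (h : LongTime K δ ρ R T τ) : 0 ≤ ρ * τ := mul_nonneg h.ρ_pos.le h.τ_nonneg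

lemma exp_le_one (h : LongTime K δ ρ R T τ) : Real.exp (-((2 * √3 + 8 * ρ) * τ)) ≤ 1 :=
  Real.exp_le_one_iff.2 (by
    linarith [h.ρ_mul_τ_nonneg, h.sqrt_three_mul_τ_ge, h.τ_nonneg])

lemma bondScale_le (h : LongTime K δ ρ R T τ) : bondScale ρ τ ≤ 1 / 10 := by
  refine le_of_sq_le_sq ?_ (by norm_num)
  rw [bondScale_sq h.ρ_pos.le]
  linarith [mul_le_mul_of_nonneg_left h.exp_le_one h.ρ_pos.le, h.ρ_le]

lemma bondScale_sq_mul_exp_le (h : LongTime K δ ρ R T τ) :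
    bondScale ρ τ ^ 2 * Real.exp (8 * T) ≤ ρ / 4 := by
  have hexp : Real.exp (-((2 * √3 + 8 * ρ) * τ) + 8 * T) ≤ 1 := Real.exp_le_one_iff.2 (by
    linarith [h.mul_T_le_τ, h.sqrt_three_mul_τ_ge, h.ρ_mul_τ_nonneg, h.τ_nonneg])
  rw [bondScale_sq_mul_exp h.ρ_pos.le]
  linarith [mul_le_mul_of_nonneg_left hexp h.ρ_pos.le, h.ρ_pos]

lemma drift_le (h : LongTime K δ ρ R T τ) :
    16 * τ * Real.exp (-((2 * √3 - 20 * ρ) * T) + 28 * ρ * τ) ≤ 1 / 4 := by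
  have hexp : Real.exp (-((2 * √3 - 20 * ρ) * T) + 28 * ρ * τ) ≤ Real.exp (-T) :=
    Real.exp_le_exp.2 (by
      linarith [h.sqrt_three_mul_T_ge, h.ρ_mul_T_le, h.ρ_mul_τ_le, h.T_nonneg])
  linarith [mul_le_mul_of_nonneg_left hexp h.τ_nonneg, h.mul_exp_le, h.ρ_le]

lemma left_mass_le (h : LongTime K δ ρ R T τ) :
    2 * Real.exp (-((2 * √3 - 20 * ρ) * (T + τ))) * Real.exp (4 * (T / 8))
      ≤ 2 * Real.exp (-((2 * √3 + 8 * ρ) * τ) - 2 * T) := by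
  rw [mul_assoc, ← Real.exp_add]
  refine mul_le_mul_of_nonneg_left (Real.exp_le_exp.2 ?_) zero_le_two
  linarith [h.sqrt_three_mul_T_ge, h.ρ_mul_T_le, h.ρ_mul_τ_le, h.T_nonneg]

lemma mul_exp_sub_le (h : LongTime K δ ρ R T τ) :
    T * Real.exp (-((2 * √3 + 8 * ρ) * τ) - 2 * T)
      ≤ ρ / 12288 * Real.exp (-((2 * √3 + 8 * ρ) * τ)) := by
  have hT : T * Real.exp (-(2 * T)) ≤ ρ / 12288 :=
    (mul_le_mul (by linarith [h.mul_T_le_τ, h.T_nonneg] : T ≤ τ)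
      (Real.exp_le_exp.2 (by linarith [h.T_nonneg])) (Real.exp_pos _).le h.τ_nonneg).trans
      h.mul_exp_le
  rw [sub_eq_add_neg, Real.exp_add]
  linarith [mul_le_mul_of_nonneg_left hT (Real.exp_pos (-((2 * √3 + 8 * ρ) * τ))).le]

lemma mass_loss_le (h : LongTime K δ ρ R T τ) :
    8 * (2 * Real.exp (-((2 * √3 + 8 * ρ) * τ) - 2 * T)) * (T / 8) ≤ ρ := by
  linarith [h.mul_exp_sub_le, mul_le_mul_of_nonneg_left h.exp_le_one h.ρ_pos.le, h.ρ_pos]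

lemma transit_drift_le (h : LongTime K δ ρ R T τ) :
    24 * (2 * Real.exp (-((2 * √3 + 8 * ρ) * τ) - 2 * T)) * (T / 8)
      ≤ bondScale ρ τ ^ 2 / 16 := by
  rw [bondScale_sq h.ρ_pos.le]
  linarith [h.mul_exp_sub_le, mul_pos h.ρ_pos (Real.exp_pos (-((2 * √3 + 8 * ρ) * τ)))]

lemma exit_drift_le (h : LongTime K δ ρ R T τ) :
    48 * τ * (2 * Real.exp (-((2 * √3 + 8 * ρ) * τ) - 2 * T) * Real.exp (8 * δ * τ))
      ≤ bondScale ρ τ ^ 2 / 16 := by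
  have hexp : Real.exp (-((2 * √3 + 8 * ρ) * τ) - 2 * T) * Real.exp (8 * δ * τ)
      ≤ Real.exp (-((2 * √3 + 8 * ρ) * τ)) * Real.exp (-T) := by
    rw [← Real.exp_add, ← Real.exp_add]
    exact Real.exp_le_exp.2 (by linarith [h.δ_mul_τ_le, h.T_nonneg])
  rw [bondScale_sq h.ρ_pos.le]
  linarith [mul_le_mul_of_nonneg_left hexp h.τ_nonneg,
    mul_le_mul_of_nonneg_left h.mul_exp_le (Real.exp_pos (-((2 * √3 + 8 * ρ) * τ))).le]

lemma exit_decay_lt (h : LongTime K δ ρ R T τ) :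
    6 * Real.exp (-(6 * τ)) < bondScale ρ τ ^ 2 / 16 := by
  have hexp : Real.exp (-(6 * τ)) ≤ Real.exp (-((2 * √3 + 8 * ρ) * τ)) * Real.exp (-T) := by
    rw [← Real.exp_add]
    refine Real.exp_le_exp.2 ?_
    linarith [h.sqrt_three_mul_τ_le, h.ρ_mul_τ_le, h.mul_T_le_τ, h.T_nonneg]
  rw [bondScale_sq h.ρ_pos.le]
  linarith [mul_lt_mul_of_pos_left h.exp_lt (Real.exp_pos (-((2 * √3 + 8 * ρ) * τ)))]

lemma bondScale_sq_lt (h : LongTime K δ ρ R T τ) :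
    8 * bondScale ρ τ ^ 2 < δ / 2 * (ρ / 192 * Real.exp (-(28 * ρ * τ))) := by
  have hexp : Real.exp (-((2 * √3 + 8 * ρ) * τ))
      ≤ Real.exp (-(28 * ρ * τ)) * Real.exp (-T) := by
    rw [← Real.exp_add]
    refine Real.exp_le_exp.2 ?_
    linarith [h.sqrt_three_mul_τ_ge, h.ρ_mul_τ_le, h.mul_T_le_τ, h.T_nonneg]
  have hδ : Real.exp (-T) < δ / 384 := by
    nlinarith [h.exp_lt, h.ρ_mul, h.K_nonneg, h.ρ_pos]
  have hlt := hexp.trans_lt (mul_lt_mul_of_pos_left hδ (Real.exp_pos (-(28 * ρ * τ))))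
  rw [bondScale_sq h.ρ_pos.le]
  linarith [mul_lt_mul_of_pos_left hlt h.ρ_pos]

lemma one_lt_mul_exp (h : LongTime K δ ρ R T τ) :
    1 < ρ / 192 * Real.exp (-(28 * ρ * τ)) * Real.exp (δ / 4 * (T / 8)) := by
  have hexp : Real.exp (δ / 64 * T)
      ≤ Real.exp (-(28 * ρ * τ)) * Real.exp (δ / 4 * (T / 8)) := by
    rw [← Real.exp_add]
    refine Real.exp_le_exp.2 ?_
    linarith [h.mul_τ_eq, mul_nonneg h.δ_pos.le h.T_nonneg]
  have hlt := (div_lt_iff₀ h.ρ_pos).1 (h.lt_exp.trans_le hexp)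
  linarith

lemma displacement_lt (h : LongTime K δ ρ R T τ) :
    2 * bondScale ρ τ * Real.exp (K * T) < R := by
  have hsqrt : √(ρ / 8) ≤ 1 := Real.sqrt_le_one.2 (by linarith [h.ρ_le])
  have hexp : Real.exp (-((√3 + 4 * ρ) * τ)) * Real.exp (K * T) ≤ Real.exp (-T) := by
    rw [← Real.exp_add]
    refine Real.exp_le_exp.2 ?_
    linarith [h.τ_eq, h.sqrt_three_mul_τ_ge, h.ρ_mul_τ_nonneg, h.τ_nonneg, h.T_nonneg]
  have hle : √(ρ / 8) * (Real.exp (-((√3 + 4 * ρ) * τ)) * Real.exp (K * T))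
      ≤ 1 * Real.exp (-T) := mul_le_mul hsqrt hexp (by positivity) zero_le_one
  rw [bondScale]
  linarith [h.exp_lt_radius]

end LongTime

theorem exists_scales {K δ ρ R : ℝ} (hK : 0 ≤ K) (hρ : 0 < ρ) (hρδ : ρ * (8000 * (K + 8)) = δ)
    (hδ : δ * (100 * (K + 8)) ≤ 1) (hR : 0 < R) : Nonempty (Scales K δ ρ R) := by
  obtain ⟨T, τ, h⟩ := exists_longTime hK hρ hρδ hδ hR
  exact ⟨{
    T₀ := T
    τ := τ
    w := T / 8
    η := bondScale ρ τ
    a := 2 * Real.exp (-((2 * √3 + 8 * ρ) * τ) - 2 * T)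
    j := ρ / 192 * Real.exp (-(28 * ρ * τ))
    ρ_pos := hρ
    ρ_le := by linarith [mul_nonneg hρ.le hK]
    δ_le := by linarith [mul_nonneg h.δ_pos.le hK]
    T₀_nonneg := h.T_nonneg
    τ_nonneg := h.τ_nonneg
    w_nonneg := div_nonneg h.T_nonneg (by norm_num)
    η_pos := by unfold bondScale; positivity
    η_le := h.bondScale_le
    j_pos := by positivity
    next_mass_le := h.bondScale_sq_mul_exp_le
    next_bond_le := (two_mul_bondScale_sq_mul_exp hρ.le τ).le
    drift_le := h.drift_le
    left_mass_le := h.left_mass_le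
    mass_loss_le := h.mass_loss_le
    transit_drift_le := h.transit_drift_le
    exit_drift_le := h.exit_drift_le
    exit_decay_lt := h.exit_decay_lt
    j_le := (bondScale_sq_div_mul_exp hρ.le τ).ge
    lt_j := h.bondScale_sq_lt
    one_lt_j_mul_exp := h.one_lt_mul_exp
    displacement_lt := h.displacement_lt }⟩

section

variable {N : ℕ} {K : ℝ} {φ : Flow ℝ (Phase N)} {x : Phase N} {k : ℕ}

namespace IsSphereFlow

lemma hasDerivAt_mass (h : IsSphereFlow K φ) (hx : ‖x‖ = 1) (k : ℕ) (t : ℝ) :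
    HasDerivAt (fun s => mass (k + 1) (φ s x)) (flux (k + 1) (φ t x) - flux k (φ t x)) t :=
  ToyModel.hasDerivAt_mass (h.isSolution x hx t) k

lemma differentiable_mass (h : IsSphereFlow K φ) (hx : ‖x‖ = 1) (k : ℕ) :
    Differentiable ℝ fun t => mass (k + 1) (φ t x) := fun t =>
  (h.hasDerivAt_mass hx k t).differentiableAt

lemma abs_deriv_mass_le (h : IsSphereFlow K φ) (hx : ‖x‖ = 1) (k : ℕ) (t : ℝ) :
    |deriv (fun s => mass (k + 1) (φ s x)) t|
      ≤ 4 * mass (k + 1) (φ t x) * (mass k (φ t x) + mass (k + 2) (φ t x)) := by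
  rw [(h.hasDerivAt_mass hx k t).deriv]
  linarith [abs_sub (flux (k + 1) (φ t x)) (flux k (φ t x)), abs_flux_le k (φ t x),
    abs_flux_le (k + 1) (φ t x)]

lemma sum_four_mass_le_one (h : IsSphereFlow K φ) (hx : ‖x‖ = 1) (k : ℕ) (t : ℝ) :
    mass k (φ t x) + mass (k + 1) (φ t x) + mass (k + 2) (φ t x) + mass (k + 3) (φ t x) ≤ 1 := by
  simpa only [h.norm_eq t x hx, one_pow] using sum_four_mass_le (φ t x) k

lemma abs_deriv_mass_le_four_mul (h : IsSphereFlow K φ) (hx : ‖x‖ = 1) (k : ℕ) (t : ℝ) :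
    |deriv (fun s => mass (k + 1) (φ s x)) t| ≤ 4 * mass (k + 1) (φ t x) := by
  refine (h.abs_deriv_mass_le hx k t).trans
    (mul_le_of_le_one_right (mul_nonneg (by norm_num) (mass_nonneg _ _)) ?_)
  linarith [h.sum_four_mass_le_one hx k t, mass_nonneg (k + 1) (φ t x),
    mass_nonneg (k + 3) (φ t x)]

lemma mass_eq_zero (h : IsSphereFlow K φ) (hx : ‖x‖ = 1) (hk : mass k x = 0) (t : ℝ) :
    mass k (φ t x) = 0 := by
  rcases k with - | k
  · simp [mass, mode_zero]
  refine le_antisymm ?_ (mass_nonneg _ _)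
  have hdiff : ∀ s, DifferentiableOn ℝ (fun r => mass (k + 1) (φ r x)) s := fun _ =>
    (h.differentiable_mass hx k).differentiableOn
  rcases le_total 0 t with ht | ht
  · simpa [hk] using le_mul_exp_of_deriv_le (a := 4) ht (hdiff _) fun r _ =>
      (abs_le.1 (h.abs_deriv_mass_le_four_mul hx k r)).2
  · refine nonpos_of_mul_nonpos_left (b := Real.exp (-4 * (0 - t))) ?_ (Real.exp_pos _)
    simpa [hk] using mul_exp_le_of_le_deriv (a := -4) ht (hdiff _) fun r _ => by
      linarith [(abs_le.1 (h.abs_deriv_mass_le_four_mul hx k r)).1]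

lemma mass_pos (h : IsSphereFlow K φ) (hx : ‖x‖ = 1) (hk : 0 < mass k x) (t : ℝ) :
    0 < mass k (φ t x) := by
  refine (mass_nonneg _ _).lt_of_ne fun h0 => hk.ne' ?_
  simpa [← Flow.map_add] using h.mass_eq_zero (h.norm_eq t x hx) h0.symm (-t)

lemma hyperbolicPair (h : IsSphereFlow K φ) (hx : ‖x‖ = 1) (k : ℕ) :
    HyperbolicPair (fun t => bondU (k + 1) (φ t x)) (fun t => bondV (k + 1) (φ t x))
      (fun t => √3 * (mass (k + 2) (φ t x) - mass (k + 1) (φ t x)))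
      (fun t => mass k (φ t x) + mass (k + 3) (φ t x)) where
  differentiable_left t := (hasDerivAt_bondU (h.isSolution x hx t) k).differentiableAt
  differentiable_right t := (hasDerivAt_bondV (h.isSolution x hx t) k).differentiableAt
  nonneg t := add_nonneg (mass_nonneg _ _) (mass_nonneg _ _)
  error_le t := by
    have h3 : √3 ^ 2 = (3 : ℝ) := Real.sq_sqrt (by norm_num)
    have hforcing := norm_bondForcing_sq_le k (φ t x)
    rw [(hasDerivAt_bondU (h.isSolution x hx t) k).deriv,
      (hasDerivAt_bondV (h.isSolution x hx t) k).deriv, add_sub_cancel_left, neg_add_cancel_comm]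
    calc _ = 6 * (bondForcing k (φ t x)).re ^ 2 + 2 * (bondForcing k (φ t x)).im ^ 2 := by
          linear_combination 2 * (bondForcing k (φ t x)).re ^ 2 * h3
      _ ≤ _ := by linarith [sq_nonneg (bondForcing k (φ t x)).im]

lemma passage (h : IsSphereFlow K φ) (hx : ‖x‖ = 1) (hs : ∀ j, k + 3 < j → mass j x = 0) :
    Passage (fun t => mass (k + 1) (φ t x)) (fun t => mass k (φ t x))
      (fun t => mass (k + 2) (φ t x)) (fun t => mass (k + 3) (φ t x))
      (fun t => bondU (k + 1) (φ t x)) (fun t => bondV (k + 1) (φ t x))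
      (fun t => bondU (k + 2) (φ t x)) (fun t => bondV (k + 2) (φ t x)) where
  A_nonneg t := mass_nonneg _ _
  B_nonneg t := mass_nonneg _ _
  M_nonneg t := mass_nonneg _ _
  J_nonneg t := mass_nonneg _ _
  mass_le t := by linarith [h.sum_four_mass_le_one hx k t]
  differentiable_A := h.differentiable_mass hx k
  differentiable_M := h.differentiable_mass hx (k + 1)
  differentiable_J := h.differentiable_mass hx (k + 2)
  abs_deriv_A_le := h.abs_deriv_mass_le hx k
  deriv_M t := by rw [(h.hasDerivAt_mass hx (k + 1) t).deriv, flux_eq, flux_eq]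
  deriv_J t := by
    have hnext : mode (φ t x) (k + 3 + 1) = 0 :=
      ToyModel.mass_eq_zero.1 (h.mass_eq_zero hx (hs (k + 4) (by omega)) t)
    have hflux : flux (k + 3) (φ t x) = 0 := by simp [flux, bond, hnext]
    rw [(h.hasDerivAt_mass hx (k + 2) t).deriv, hflux, zero_sub, flux_eq]
  left := h.hyperbolicPair hx k
  right := by
    have hnext : (fun t => mass (k + 1) (φ t x) + mass (k + 4) (φ t x))
        = fun t => mass (k + 1) (φ t x) :=
      funext fun t => by rw [h.mass_eq_zero hx (hs (k + 4) (by omega)), add_zero]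
    exact hnext ▸ h.hyperbolicPair hx (k + 1)
  left_ge t := two_mul_mass_mul_mass_le _ _
  left_le t := bondU_sq_add_bondV_sq_le _ _
  right_ge t := two_mul_mass_mul_mass_le _ _
  right_le t := bondU_sq_add_bondV_sq_le _ _

end IsSphereFlow

/-! ### Points reached from a circle -/

lemma norm_mode_le_supNorm (x : Phase N) (k : ℕ) : ‖mode x k‖ ≤ supNorm x := by
  unfold mode supNorm
  split_ifs
  · exact norm_le_pi_norm (WithLp.ofLp x) _
  · simp

lemma supNorm_le_norm (x : Phase N) : supNorm x ≤ ‖x‖ :=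
  (pi_norm_le_iff_of_nonneg (norm_nonneg x)).2 (PiLp.norm_apply_le x)

lemma half_lt_supNorm (h : 1 / 4 < mass k x) : 1 / 2 < supNorm x := by
  have hmode : 1 / 2 < ‖mode x k‖ :=
    lt_of_pow_lt_pow_left₀ 2 (norm_nonneg _) (by rw [mass] at h; linarith)
  exact hmode.trans_le (norm_mode_le_supNorm x k)

@[fun_prop]
lemma continuous_supNorm : Continuous (supNorm : Phase N → ℝ) :=
  (PiLp.continuous_ofLp 2 _).norm

/-- The points that can be reached from the vicinity of the circle `m` without ever spreading the
mass too thinly. -/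
def Reach (φ : Flow ℝ (Phase N)) (m : ℕ) (ε : ℝ) : Set (Phase N) :=
  {y | ∃ T, 0 ≤ T ∧ 1 - ε < mass m (φ (-T) y) ∧ ∀ t ∈ Icc 0 T, 1 / 2 < supNorm (φ (-t) y)}

lemma eventually_forall_mem_Icc {X Y : Type*} [TopologicalSpace X] [TopologicalSpace Y]
    {g : ℝ → X → Y} (hg : Continuous fun z : ℝ × X => g z.1 z.2) {U : Set Y} (hU : IsOpen U)
    {a b : ℝ} {x : X} (hx : ∀ t ∈ Icc a b, g t x ∈ U) :
    ∀ᶠ y in 𝓝 x, ∀ t ∈ Icc a b, g t y ∈ U :=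
  isCompact_Icc.eventually_forall_of_forall_eventually (P := fun y t => g t y ∈ U) fun t ht =>
    (hg.comp continuous_swap).continuousAt.eventually (hU.mem_nhds (hx t ht))

lemma isOpen_reach (φ : Flow ℝ (Phase N)) (m : ℕ) (ε : ℝ) : IsOpen (Reach φ m ε) := by
  rw [isOpen_iff_mem_nhds]
  rintro y ⟨T, hT, hstart, hspread⟩
  have hstart' : ∀ᶠ z in 𝓝 y, 1 - ε < mass m (φ (-T) z) :=
    (by fun_prop : Continuous fun z => mass m (φ (-T) z)).continuousAt.eventually
      (lt_mem_nhds hstart)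
  have hspread' := eventually_forall_mem_Icc (g := fun t z => φ (-t) z) (by fun_prop)
    (isOpen_lt continuous_const continuous_supNorm) hspread
  filter_upwards [hstart', hspread'] with z hz hz'
  exact ⟨T, hT, hz, hz'⟩

lemma Reach.flow {m : ℕ} {ε t : ℝ} {y : Phase N} (hy : y ∈ Reach φ m ε) (ht : 0 ≤ t)
    (hs : ∀ r ∈ Icc 0 t, 1 / 2 < supNorm (φ r y)) : φ t y ∈ Reach φ m ε := by
  obtain ⟨T, hT, hstart, hspread⟩ := hy
  refine ⟨T + t, by linarith, ?_, fun r hr => ?_⟩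
  · rwa [← Flow.map_add, neg_add, neg_add_cancel_right]
  · rw [← Flow.map_add]
    rcases le_total r t with hrt | hrt
    · exact hs _ ⟨by linarith, by linarith [hr.1]⟩
    · rw [show -r + t = -(r - t) by ring]
      exact hspread (r - t) ⟨by linarith, by linarith [hr.2]⟩

/-! ### Inserting mass in the next mode -/

/-- The unit vector of the mode `j`. -/
noncomputable def unitVec (N j : ℕ) : Phase N :=
  WithLp.toLp 2 fun i : Fin N => if (i : ℕ) + 1 = j then 1 else 0

lemma mode_unitVec {j : ℕ} (h1 : 1 ≤ j) (h2 : j ≤ N) (k : ℕ) :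
    mode (unitVec N j) k = if k = j then 1 else 0 := by
  by_cases h : 1 ≤ k ∧ k ≤ N
  · simp [mode, h, unitVec]
  · rw [if_neg (by omega), mode, dif_neg h]

lemma norm_unitVec {j : ℕ} (h1 : 1 ≤ j) (h2 : j ≤ N) : ‖unitVec N j‖ = 1 := by
  obtain ⟨i, rfl⟩ := Nat.exists_eq_add_of_le' h1
  rw [← sq_eq_sq₀ (norm_nonneg _) zero_le_one, one_pow, norm_sq_eq_sum_mass,
    Finset.sum_eq_single_of_mem i (Finset.mem_range.2 h2) fun k _ hk => by
      simp [mass, mode_unitVec h1 h2, hk]]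
  simp [mass, mode_unitVec h1 h2]

/-- Multiply the mode `m` by `c` and put `d` times the mode `m` in the mode `m + 1`. -/
noncomputable def insertMode (m : ℕ) (c : ℝ) (d : ℂ) (x : Phase N) : Phase N :=
  x + ((c - 1) * mode x m) • unitVec N m + (d * mode x m) • unitVec N (m + 1)

section

variable {m : ℕ} {c : ℝ} {d : ℂ}

lemma mode_insertMode (h1 : 1 ≤ m) (h2 : m + 1 ≤ N) (hx : mode x (m + 1) = 0) (j : ℕ) :
    mode (insertMode m c d x) j =
      if j = m then c * mode x m else if j = m + 1 then d * mode x m else mode x j := by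
  rw [insertMode, mode_add, mode_add, mode_smul, mode_smul, mode_unitVec h1 (by omega),
    mode_unitVec (by omega) h2]
  rcases eq_or_ne j m with rfl | hj
  · simp only [if_true, Nat.left_eq_add, one_ne_zero, if_false]
    ring
  rcases eq_or_ne j (m + 1) with rfl | hj'
  · simp [hx]
  · simp [hj, hj']

lemma norm_insertMode (h1 : 1 ≤ m) (h2 : m + 1 ≤ N) (hx : mode x (m + 1) = 0)
    (hcd : c ^ 2 + ‖d‖ ^ 2 = 1) : ‖insertMode m c d x‖ = ‖x‖ := by
  obtain ⟨i, rfl⟩ := Nat.exists_eq_add_of_le' h1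
  rw [← sq_eq_sq₀ (norm_nonneg _) (norm_nonneg _), ← sub_eq_zero, norm_sq_eq_sum_mass,
    norm_sq_eq_sum_mass, ← Finset.sum_sub_distrib,
    Finset.sum_eq_add_of_mem i (i + 1) (Finset.mem_range.2 (by omega))
      (Finset.mem_range.2 (by omega)) (by omega) fun j _ hj => by
        simp [mass, mode_insertMode h1 h2 hx, hj.1, hj.2]]
  simp only [mass, mode_insertMode h1 h2 hx, Nat.add_eq_left, one_ne_zero, if_true,
    if_false, norm_mul, Complex.norm_real, Real.norm_eq_abs, mul_pow, sq_abs, hx, norm_zero]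
  linear_combination ‖mode x (i + 1)‖ ^ 2 * hcd

lemma dist_insertMode_le (h1 : 1 ≤ m) (h2 : m + 1 ≤ N) (hc : 0 ≤ c) (hcd : c ^ 2 + ‖d‖ ^ 2 = 1) :
    dist (insertMode m c d x) x ≤ 2 * ‖d‖ * ‖x‖ := by
  have hd := norm_nonneg d
  have hc1 : c ≤ 1 := by nlinarith [sq_nonneg ‖d‖]
  have hcd' : 1 - c ≤ ‖d‖ := by
    by_contra! hlt
    nlinarith
  have hfactor : ‖(c : ℂ) - 1‖ ≤ ‖d‖ := by
    rwa [← Complex.ofReal_one, ← Complex.ofReal_sub, Complex.norm_real, Real.norm_eq_abs,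
      abs_sub_comm, abs_of_nonneg (sub_nonneg.2 hc1)]
  have hterm : ∀ {z : ℂ} {e : Phase N}, ‖z‖ ≤ ‖d‖ → ‖e‖ = 1 →
      ‖(z * mode x m) • e‖ ≤ ‖d‖ * ‖x‖ := fun hz he => by
    rw [norm_smul, norm_mul, he, mul_one]
    exact mul_le_mul hz (norm_mode_le x m) (norm_nonneg _) hd
  rw [dist_eq_norm, insertMode, add_assoc, add_sub_cancel_left]
  linarith [norm_add_le (((c - 1 : ℂ) * mode x m) • unitVec N m)
    ((d * mode x m) • unitVec N (m + 1)), hterm hfactor (norm_unitVec h1 (by omega)),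
    hterm (le_refl ‖d‖) (norm_unitVec (by omega) h2)]

end

end

/-! ### Launching mass into the next mode -/

/-- The complex number whose conjugate has the components `(a η, η)` along the unstable and the
stable bond direction. -/
noncomputable def seed (η a : ℝ) : ℂ := ⟨(1 + a) * η / (2 * √3), (1 - a) * η / 2⟩

lemma norm_seed_sq (η a : ℝ) : ‖seed η a‖ ^ 2 = (1 - a + a ^ 2) / 3 * η ^ 2 := by
  have h3 : √3 ^ 2 = (3 : ℝ) := Real.sq_sqrt (by norm_num)
  have h30 : √3 ≠ 0 := by positivity
  rw [Complex.sq_norm, Complex.normSq_apply, seed]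
  field_simp
  rw [h3]
  ring

lemma norm_seed_pos {η : ℝ} (hη : 0 < η) (a : ℝ) : 0 < ‖seed η a‖ := by
  refine lt_of_pow_lt_pow_left₀ 2 (norm_nonneg _) ?_
  rw [norm_seed_sq, zero_pow two_ne_zero]
  have : 0 < 1 - a + a ^ 2 := by nlinarith [sq_nonneg (a - 1 / 2)]
  positivity

@[fun_prop]
lemma continuous_seed (η : ℝ) : Continuous (seed η) := by
  have hseed : seed η = fun a => (((1 + a) * η / (2 * √3) : ℝ) : ℂ)
      + (((1 - a) * η / 2 : ℝ) : ℂ) * Complex.I :=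
    funext fun a => Complex.mk_eq_add_mul_I _ _
  rw [hseed]
  fun_prop

section

variable {N : ℕ} {x : Phase N} {k m : ℕ} {η a r : ℝ}

lemma bondV_of_bond_eq (h : bond k x = r * (starRingEnd ℂ) (seed η a)) : bondV k x = r * η := by
  have h30 : √3 ≠ 0 := by positivity
  rw [bondV, h, Complex.re_ofReal_mul, Complex.im_ofReal_mul]
  simp only [seed, Complex.conj_re, Complex.conj_im]
  field_simp
  ring

lemma bondU_of_bond_eq (h : bond k x = r * (starRingEnd ℂ) (seed η a)) :
    bondU k x = a * bondV k x := by
  have h30 : √3 ≠ 0 := by positivity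
  rw [bondV_of_bond_eq h, bondU, h, Complex.re_ofReal_mul, Complex.im_ofReal_mul]
  simp only [seed, Complex.conj_re, Complex.conj_im]
  field_simp
  ring

/-- The weight left to a mode when the share `‖seed η a‖ ^ 2` of its mass is moved away. -/
noncomputable def retention (η a : ℝ) : ℝ := √(1 - ‖seed η a‖ ^ 2)

/-- Move mass from the mode `m` to the empty mode `m + 1`, such that the bond between these two
modes gets components proportional to `(a η, η)`. -/
noncomputable def insertSeed (m : ℕ) (η a : ℝ) (x : Phase N) : Phase N :=
  insertMode m (retention η a) (seed η a) x

@[fun_prop]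
lemma continuous_retention (η : ℝ) : Continuous (retention η) := by
  unfold retention
  fun_prop

lemma continuous_insertSeed (m : ℕ) (η : ℝ) :
    Continuous fun z : ℝ × Phase N => insertSeed m η z.1 z.2 := by
  unfold insertSeed insertMode
  fun_prop

lemma norm_seed_le (ha : a ∈ Icc (-1 : ℝ) 1) (hη : 0 ≤ η) : ‖seed η a‖ ≤ η := by
  refine abs_le_of_sq_le_sq' ?_ hη |>.2
  rw [norm_seed_sq]
  exact mul_le_of_le_one_left (sq_nonneg _) (by nlinarith [ha.1, ha.2])

lemma retention_sq_add (h : ‖seed η a‖ ≤ 1) : retention η a ^ 2 + ‖seed η a‖ ^ 2 = 1 := by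
  rw [retention, Real.sq_sqrt (sub_nonneg.2 (pow_le_one₀ (norm_nonneg _) h)), sub_add_cancel]

lemma retention_le_one (η a : ℝ) : retention η a ≤ 1 :=
  Real.sqrt_le_one.2 (by linarith [sq_nonneg ‖seed η a‖])

lemma retention_ge (h : ‖seed η a‖ ≤ 1 / 10) : 9 / 10 ≤ retention η a :=
  Real.le_sqrt_of_sq_le (by linarith [pow_le_pow_left₀ (norm_nonneg _) h 2])

lemma mode_insertSeed (h1 : 1 ≤ m) (h2 : m + 1 ≤ N) (hx : mode x (m + 1) = 0) (j : ℕ) :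
    mode (insertSeed m η a x) j = if j = m then retention η a * mode x m
      else if j = m + 1 then seed η a * mode x m else mode x j :=
  mode_insertMode h1 h2 hx j

lemma norm_insertSeed (h1 : 1 ≤ m) (h2 : m + 1 ≤ N) (hx : mode x (m + 1) = 0)
    (hseed : ‖seed η a‖ ≤ 1) : ‖insertSeed m η a x‖ = ‖x‖ :=
  norm_insertMode h1 h2 hx (retention_sq_add hseed)

lemma mass_insertSeed (h1 : 1 ≤ m) (h2 : m + 1 ≤ N) (hx : mode x (m + 1) = 0) (j : ℕ) :
    mass j (insertSeed m η a x) = if j = m then retention η a ^ 2 * mass m x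
      else if j = m + 1 then ‖seed η a‖ ^ 2 * mass m x else mass j x := by
  rw [mass, mode_insertSeed h1 h2 hx]
  split_ifs <;> simp [mass, mul_pow]

lemma bond_insertSeed (h1 : 1 ≤ m) (h2 : m + 1 ≤ N) (hx : mode x (m + 1) = 0) :
    bond m (insertSeed m η a x)
      = (retention η a * mass m x : ℝ) * (starRingEnd ℂ) (seed η a) := by
  rw [bond, mode_insertSeed h1 h2 hx, mode_insertSeed h1 h2 hx, if_pos rfl,
    if_neg (Nat.succ_ne_self m), if_pos rfl, map_mul, mass]
  push_cast
  rw [← Complex.mul_conj']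
  ring

end

section

variable {N : ℕ} {K : ℝ} {φ : Flow ℝ (Phase N)} {x : Phase N} {k : ℕ} {T η a : ℝ}

/-- The datum `z` is launched from the mode `k + 2` at the time `T`: by then the mode `k + 3`, the
last one that is excited, carries little mass, and the bond between these two modes has the
components `(a b, b)` with `b ≤ η`. -/
structure IsLaunched (φ : Flow ℝ (Phase N)) (k : ℕ) (T η a : ℝ) (z : Phase N) : Prop where
  norm_eq : ‖z‖ = 1
  mass_eq_zero : ∀ j, k + 3 < j → mass j z = 0
  mass_pos : ∀ j ∈ Icc (k + 1) (k + 3), 0 < mass j z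
  next_mass_le : mass (k + 3) (φ T z) ≤ η ^ 2
  bondU_eq : bondU (k + 2) (φ T z) = a * bondV (k + 2) (φ T z)
  bondV_pos : 0 < bondV (k + 2) (φ T z)
  bondV_le : bondV (k + 2) (φ T z) ≤ η
  le_bondV : 99 / 100 < mass (k + 2) (φ T z) → η / 2 ≤ bondV (k + 2) (φ T z)

/-- Insert mass from the mode `m` in the next one at the time `T`, and flow back. -/
noncomputable def launch (φ : Flow ℝ (Phase N)) (m : ℕ) (T η a : ℝ) (x : Phase N) : Phase N :=
  φ (-T) (insertSeed m η a (φ T x))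

lemma continuous_launch (φ : Flow ℝ (Phase N)) (m : ℕ) (T η : ℝ) {X : Type*} [TopologicalSpace X]
    {α : X → ℝ} {x : X → Phase N} (hα : Continuous α) (hx : Continuous x) :
    Continuous fun s => launch φ m T η (α s) (x s) := by
  have hinsert := (continuous_insertSeed m η).comp
    (by fun_prop : Continuous fun s => (α s, φ T (x s)))
  unfold launch
  fun_prop

lemma flow_launch (φ : Flow ℝ (Phase N)) (m : ℕ) (T η a : ℝ) (x : Phase N) :
    φ T (launch φ m T η a x) = insertSeed m η a (φ T x) := by
  rw [launch, ← Flow.map_add, add_neg_cancel, Flow.map_zero_apply]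

lemma IsSphereFlow.dist_launch_le (h : IsSphereFlow K φ) {m : ℕ} (h1 : 1 ≤ m) (h2 : m + 1 ≤ N)
    (hx : ‖x‖ = 1) (hT : 0 ≤ T) (ha : a ∈ Icc (-1 : ℝ) 1) (hη : 0 ≤ η) (hη1 : η ≤ 1) :
    dist (launch φ m T η a x) x ≤ 2 * η * Real.exp (K * T) := by
  have hseed := norm_seed_le ha hη
  have hinsert : dist (insertSeed m η a (φ T x)) (φ T x) ≤ 2 * η := by
    have := dist_insertMode_le (x := φ T x) h1 h2 (Real.sqrt_nonneg _)
      (retention_sq_add (hseed.trans hη1))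
    rw [h.norm_eq T x hx, mul_one] at this
    exact this.trans (by linarith)
  have hback := h.dist_le (-T) (insertSeed m η a (φ T x)) (φ T x)
  rw [← Flow.map_add, neg_add_cancel, Flow.map_zero_apply, abs_neg, abs_of_nonneg hT] at hback
  exact hback.trans (mul_le_mul_of_nonneg_right hinsert (Real.exp_pos _).le)

lemma IsSphereFlow.isLaunched_launch (h : IsSphereFlow K φ) (hN : k + 3 ≤ N) (hx : ‖x‖ = 1)
    (hs : ∀ j, k + 2 < j → mass j x = 0) (hx1 : 0 < mass (k + 1) x) (hx2 : 0 < mass (k + 2) x)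
    (ha : a ∈ Icc (-1 : ℝ) 1) (hη : 0 < η) (hη1 : η ≤ 1 / 10) :
    IsLaunched φ k T η a (launch φ (k + 2) T η a x) := by
  have hseed := norm_seed_le ha hη.le
  have hret := retention_ge (hseed.trans hη1)
  have hnext : mode (φ T x) (k + 2 + 1) = 0 :=
    ToyModel.mass_eq_zero.1 (h.mass_eq_zero hx (hs _ (by omega)) T)
  have hmass := mass_insertSeed (η := η) (a := a) (by omega) hN hnext
  have hbond := bond_insertSeed (η := η) (a := a) (by omega) hN hnext
  have hpos := h.mass_pos hx hx2 T
  have hle : mass (k + 2) (φ T x) ≤ 1 :=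
    pow_le_one₀ (norm_nonneg _) ((norm_mode_le _ _).trans_eq (h.norm_eq T x hx))
  have hnorm : ‖insertSeed (k + 2) η a (φ T x)‖ = 1 :=
    (norm_insertSeed (by omega) hN hnext (by linarith)).trans (h.norm_eq T x hx)
  have hV := bondV_of_bond_eq hbond
  refine ⟨h.norm_eq _ _ hnorm, fun j hj => h.mass_eq_zero hnorm ?_ _,
    fun j ⟨hj1, hj2⟩ => h.mass_pos hnorm ?_ _, ?_, ?_, ?_, ?_, ?_⟩ <;> try rw [flow_launch]
  · rw [hmass, if_neg (by omega), if_neg (by omega)]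
    exact h.mass_eq_zero hx (hs j (by omega)) T
  · rw [hmass]
    split_ifs
    · positivity
    · exact mul_pos (pow_pos (norm_seed_pos hη a) 2) hpos
    · obtain rfl : j = k + 1 := by omega
      exact h.mass_pos hx hx1 T
  · rw [hmass, if_neg (by omega), if_pos rfl]
    exact (mul_le_of_le_one_right (sq_nonneg _) hle).trans
      (pow_le_pow_left₀ (norm_nonneg _) hseed 2)
  · exact bondU_of_bond_eq hbond
  · exact hV ▸ by positivity
  · rw [hV]
    exact mul_le_of_le_one_left hη.le (mul_le_one₀ (retention_le_one _ _) hpos.le hle)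
  · rw [hV, hmass, if_pos rfl]
    intro hlarge
    have : 1 / 2 ≤ retention η a * mass (k + 2) (φ T x) := by
      nlinarith [retention_le_one η a]
    nlinarith

end

namespace Passage

/-! ### Leaving a circle along the outgoing bond -/

variable {A B M J u v p q : ℝ → ℝ} {K δ ρ R t : ℝ}

lemma A_le_of_transit (h : Passage A B M J u v p q) (S : Scales K δ ρ R)
    (hM : ∀ t ∈ Icc 0 (S.T₀ + S.τ), 1 - ρ < M t)
    (hcone : ∀ t ∈ Icc 0 (S.T₀ + S.τ), u t ^ 2 < 2 * v t ^ 2)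
    (ht : t ∈ Icc (S.T₀ + S.τ) (S.T₀ + S.τ + S.w)) : A t ≤ S.a := by
  have hend : S.T₀ + S.τ ∈ Icc 0 (S.T₀ + S.τ) :=
    right_mem_Icc.2 (add_nonneg S.T₀_nonneg S.τ_nonneg)
  have hρ1 : ρ ≤ 1 / 100 := by linarith [S.ρ_le, S.δ_le, S.ρ_pos]
  calc A t ≤ A (S.T₀ + S.τ) * Real.exp (4 * 1 * (t - (S.T₀ + S.τ))) :=
        h.A_le_mul_exp ht.1 fun r _ => by linarith [h.mass_le r, h.A_nonneg r, h.J_nonneg r]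
    _ ≤ 2 * Real.exp (-((2 * √3 - 20 * ρ) * (S.T₀ + S.τ))) * Real.exp (4 * S.w) :=
        mul_le_mul (h.A_le_of_contracting hρ1 hM hcone hend)
          (Real.exp_le_exp.2 (by linarith [ht.2])) (Real.exp_pos _).le (by positivity)
    _ ≤ S.a := S.left_mass_le

lemma le_M_add_J_of_transit (h : Passage A B M J u v p q) (S : Scales K δ ρ R)
    (hM : ∀ t ∈ Icc 0 (S.T₀ + S.τ), 1 - ρ < M t)
    (hcone : ∀ t ∈ Icc 0 (S.T₀ + S.τ), u t ^ 2 < 2 * v t ^ 2)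
    (ht : t ∈ Icc (S.T₀ + S.τ) (S.T₀ + S.τ + S.w)) : 1 - 2 * ρ ≤ M t + J t := by
  have hloss := h.M_add_J_sub_le ht.1 fun r hr =>
    h.A_le_of_transit S hM hcone ⟨hr.1.le, hr.2.le.trans ht.2⟩
  have ha : 0 ≤ S.a := (h.A_nonneg t).trans (h.A_le_of_transit S hM hcone ht)
  linarith [S.mass_loss_le, hM _ (right_mem_Icc.2 (add_nonneg S.T₀_nonneg S.τ_nonneg)),
    h.J_nonneg (S.T₀ + S.τ), mul_le_mul_of_nonneg_left (sub_le_iff_le_add'.2 ht.2) ha]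

lemma abs_mul_sub_mul_le_of_transit (h : Passage A B M J u v p q) (S : Scales K δ ρ R)
    (hM : ∀ t ∈ Icc 0 (S.T₀ + S.τ), 1 - ρ < M t)
    (hcone : ∀ t ∈ Icc 0 (S.T₀ + S.τ), u t ^ 2 < 2 * v t ^ 2)
    (hpq : p S.T₀ ^ 2 ≤ q S.T₀ ^ 2) (ht : t ∈ Icc (S.T₀ + S.τ) (S.T₀ + S.τ + S.w)) :
    |p t * q t - p S.T₀ * q S.T₀| ≤ q S.T₀ ^ 2 / 4 + S.η ^ 2 / 16 := by
  have hρ1 : ρ ≤ 1 / 100 := by linarith [S.ρ_le, S.δ_le, S.ρ_pos]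
  have hsub : ∀ r ∈ Icc S.T₀ (S.T₀ + S.τ), r ∈ Icc 0 (S.T₀ + S.τ) := fun r hr =>
    ⟨S.T₀_nonneg.trans hr.1, hr.2⟩
  have hbefore : |p (S.T₀ + S.τ) * q (S.T₀ + S.τ) - p S.T₀ * q S.T₀| ≤ q S.T₀ ^ 2 / 4 :=
    h.abs_mul_sub_mul_le_of_decay (le_add_of_nonneg_right S.τ_nonneg) S.ρ_pos
      (fun r hr => hM r (hsub r hr))
      (fun r hr => h.A_le_of_contracting hρ1 hM hcone (hsub r hr)) hpq
      (by simpa only [add_sub_cancel_left] using S.drift_le)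
  have hduring := h.abs_mul_sub_mul_le ht.1 fun r hr =>
    h.A_le_of_transit S hM hcone ⟨hr.1.le, hr.2.le.trans ht.2⟩
  have ha : 0 ≤ S.a := (h.A_nonneg t).trans (h.A_le_of_transit S hM hcone ht)
  linarith [abs_sub_le (p t * q t) (p (S.T₀ + S.τ) * q (S.T₀ + S.τ)) (p S.T₀ * q S.T₀),
    S.transit_drift_le, mul_le_mul_of_nonneg_left (sub_le_iff_le_add'.2 ht.2) ha]

lemma le_J_of_contracting (h : Passage A B M J u v p q) (S : Scales K δ ρ R)
    (hM : ∀ t ∈ Icc 0 (S.T₀ + S.τ), 1 - ρ < M t) (hpq : p S.T₀ ^ 2 ≤ q S.T₀ ^ 2)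
    (hq : S.η / 2 ≤ q S.T₀) : S.j ≤ J (S.T₀ + S.τ) := by
  have hρ1 : ρ ≤ 1 / 100 := by linarith [S.ρ_le, S.δ_le, S.ρ_pos]
  have hgrowth := h.q_sq_mul_exp_le hρ1 (le_add_of_nonneg_right S.τ_nonneg)
    (fun r hr => hM r ⟨S.T₀_nonneg.trans hr.1, hr.2⟩) hpq
  rw [add_sub_cancel_left] at hgrowth
  have hstart : S.η ^ 2 / 4 ≤ q S.T₀ ^ 2 := by
    linarith [pow_le_pow_left₀ (half_pos S.η_pos).le hq 2]
  linarith [h.right_sq_add_sq_le (S.T₀ + S.τ), sq_nonneg (p (S.T₀ + S.τ)), S.j_le,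
    mul_le_mul_of_nonneg_right hstart (Real.exp_pos ((2 * √3 - 20 * ρ) * S.τ)).le]

lemma exists_transit_of_launch (h : Passage A B M J u v p q) (S : Scales K δ ρ R)
    (hM : ∀ t ∈ Icc 0 (S.T₀ + S.τ), 1 - ρ < M t)
    (hcone : ∀ t ∈ Icc 0 (S.T₀ + S.τ), u t ^ 2 < 2 * v t ^ 2)
    (hJ : ∀ t, 0 < J t) (hpq : p S.T₀ ^ 2 ≤ q S.T₀ ^ 2) (hq : S.η / 2 ≤ q S.T₀)
    (hqη : q S.T₀ ≤ S.η) :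
    ∃ t ∈ Icc (S.T₀ + S.τ) (S.T₀ + S.τ + S.w), 1 - δ < J t ∧
      ∀ r ∈ Icc (S.T₀ + S.τ) t, 2 * |p r| < q r := by
  have hρ1 : ρ ≤ 1 / 100 := by linarith [S.ρ_le, S.δ_le, S.ρ_pos]
  have hq0 : 0 < q S.T₀ := (half_pos S.η_pos).trans_le hq
  have hT : S.T₀ ≤ S.T₀ + S.τ := le_add_of_nonneg_right S.τ_nonneg
  have hM' : ∀ r ∈ Icc S.T₀ (S.T₀ + S.τ), 1 - ρ < M r := fun r hr =>
    hM r ⟨S.T₀_nonneg.trans hr.1, hr.2⟩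
  have hprod : ∀ t ∈ Icc (S.T₀ + S.τ) (S.T₀ + S.τ + S.w), |p t * q t| ≤ 2 * S.η ^ 2 := by
    intro t ht
    have hdrift := h.abs_mul_sub_mul_le_of_transit S hM hcone hpq ht
    have hstart : |p S.T₀ * q S.T₀| ≤ q S.T₀ ^ 2 := by
      rw [abs_mul, pow_two, abs_of_pos hq0]
      exact mul_le_mul_of_nonneg_right (abs_le_of_sq_le_sq hpq hq0.le) hq0.le
    linarith [abs_sub_abs_le_abs_sub (p t * q t) (p S.T₀ * q S.T₀), sq_nonneg S.η,
      pow_le_pow_left₀ hq0.le hqη 2]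
  refine h.exists_transit S.w_nonneg (by linarith [S.ρ_le, S.ρ_pos]) (fun t ht => ?_) hprod
    (h.q_pos hρ1 hT hM' hJ hq0 hpq) (h.p_sq_le_q_sq hρ1 hT hM' hpq) S.j_pos
    (h.le_J_of_contracting S hM hpq hq) S.lt_j S.one_lt_j_mul_exp ?_
  · linarith [h.le_M_add_J_of_transit S hM hcone ht, S.ρ_le]
  · linarith [h.mass_le (S.T₀ + S.τ), h.A_nonneg (S.T₀ + S.τ), h.B_nonneg (S.T₀ + S.τ),
      hM' _ (right_mem_Icc.2 hT), S.δ_le]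

end Passage

/-! ### Crossing the contracting cone -/

section

variable {N : ℕ} {K : ℝ} {φ : Flow ℝ (Phase N)} {m k : ℕ} {ε δ T₁ w a t : ℝ}
  {x y y₀ y₁ : Phase N}

/-- The points at which the bond `k` is dominated by a positive unstable component. -/
def posCone (N k : ℕ) : Set (Phase N) := {x | |bondV k x| < bondU k x}

/-- The points at which the bond `k` is dominated by a negative unstable component. -/
def negCone (N k : ℕ) : Set (Phase N) := {x | |bondV k x| < -bondU k x}

lemma isOpen_posCone (N k : ℕ) : IsOpen (posCone N k) :=
  isOpen_lt (by fun_prop) (by fun_prop)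

lemma isOpen_negCone (N k : ℕ) : IsOpen (negCone N k) :=
  isOpen_lt (by fun_prop) (by fun_prop)

/-- A point near the circle `k + 2`, reached from the vicinity of the circle `m`, that is
supported on the modes up to `k + 2` and does not vanish in the mode `k + 1`. -/
structure IsStaged (φ : Flow ℝ (Phase N)) (m : ℕ) (ε : ℝ) (k : ℕ) (δ : ℝ) (y : Phase N) :
    Prop where
  norm_eq : ‖y‖ = 1
  mem_reach : y ∈ Reach φ m ε
  mass_eq_zero : ∀ j, k + 2 < j → mass j y = 0
  lt_mass : 1 - δ < mass (k + 2) y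
  mass_pos : 0 < mass (k + 1) y

/-- A path of points near the circle `k + 2`, reached from the vicinity of the circle `m`, that
crosses the contracting cone of the bond between the modes `k + 1` and `k + 2`. -/
def Crossing (φ : Flow ℝ (Phase N)) (m : ℕ) (ε : ℝ) (k : ℕ) (δ : ℝ) : Prop :=
  ∃ x₀ ∈ negCone N (k + 1), ∃ x₁ ∈ posCone N (k + 1), JoinedIn {y | IsStaged φ m ε k δ y} x₀ x₁

lemma Crossing.mono {δ' : ℝ} (hδ : δ ≤ δ') (h : Crossing φ m ε k δ) : Crossing φ m ε k δ' := by
  obtain ⟨x₀, hx₀, x₁, hx₁, hjoin⟩ := h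
  exact ⟨x₀, hx₀, x₁, hx₁, hjoin.mono fun y hy => { hy with lt_mass := by linarith [hy.lt_mass] }⟩

lemma joinedIn_of_orbit {S : Set (Phase N)} {s : ℝ} (hst : s ≤ t) (hS : ∀ r ∈ Icc s t, φ r y ∈ S) :
    JoinedIn S (φ s y) (φ t y) := by
  have horbit : IsPathConnected ((fun r => φ r y) '' Icc s t) :=
    ((convex_Icc s t).isPathConnected ⟨s, left_mem_Icc.2 hst⟩).image (by fun_prop)
  refine (horbit.joinedIn _ ⟨s, left_mem_Icc.2 hst, rfl⟩ _ ⟨t, right_mem_Icc.2 hst, rfl⟩).mono ?_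
  rintro _ ⟨r, hr, rfl⟩
  exact hS r hr

/-! ### From one circle to the next -/

/-- The times within `[T₁, T₁ + w]` at which the orbit of `y` is near the circle `k + 3`, and has
stayed well inside the contracting cone of the bond `k + 2` since `T₁`. -/
def arrivalTimes (φ : Flow ℝ (Phase N)) (k : ℕ) (δ T₁ w : ℝ) (y : Phase N) : Set ℝ :=
  {t | t ∈ Icc T₁ (T₁ + w) ∧ 1 - δ < mass (k + 3) (φ t y) ∧
    ∀ r ∈ Icc T₁ t, 2 * |bondU (k + 2) (φ r y)| < bondV (k + 2) (φ r y)}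

/-- The orbit of `y` stays near the circle `k + 2` up to the time `T₁`, and then moves on to the
circle `k + 3` within the time `w`, leaving at most the mass `a` in the mode `k + 1`. -/
structure IsDeparting (φ : Flow ℝ (Phase N)) (m : ℕ) (ε : ℝ) (k : ℕ) (δ T₁ w a : ℝ)
    (y : Phase N) : Prop where
  norm_eq : ‖y‖ = 1
  mem_reach : y ∈ Reach φ m ε
  mass_eq_zero : ∀ j, k + 3 < j → mass j y = 0
  mass_pos : 0 < mass (k + 2) y
  lt_mass : ∀ t ∈ Icc 0 T₁, 1 / 4 < mass (k + 2) (φ t y)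
  left_mass_le : ∀ t ∈ Icc T₁ (T₁ + w), mass (k + 1) (φ t y) ≤ a
  half_lt_mass_add : ∀ t ∈ Icc T₁ (T₁ + w),
    1 / 2 < mass (k + 2) (φ t y) + mass (k + 3) (φ t y)
  nonempty_arrivalTimes : (arrivalTimes φ k δ T₁ w y).Nonempty

namespace IsDeparting

lemma half_lt_supNorm (hy : IsDeparting φ m ε k δ T₁ w a y) (ht : t ∈ Icc 0 (T₁ + w)) :
    1 / 2 < supNorm (φ t y) := by
  rcases le_total t T₁ with htT | htT
  · exact ToyModel.half_lt_supNorm (hy.lt_mass t ⟨ht.1, htT⟩)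
  · by_cases hM : 1 / 4 < mass (k + 2) (φ t y)
    · exact ToyModel.half_lt_supNorm hM
    · exact ToyModel.half_lt_supNorm (k := k + 3)
        (by linarith [hy.half_lt_mass_add t ⟨htT, ht.2⟩])

lemma isStaged_flow (hy : IsDeparting φ m ε k δ T₁ w a y) (h : IsSphereFlow K φ) (ht : 0 ≤ t)
    (hs : ∀ r ∈ Icc 0 t, 1 / 2 < supNorm (φ r y)) (hJ : 1 - δ < mass (k + 3) (φ t y)) :
    IsStaged φ m ε (k + 1) δ (φ t y) where
  norm_eq := h.norm_eq t y hy.norm_eq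
  mem_reach := Reach.flow hy.mem_reach ht hs
  mass_eq_zero j hj := h.mass_eq_zero hy.norm_eq (hy.mass_eq_zero j (by omega)) t
  lt_mass := hJ
  mass_pos := h.mass_pos hy.norm_eq hy.mass_pos t

lemma convex_arrivalTimes (hy : IsDeparting φ m ε k δ T₁ w a y) (h : IsSphereFlow K φ) :
    Convex ℝ (arrivalTimes φ k δ T₁ w y) := by
  have hP := h.passage hy.norm_eq hy.mass_eq_zero
  refine OrdConnected.convex ⟨fun s hs t ht r hr => ⟨⟨hs.1.1.trans hr.1, hr.2.trans ht.1.2⟩,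
    hs.2.1.trans_le ?_, fun r' hr' => ht.2.2 r' ⟨hr'.1, hr'.2.trans hr.2⟩⟩⟩
  refine le_of_deriv_nonneg hr.1 hP.differentiable_J.differentiableOn fun t' ht' => ?_
  have hcone := ht.2.2 t' ⟨hs.1.1.trans ht'.1.le, ht'.2.le.trans hr.2⟩
  have hsq : bondU (k + 2) (φ t' y) ^ 2 ≤ bondV (k + 2) (φ t' y) ^ 2 :=
    sq_le_sq.2 ((by linarith [abs_nonneg (bondU (k + 2) (φ t' y))] :
      |bondU (k + 2) (φ t' y)| ≤ bondV (k + 2) (φ t' y)).trans (le_abs_self _))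
  rw [hP.deriv_J, neg_nonneg]
  exact mul_nonpos_of_nonneg_of_nonpos (by positivity) (by linarith)

end IsDeparting

/- The arrival times form convex sets, and a fixed arrival time persists for nearby data, so that
they can be selected continuously along the path. -/
lemma exists_joinedIn_arrival (h : IsSphereFlow K φ) (hT₁ : 0 ≤ T₁)
    (hjoin : JoinedIn {y | IsDeparting φ m ε k δ T₁ w a y} y₀ y₁) :
    ∃ s ∈ arrivalTimes φ k δ T₁ w y₀, ∃ t ∈ arrivalTimes φ k δ T₁ w y₁,
      JoinedIn {y | IsStaged φ m ε (k + 1) δ y} (φ s y₀) (φ t y₁) := by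
  let π := hjoin.somePath
  have hπ : ∀ i, IsDeparting φ m ε k δ T₁ w a (π i) := hjoin.somePath_mem
  obtain ⟨g, hg⟩ := exists_continuous_forall_mem_convex_of_local_const
    (fun i => (hπ i).convex_arrivalTimes h) fun i => by
      obtain ⟨t, ht, hJ, hcone⟩ := (hπ i).nonempty_arrivalTimes
      have hcone' := eventually_forall_mem_Icc (g := fun t i => φ t (π i)) (by fun_prop)
        (isOpen_lt (by fun_prop) (by fun_prop) :
          IsOpen {y : Phase N | 2 * |bondU (k + 2) y| < bondV (k + 2) y}) hcone
      have hJ' : ∀ᶠ j in 𝓝 i, 1 - δ < mass (k + 3) (φ t (π j)) :=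
        (by fun_prop : Continuous fun j => mass (k + 3) (φ t (π j))).continuousAt.eventually
          (lt_mem_nhds hJ)
      refine ⟨t, ?_⟩
      filter_upwards [hcone', hJ'] with j hj hj'
      exact ⟨ht, hj', hj⟩
  refine ⟨g 0, by simpa only [π, Path.source] using hg 0, g 1,
    by simpa only [π, Path.target] using hg 1,
    ⟨⟨⟨fun i => φ (g i) (π i), by fun_prop⟩, by simp [π], by simp [π]⟩, fun i => ?_⟩⟩
  have hgi := (hg i).1
  exact (hπ i).isStaged_flow h (hT₁.trans hgi.1)
    (fun r hr => (hπ i).half_lt_supNorm ⟨hr.1, hr.2.trans hgi.2⟩) (hg i).2.1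

lemma IsDeparting.joinedIn_flow (hy : IsDeparting φ m ε k δ T₁ w a y) (h : IsSphereFlow K φ)
    (hT₁ : 0 ≤ T₁) (hδ : δ ≤ 3 / 4) {s : ℝ} (hs : s ∈ Icc T₁ (T₁ + w)) (hst : s ≤ t)
    (hJ : ∀ r ∈ Icc s t, 1 - δ < mass (k + 3) (φ r y)) :
    JoinedIn {y | IsStaged φ m ε (k + 1) δ y} (φ s y) (φ t y) := by
  refine joinedIn_of_orbit hst fun r hr =>
    hy.isStaged_flow h (hT₁.trans (hs.1.trans hr.1)) (fun r' hr' => ?_) (hJ r hr)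
  rcases le_total r' s with hrs | hrs
  · exact hy.half_lt_supNorm ⟨hr'.1, hrs.trans hs.2⟩
  · exact ToyModel.half_lt_supNorm (k := k + 3) (by linarith [hJ r' ⟨hrs, hr'.2.trans hr.2⟩])

lemma IsDeparting.exists_joinedIn_posCone {ρ R : ℝ} (S : Scales K δ ρ R) (h : IsSphereFlow K φ)
    (hT₁ : 0 ≤ T₁) (hy : IsDeparting φ m ε k δ T₁ w S.a y)
    (hpq : ∀ t ∈ Icc T₁ (T₁ + w),
      S.η ^ 2 / 8 ≤ bondU (k + 2) (φ t y) * bondV (k + 2) (φ t y))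
    {s : ℝ} (hs : s ∈ arrivalTimes φ k δ T₁ w y) :
    ∃ x ∈ posCone N (k + 2), JoinedIn {y | IsStaged φ m ε (k + 1) δ y} (φ s y) x := by
  have hq := hs.2.2 s (right_mem_Icc.2 hs.1.1)
  obtain ⟨t, hst, hJ, hcone⟩ := (h.passage hy.norm_eq hy.mass_eq_zero).exists_exit S.τ_nonneg
    (by linarith [S.ρ_le, S.ρ_pos]) S.δ_le (hy.left_mass_le s hs.1) (k := S.η ^ 2 / 16)
    (by have := S.η_pos; positivity)
    (by linarith [hpq s hs.1]) (by linarith [abs_nonneg (bondU (k + 2) (φ s y))]) hs.2.1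
    S.exit_drift_le S.exit_decay_lt
  exact ⟨φ t y, hcone, hy.joinedIn_flow h hT₁ (by linarith [S.δ_le]) hs.1 hst hJ⟩

lemma IsDeparting.exists_joinedIn_negCone {ρ R : ℝ} (S : Scales K δ ρ R) (h : IsSphereFlow K φ)
    (hT₁ : 0 ≤ T₁) (hy : IsDeparting φ m ε k δ T₁ w S.a y)
    (hpq : ∀ t ∈ Icc T₁ (T₁ + w),
      S.η ^ 2 / 8 ≤ -bondU (k + 2) (φ t y) * bondV (k + 2) (φ t y))
    {s : ℝ} (hs : s ∈ arrivalTimes φ k δ T₁ w y) :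
    ∃ x ∈ negCone N (k + 2), JoinedIn {y | IsStaged φ m ε (k + 1) δ y} (φ s y) x := by
  have hq := hs.2.2 s (right_mem_Icc.2 hs.1.1)
  obtain ⟨t, hst, hJ, hcone⟩ := (h.passage hy.norm_eq hy.mass_eq_zero).neg_p.exists_exit
    S.τ_nonneg (by linarith [S.ρ_le, S.ρ_pos]) S.δ_le (hy.left_mass_le s hs.1) (k := S.η ^ 2 / 16)
    (by have := S.η_pos; positivity) (by linarith [hpq s hs.1])
    (by linarith [abs_nonneg (bondU (k + 2) (φ s y))]) hs.2.1 S.exit_drift_le S.exit_decay_lt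
  exact ⟨φ t y, hcone, hy.joinedIn_flow h hT₁ (by linarith [S.δ_le]) hs.1 hst hJ⟩

lemma crossing_of_joinedIn_isDeparting {ρ R : ℝ} (S : Scales K δ ρ R) (h : IsSphereFlow K φ)
    (hT₁ : 0 ≤ T₁)
    (hjoin : JoinedIn {y | IsDeparting φ m ε k δ T₁ w S.a y} y₀ y₁)
    (hy₀ : ∀ t ∈ Icc T₁ (T₁ + w),
      S.η ^ 2 / 8 ≤ -bondU (k + 2) (φ t y₀) * bondV (k + 2) (φ t y₀))
    (hy₁ : ∀ t ∈ Icc T₁ (T₁ + w),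
      S.η ^ 2 / 8 ≤ bondU (k + 2) (φ t y₁) * bondV (k + 2) (φ t y₁)) :
    Crossing φ m ε (k + 1) δ := by
  obtain ⟨s, hs, t, ht, hmid⟩ := exists_joinedIn_arrival h hT₁ hjoin
  obtain ⟨x₀, hx₀, htail₀⟩ := hjoin.source_mem.exists_joinedIn_negCone S h hT₁ hy₀ hs
  obtain ⟨x₁, hx₁, htail₁⟩ := hjoin.target_mem.exists_joinedIn_posCone S h hT₁ hy₁ ht
  exact ⟨x₀, hx₀, x₁, hx₁, (htail₀.symm.trans hmid).trans htail₁⟩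

end

/-! ### The induction step -/

section

variable {N : ℕ} {K : ℝ} {φ : Flow ℝ (Phase N)} {m k : ℕ} {ε δ ρ R T η a : ℝ} {y : Phase N}

/-- The data whose orbit is in `V` at some time in `[0, T]` and near the circle `m` until then. -/
def entering (φ : Flow ℝ (Phase N)) (m : ℕ) (ρ T : ℝ) (V : Set (Phase N)) : Set (Phase N) :=
  {y | ∃ t ∈ Icc 0 T, (∀ r ∈ Icc 0 t, 1 - ρ < mass m (φ r y)) ∧ φ t y ∈ V}

/-- The data whose orbit stays near the circle `k + 2` and near the contracting cone of the bond
`k + 1` during `[0, T]`. The slack `2` makes this an open condition. -/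
def remaining (φ : Flow ℝ (Phase N)) (k : ℕ) (ρ T : ℝ) : Set (Phase N) :=
  {y | ∀ t ∈ Icc 0 T, 1 - ρ < mass (k + 2) (φ t y) ∧
    bondU (k + 1) (φ t y) ^ 2 < 2 * bondV (k + 1) (φ t y) ^ 2}

lemma isOpen_entering {V : Set (Phase N)} (hV : IsOpen V) : IsOpen (entering φ m ρ T V) := by
  rw [isOpen_iff_mem_nhds]
  rintro y ⟨t, ht, hmass, hy⟩
  have hmass' := eventually_forall_mem_Icc (g := fun t z => φ t z) (by fun_prop)
    (isOpen_lt (by fun_prop) (by fun_prop) : IsOpen {y : Phase N | 1 - ρ < mass m y}) hmass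
  have hmem : ∀ᶠ z in 𝓝 y, φ t z ∈ V :=
    (by fun_prop : Continuous fun z => φ t z).continuousAt.eventually (hV.mem_nhds hy)
  filter_upwards [hmass', hmem] with z hz hz'
  exact ⟨t, ht, hz, hz'⟩

lemma isOpen_remaining : IsOpen (remaining φ k ρ T) := by
  rw [isOpen_iff_mem_nhds]
  intro y hy
  have hopen : IsOpen {y : Phase N |
      1 - ρ < mass (k + 2) y ∧ bondU (k + 1) y ^ 2 < 2 * bondV (k + 1) y ^ 2} :=
    IsOpen.and (isOpen_lt (by fun_prop) (by fun_prop)) (isOpen_lt (by fun_prop) (by fun_prop))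
  exact eventually_forall_mem_Icc (g := fun t z => φ t z) (by fun_prop) hopen hy

lemma mem_entering_of_mem {V : Set (Phase N)} (hT : 0 ≤ T) (hmass : 1 - ρ < mass m y)
    (hy : y ∈ V) : y ∈ entering φ m ρ T V := by
  refine ⟨0, left_mem_Icc.2 hT, fun r hr => ?_, by rwa [Flow.map_zero_apply]⟩
  rwa [le_antisymm hr.2 hr.1, Flow.map_zero_apply]

namespace IsLaunched

lemma passage (hy : IsLaunched φ k T η a y) (h : IsSphereFlow K φ) :
    Passage (fun t => mass (k + 1) (φ t y)) (fun t => mass k (φ t y))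
      (fun t => mass (k + 2) (φ t y)) (fun t => mass (k + 3) (φ t y))
      (fun t => bondU (k + 1) (φ t y)) (fun t => bondV (k + 1) (φ t y))
      (fun t => bondU (k + 2) (φ t y)) (fun t => bondV (k + 2) (φ t y)) :=
  h.passage hy.norm_eq hy.mass_eq_zero

lemma not_mem_entering_posCone {T' : ℝ} (hy : IsLaunched φ k T η a y) (h : IsSphereFlow K φ)
    (hρ : ρ ≤ 1 / 100) (hneg : y ∈ entering φ (k + 2) ρ T' (negCone N (k + 1))) :
    y ∉ entering φ (k + 2) ρ T' (posCone N (k + 1)) := by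
  rintro ⟨t, ht, hmass, hpos⟩
  obtain ⟨s, hs, hmass', hneg⟩ := hneg
  rw [negCone, mem_ofPred_eq] at hneg
  rw [posCone, mem_ofPred_eq] at hpos
  have hP := hy.passage h
  rcases le_total s t with hst | hst
  · have := hP.abs_v_lt_neg_u hst
      (fun r hr => by linarith [hmass r ⟨hs.1.trans hr.1.le, hr.2.le⟩]) hneg
    linarith [abs_nonneg (bondV (k + 1) (φ t y))]
  · have := hP.abs_v_lt_u hst
      (fun r hr => by linarith [hmass' r ⟨ht.1.trans hr.1.le, hr.2.le⟩]) hpos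
    linarith [abs_nonneg (bondV (k + 1) (φ s y))]

lemma bondU_sq_le (hy : IsLaunched φ k T η a y) (ha : a ∈ Icc (-1 : ℝ) 1) :
    bondU (k + 2) (φ T y) ^ 2 ≤ bondV (k + 2) (φ T y) ^ 2 := by
  rw [hy.bondU_eq, mul_pow]
  exact mul_le_of_le_one_left (sq_nonneg _) (by nlinarith [ha.1, ha.2])

lemma mem_remaining (S : Scales K δ ρ R) (hy : IsLaunched φ k S.T₀ S.η a y)
    (h : IsSphereFlow K φ) (ha : a ∈ Icc (-1 : ℝ) 1) (hmass : 1 - ρ / 4 < mass (k + 2) y)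
    (hneg : y ∉ entering φ (k + 2) ρ (S.T₀ + S.τ) (negCone N (k + 1)))
    (hpos : y ∉ entering φ (k + 2) ρ (S.T₀ + S.τ) (posCone N (k + 1))) :
    y ∈ remaining φ k ρ (S.T₀ + S.τ) := by
  have hP := hy.passage h
  have hcone : ∀ t ∈ Icc 0 (S.T₀ + S.τ), (∀ r ∈ Icc 0 t, 1 - ρ < mass (k + 2) (φ r y)) →
      bondU (k + 1) (φ t y) ^ 2 ≤ bondV (k + 1) (φ t y) ^ 2 := by
    intro t ht hr
    have hneg' : ¬ |bondV (k + 1) (φ t y)| < -bondU (k + 1) (φ t y) := fun hlt =>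
      hneg ⟨t, ht, hr, hlt⟩
    have hpos' : ¬ |bondV (k + 1) (φ t y)| < bondU (k + 1) (φ t y) := fun hlt =>
      hpos ⟨t, ht, hr, hlt⟩
    exact sq_le_sq.2 (abs_le.2 ⟨by linarith, by linarith⟩)
  have hbond : bondU (k + 2) (φ S.T₀ y) ^ 2 + bondV (k + 2) (φ S.T₀ y) ^ 2 ≤ 2 * S.η ^ 2 := by
    linarith [hy.bondU_sq_le ha, pow_le_pow_left₀ hy.bondV_pos.le hy.bondV_le 2]
  have hM := hP.forall_M_gt_of_contracting S.T₀_nonneg S.ρ_pos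
    (by linarith [S.ρ_le, S.δ_le, S.ρ_pos]) (by rw [Flow.map_zero_apply]; exact hmass.le)
    ((mul_le_mul_of_nonneg_right hy.next_mass_le (Real.exp_pos _).le).trans S.next_mass_le)
    (by
      rw [add_sub_cancel_left]
      exact (mul_le_mul_of_nonneg_right hbond (Real.exp_pos _).le).trans S.next_bond_le) hcone
  intro t ht
  refine ⟨hM t ht, ?_⟩
  have hlt := mul_pos (h.mass_pos hy.norm_eq (hy.mass_pos (k + 1) ⟨by omega, by omega⟩) t)
    (h.mass_pos hy.norm_eq (hy.mass_pos (k + 2) ⟨by omega, by omega⟩) t)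
  linarith [hcone t ht fun r hr => hM r ⟨hr.1, hr.2.trans ht.2⟩, hP.left_ge t]

lemma le_bondV_of_remaining (S : Scales K δ ρ R) (hy : IsLaunched φ k S.T₀ S.η a y)
    (hr : y ∈ remaining φ k ρ (S.T₀ + S.τ)) : S.η / 2 ≤ bondV (k + 2) (φ S.T₀ y) :=
  hy.le_bondV (by
    linarith [(hr S.T₀ ⟨S.T₀_nonneg, le_add_of_nonneg_right S.τ_nonneg⟩).1, S.ρ_le, S.δ_le,
      S.ρ_pos])

lemma isDeparting (S : Scales K δ ρ R) (hy : IsLaunched φ k S.T₀ S.η a y) (h : IsSphereFlow K φ)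
    (ha : a ∈ Icc (-1 : ℝ) 1) (hreach : y ∈ Reach φ m ε)
    (hr : y ∈ remaining φ k ρ (S.T₀ + S.τ)) :
    IsDeparting φ m ε k δ (S.T₀ + S.τ) S.w S.a y := by
  have hP := hy.passage h
  have hM := fun t ht => (hr t ht).1
  have hcone := fun t ht => (hr t ht).2
  exact {
    norm_eq := hy.norm_eq
    mem_reach := hreach
    mass_eq_zero := hy.mass_eq_zero
    mass_pos := hy.mass_pos _ ⟨by omega, by omega⟩
    lt_mass t ht := by linarith [hM t ht, S.ρ_le, S.δ_le, S.ρ_pos]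
    left_mass_le t ht := hP.A_le_of_transit S hM hcone ht
    half_lt_mass_add t ht := by
      linarith [hP.le_M_add_J_of_transit S hM hcone ht, S.ρ_le, S.δ_le, S.ρ_pos]
    nonempty_arrivalTimes := hP.exists_transit_of_launch S hM hcone
      (h.mass_pos hy.norm_eq (hy.mass_pos _ ⟨by omega, by omega⟩)) (hy.bondU_sq_le ha)
      (hy.le_bondV_of_remaining S hr) hy.bondV_le }

lemma abs_bond_mul_sub_le (S : Scales K δ ρ R) (hy : IsLaunched φ k S.T₀ S.η a y)
    (h : IsSphereFlow K φ) (ha : a ∈ Icc (-1 : ℝ) 1) (hr : y ∈ remaining φ k ρ (S.T₀ + S.τ))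
    {t : ℝ} (ht : t ∈ Icc (S.T₀ + S.τ) (S.T₀ + S.τ + S.w)) :
    |bondU (k + 2) (φ t y) * bondV (k + 2) (φ t y) - a * bondV (k + 2) (φ S.T₀ y) ^ 2|
      ≤ bondV (k + 2) (φ S.T₀ y) ^ 2 / 4 + S.η ^ 2 / 16 := by
  have := (hy.passage h).abs_mul_sub_mul_le_of_transit S (fun t ht => (hr t ht).1)
    (fun t ht => (hr t ht).2) (hy.bondU_sq_le ha) ht
  rwa [hy.bondU_eq, mul_assoc, ← pow_two] at this

lemma le_bond_mul_of_one (S : Scales K δ ρ R) (hy : IsLaunched φ k S.T₀ S.η 1 y)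
    (h : IsSphereFlow K φ) (hr : y ∈ remaining φ k ρ (S.T₀ + S.τ)) {t : ℝ}
    (ht : t ∈ Icc (S.T₀ + S.τ) (S.T₀ + S.τ + S.w)) :
    S.η ^ 2 / 8 ≤ bondU (k + 2) (φ t y) * bondV (k + 2) (φ t y) := by
  have hdrift := hy.abs_bond_mul_sub_le S h ⟨by norm_num, le_rfl⟩ hr ht
  linarith [(abs_le.1 hdrift).1,
    pow_le_pow_left₀ (half_pos S.η_pos).le (hy.le_bondV_of_remaining S hr) 2]

lemma le_neg_bond_mul_of_neg_one (S : Scales K δ ρ R) (hy : IsLaunched φ k S.T₀ S.η (-1) y)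
    (h : IsSphereFlow K φ) (hr : y ∈ remaining φ k ρ (S.T₀ + S.τ)) {t : ℝ}
    (ht : t ∈ Icc (S.T₀ + S.τ) (S.T₀ + S.τ + S.w)) :
    S.η ^ 2 / 8 ≤ -bondU (k + 2) (φ t y) * bondV (k + 2) (φ t y) := by
  have hdrift := hy.abs_bond_mul_sub_le S h ⟨le_rfl, by norm_num⟩ hr ht
  linarith [(abs_le.1 hdrift).2,
    pow_le_pow_left₀ (half_pos S.η_pos).le (hy.le_bondV_of_remaining S hr) 2]

end IsLaunched

/- The data entering one of the two cones of the incoming bond separate the left end of the strip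
from the right one. -/
lemma exists_joinedIn_remaining (S : Scales K δ ρ R) (h : IsSphereFlow K φ) {α : ℝ → ℝ}
    (hα : ∀ s, α s ∈ Icc (-1 : ℝ) 1) {z : ℝ × ℝ → Phase N} (hz : Continuous z)
    (hlaunch : ∀ x, IsLaunched φ k S.T₀ S.η (α x.2) (z x))
    (hmass : ∀ x, 1 - ρ / 4 < mass (k + 2) (z x))
    (hneg : ∀ x, x.1 ≤ 0 → z x ∈ negCone N (k + 1))
    (hpos : ∀ x, 1 ≤ x.1 → z x ∈ posCone N (k + 1)) :
    ∃ x₀ x₁, x₀.2 ≤ -1 ∧ 1 ≤ x₁.2 ∧ JoinedIn (z ⁻¹' remaining φ k ρ (S.T₀ + S.τ)) x₀ x₁ := by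
  have hT : 0 ≤ S.T₀ + S.τ := add_nonneg S.T₀_nonneg S.τ_nonneg
  have hρ : ρ ≤ 1 / 100 := by linarith [S.ρ_le, S.δ_le, S.ρ_pos]
  have hmass' : ∀ x, 1 - ρ < mass (k + 2) (z x) := fun x => by linarith [hmass x, S.ρ_pos]
  refine exists_joinedIn_of_separates (a := 0) (b := 1)
    (L := z ⁻¹' entering φ (k + 2) ρ (S.T₀ + S.τ) (negCone N (k + 1)))
    (R := z ⁻¹' entering φ (k + 2) ρ (S.T₀ + S.τ) (posCone N (k + 1)))
    ((isOpen_entering (isOpen_negCone N _)).preimage hz)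
    ((isOpen_entering (isOpen_posCone N _)).preimage hz) (isOpen_remaining.preimage hz)
    (Set.disjoint_left.2 fun x => (hlaunch x).not_mem_entering_posCone h hρ) (fun x hx => ?_)
    (by norm_num) (fun x hx => mem_entering_of_mem hT (hmass' x) (hneg x hx))
    fun x hx => mem_entering_of_mem hT (hmass' x) (hpos x hx)
  rw [compl_union] at hx
  exact (hlaunch x).mem_remaining S h (hα x.2) (hmass x) hx.1 hx.2

lemma exists_launched_family (S : Scales K δ ρ R) (h : IsSphereFlow K φ) (hN : k + 3 ≤ N)
    {γ : ℝ → Phase N} (hγ : Continuous γ) (hstage : ∀ s, IsStaged φ m ε k (ρ / 4) (γ s))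
    {α : ℝ → ℝ} (hαc : Continuous α) (hα : ∀ s, α s ∈ Icc (-1 : ℝ) 1) :
    ∃ z : ℝ × ℝ → Phase N, Continuous z ∧ (∀ x, IsLaunched φ k S.T₀ S.η (α x.2) (z x)) ∧
      ∀ x, dist (z x) (γ x.1) < R := by
  refine ⟨fun x => launch φ (k + 2) S.T₀ S.η (α x.2) (γ x.1),
    continuous_launch φ (k + 2) S.T₀ S.η (by fun_prop) (by fun_prop),
    fun x => ?_, fun x => ?_⟩
  · exact h.isLaunched_launch hN (hstage x.1).norm_eq (hstage x.1).mass_eq_zero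
      (hstage x.1).mass_pos (by linarith [(hstage x.1).lt_mass, S.ρ_le, S.δ_le, S.ρ_pos])
      (hα x.2) S.η_pos S.η_le
  · exact (h.dist_launch_le (by omega) hN (hstage x.1).norm_eq S.T₀_nonneg (hα x.2) S.η_pos.le
      (by linarith [S.η_le])).trans_lt S.displacement_lt

lemma exists_joinedIn_launched (S : Scales K δ ρ R) (h : IsSphereFlow K φ) (hN : k + 3 ≤ N)
    {γ : ℝ → Phase N} (hγ : Continuous γ) (hstage : ∀ s, IsStaged φ m ε k (ρ / 4) (γ s))
    (hnear : ∀ s y, dist y (γ s) < R → y ∈ Reach φ m ε ∧ 1 - ρ / 4 < mass (k + 2) y)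
    (hneg : ∀ s ≤ 0, ∀ y, dist y (γ s) < R → y ∈ negCone N (k + 1))
    (hpos : ∀ s, 1 ≤ s → ∀ y, dist y (γ s) < R → y ∈ posCone N (k + 1)) :
    ∃ y₀ y₁, IsLaunched φ k S.T₀ S.η (-1) y₀ ∧ IsLaunched φ k S.T₀ S.η 1 y₁ ∧
      JoinedIn {y | (∃ a ∈ Icc (-1 : ℝ) 1, IsLaunched φ k S.T₀ S.η a y) ∧ y ∈ Reach φ m ε ∧
        y ∈ remaining φ k ρ (S.T₀ + S.τ)} y₀ y₁ := by
  have hα : ∀ s : ℝ, max (-1) (min 1 s) ∈ Icc (-1 : ℝ) 1 := fun s =>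
    ⟨le_max_left _ _, max_le (by norm_num) (min_le_left _ _)⟩
  obtain ⟨z, hz, hlaunch, hdist⟩ :=
    exists_launched_family S h hN hγ hstage (by fun_prop) hα
  obtain ⟨x₀, x₁, hx₀, hx₁, hjoin⟩ := exists_joinedIn_remaining S h hα hz hlaunch
    (fun x => (hnear x.1 _ (hdist x)).2) (fun x hx => hneg x.1 hx _ (hdist x))
    fun x hx => hpos x.1 hx _ (hdist x)
  have hlaunch₀ := hlaunch x₀
  have hlaunch₁ := hlaunch x₁
  rw [min_eq_right (hx₀.trans (by norm_num)), max_eq_left hx₀] at hlaunch₀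
  rw [min_eq_left hx₁, max_eq_right (by norm_num)] at hlaunch₁
  exact ⟨z x₀, z x₁, hlaunch₀, hlaunch₁, hjoin.somePath.map hz, fun i =>
    ⟨⟨_, hα _, hlaunch _⟩, (hnear _ _ (hdist _)).1, hjoin.somePath_mem i⟩⟩

lemma Crossing.exists_path (hcross : Crossing φ m ε k δ) :
    ∃ γ : ℝ → Phase N, Continuous γ ∧ (∀ s, IsStaged φ m ε k δ (γ s)) ∧ ∃ R, 0 < R ∧
      (∀ s y, dist y (γ s) < R → y ∈ Reach φ m ε ∧ 1 - δ < mass (k + 2) y) ∧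
      (∀ s ≤ 0, ∀ y, dist y (γ s) < R → y ∈ negCone N (k + 1)) ∧
      ∀ s, 1 ≤ s → ∀ y, dist y (γ s) < R → y ∈ posCone N (k + 1) := by
  obtain ⟨x₀, hx₀, x₁, hx₁, hjoin⟩ := hcross
  let π := hjoin.somePath
  have hopen : IsOpen (Reach φ m ε ∩ {y | 1 - δ < mass (k + 2) y}) :=
    (isOpen_reach φ m ε).inter (isOpen_lt (by fun_prop) (by fun_prop))
  obtain ⟨R₁, hR₁, hR₁'⟩ := (isCompact_range π.continuous).exists_thickening_subset_open hopen (by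
    rintro _ ⟨s, rfl⟩
    exact ⟨(hjoin.somePath_mem s).mem_reach, (hjoin.somePath_mem s).lt_mass⟩)
  obtain ⟨R₂, hR₂, hR₂'⟩ := Metric.isOpen_iff.1 (isOpen_negCone N (k + 1)) x₀ hx₀
  obtain ⟨R₃, hR₃, hR₃'⟩ := Metric.isOpen_iff.1 (isOpen_posCone N (k + 1)) x₁ hx₁
  refine ⟨π.extend, π.continuous_extend, fun s => hjoin.somePath_mem _, min R₁ (min R₂ R₃),
    lt_min hR₁ (lt_min hR₂ hR₃), fun s y hy => ?_, fun s hs y hy => ?_, fun s hs y hy => ?_⟩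
  · exact hR₁' (Metric.mem_thickening_iff.2
      ⟨_, mem_range_self _, hy.trans_le (min_le_left _ _)⟩)
  · rw [π.extend_of_le_zero hs] at hy
    exact hR₂' (hy.trans_le ((min_le_right _ _).trans (min_le_left _ _)))
  · rw [π.extend_of_one_le hs] at hy
    exact hR₃' (hy.trans_le ((min_le_right _ _).trans (min_le_right _ _)))

theorem Crossing.succ (h : IsSphereFlow K φ) (hK : 0 ≤ K) (hN : k + 3 ≤ N)
    (hcross : ∀ δ, 0 < δ → Crossing φ m ε k δ) (hδ : 0 < δ) (hδK : δ * (100 * (K + 8)) ≤ 1) :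
    Crossing φ m ε (k + 1) δ := by
  have hρ : 0 < δ / (8000 * (K + 8)) := by positivity
  obtain ⟨γ, hγ, hstage, R, hR, hnear, hneg, hpos⟩ :=
    (hcross (δ / (8000 * (K + 8)) / 4) (by positivity)).exists_path
  obtain ⟨S⟩ := exists_scales hK hρ (div_mul_cancel₀ δ (by positivity)) hδK hR
  obtain ⟨y₀, y₁, hy₀, hy₁, hjoin⟩ := exists_joinedIn_launched S h hN hγ hstage hnear hneg hpos
  refine crossing_of_joinedIn_isDeparting S h (add_nonneg S.T₀_nonneg S.τ_nonneg)
    (hjoin.mono ?_) (fun t => hy₀.le_neg_bond_mul_of_neg_one S h hjoin.source_mem.2.2)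
    fun t => hy₁.le_bond_mul_of_one S h hjoin.target_mem.2.2
  rintro y ⟨⟨a, ha, hy⟩, hreach, hr⟩
  exact hy.isDeparting S h ha hreach hr

end

/-! ### The first crossing and the induction -/

section

variable {N : ℕ} {K : ℝ} {φ : Flow ℝ (Phase N)} {j k l : ℕ} {ε δ η a : ℝ}

/-- The point of the sphere supported on the modes `k + 1` and `k + 2` whose bond has components
proportional to `(a η, η)`. -/
noncomputable def twoMode (N k : ℕ) (η a : ℝ) : Phase N :=
  (starRingEnd ℂ) (seed η a) • unitVec N (k + 1) + (retention η a : ℂ) • unitVec N (k + 2)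

lemma continuous_twoMode (N k : ℕ) (η : ℝ) : Continuous (twoMode N k η) := by
  unfold twoMode
  fun_prop

lemma mode_twoMode (hN : k + 2 ≤ N) (η a : ℝ) (j : ℕ) :
    mode (twoMode N k η a) j = if j = k + 1 then (starRingEnd ℂ) (seed η a)
      else if j = k + 2 then (retention η a : ℂ) else 0 := by
  rw [twoMode, mode_add, mode_smul, mode_smul, mode_unitVec (by omega) (by omega),
    mode_unitVec (by omega) hN]
  split_ifs with h1 h2 <;> first | omega | simp only [mul_one, mul_zero, add_zero, zero_add]

lemma mass_twoMode (hN : k + 2 ≤ N) (η a : ℝ) (j : ℕ) :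
    mass j (twoMode N k η a) = if j = k + 1 then ‖seed η a‖ ^ 2
      else if j = k + 2 then retention η a ^ 2 else 0 := by
  rw [mass, mode_twoMode hN]
  split_ifs <;> simp

lemma bond_twoMode (hN : k + 2 ≤ N) (η a : ℝ) :
    bond (k + 1) (twoMode N k η a) = retention η a * (starRingEnd ℂ) (seed η a) := by
  rw [bond, mode_twoMode hN, mode_twoMode hN, if_pos rfl, if_neg (by omega), if_pos rfl,
    Complex.conj_ofReal, mul_comm]

lemma norm_twoMode (hN : k + 2 ≤ N) (h : ‖seed η a‖ ≤ 1) : ‖twoMode N k η a‖ = 1 := by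
  rw [← sq_eq_sq₀ (norm_nonneg _) zero_le_one, norm_sq_eq_sum_mass,
    Finset.sum_eq_add_of_mem k (k + 1) (Finset.mem_range.2 (by omega))
      (Finset.mem_range.2 (by omega)) (by omega) fun i _ hi => ?_,
    mass_twoMode hN, mass_twoMode hN, if_pos rfl, if_neg (by omega), if_pos rfl, add_comm,
    retention_sq_add h, one_pow]
  rw [mass_twoMode hN, if_neg (by omega), if_neg (by omega)]

lemma isStaged_twoMode (φ : Flow ℝ (Phase N)) (hN : k + 2 ≤ N) (hη : 0 < η)
    (hseed : ‖seed η a‖ ^ 2 < min (min ε δ) (1 / 2)) :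
    IsStaged φ (k + 2) ε k δ (twoMode N k η a) := by
  obtain ⟨hεδ, hhalf⟩ := lt_min_iff.1 hseed
  obtain ⟨hε, hδ⟩ := lt_min_iff.1 hεδ
  have hle : ‖seed η a‖ ≤ 1 :=
    (sq_le_one_iff₀ (norm_nonneg _)).1 (hhalf.le.trans (by norm_num))
  have hmass : mass (k + 2) (twoMode N k η a) = 1 - ‖seed η a‖ ^ 2 := by
    rw [mass_twoMode hN, if_neg (by omega), if_pos rfl, ← retention_sq_add hle,
      add_sub_cancel_right]
  refine ⟨norm_twoMode hN hle, ⟨0, le_rfl, ?_, fun t ht => ?_⟩, fun j hj => ?_, ?_, ?_⟩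
  · rw [neg_zero, Flow.map_zero_apply, hmass]
    linarith
  · rw [le_antisymm ht.2 ht.1, neg_zero, Flow.map_zero_apply]
    exact half_lt_supNorm (k := k + 2) (by linarith)
  · rw [mass_twoMode hN, if_neg (by omega), if_neg (by omega)]
  · linarith
  · rw [mass_twoMode hN, if_pos rfl]
    exact pow_pos (norm_seed_pos hη a) 2

lemma crossing_base (φ : Flow ℝ (Phase N)) (hN : k + 2 ≤ N) (hε : 0 < ε) (hδ : 0 < δ) :
    Crossing φ (k + 2) ε k δ := by
  obtain ⟨η, hη, hη3⟩ : ∃ η : ℝ, 0 < η ∧ 3 * η ^ 2 < min (min ε δ) (1 / 2) := by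
    have hμ : 0 < min (min ε δ) (1 / 2) := by positivity
    refine ⟨√(min (min ε δ) (1 / 2) / 4), by positivity, ?_⟩
    rw [Real.sq_sqrt (by positivity)]
    linarith
  have hseed : ∀ a ∈ Icc (-2 : ℝ) 2, ‖seed η a‖ ^ 2 < min (min ε δ) (1 / 2) := fun a ha => by
    refine lt_of_le_of_lt ?_ hη3
    rw [norm_seed_sq]
    gcongr
    nlinarith [ha.1, ha.2]
  have hV : ∀ a ∈ Icc (-2 : ℝ) 2, 0 < bondV (k + 1) (twoMode N k η a) := fun a ha => by
    rw [bondV_of_bond_eq (bond_twoMode hN η a)]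
    refine mul_pos (Real.sqrt_pos.2 ?_) hη
    linarith [hseed a ha, min_le_right (min ε δ) (1 / 2)]
  have hU : ∀ a, bondU (k + 1) (twoMode N k η a) = a * bondV (k + 1) (twoMode N k η a) :=
    fun a => bondU_of_bond_eq (bond_twoMode hN η a)
  have hleft : (-2 : ℝ) ∈ Icc (-2 : ℝ) 2 := by norm_num
  have hright : (2 : ℝ) ∈ Icc (-2 : ℝ) 2 := by norm_num
  have hpath : IsPathConnected (twoMode N k η '' Icc (-2) 2) :=
    ((convex_Icc (-2 : ℝ) 2).isPathConnected ⟨_, hleft⟩).image (continuous_twoMode N k η)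
  refine ⟨twoMode N k η (-2), ?_, twoMode N k η 2, ?_,
    (hpath.joinedIn _ ⟨_, hleft, rfl⟩ _ ⟨_, hright, rfl⟩).mono ?_⟩
  · change |bondV _ _| < -bondU _ _
    rw [hU, abs_of_pos (hV _ hleft)]
    linarith [hV _ hleft]
  · change |bondV _ _| < bondU _ _
    rw [hU, abs_of_pos (hV _ hright)]
    linarith [hV _ hright]
  · rintro _ ⟨a, ha, rfl⟩
    exact isStaged_twoMode φ hN hη (hseed a ha)

theorem crossing (h : IsSphereFlow K φ) (hK : 0 ≤ K) (hlk : l ≤ k) (hε : 0 < ε) :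
    k + 2 ≤ N → ∀ δ, 0 < δ → Crossing φ (l + 2) ε k δ := by
  induction k, hlk using Nat.le_induction with
  | base => exact fun hN δ hδ => crossing_base φ hN hε hδ
  | succ k _ ih =>
    intro hN δ hδ
    have hK8 : 0 < 100 * (K + 8) := by positivity
    refine Crossing.mono (min_le_left δ (1 / (100 * (K + 8)))) (Crossing.succ h hK (by omega)
      (ih (by omega)) (by positivity) ((le_div_iff₀ hK8).1 (min_le_right _ _)))

/-! ### Distance to the circles -/

lemma mass_le_norm_mode {x : Phase N} (hnorm : ‖x‖ ≤ 1) (j : ℕ) : mass j x ≤ ‖mode x j‖ :=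
  pow_le_of_le_one (norm_nonneg _) ((norm_mode_le x j).trans hnorm) two_ne_zero

lemma inner_unitVec (h1 : 1 ≤ j) (h2 : j ≤ N) (x : Phase N) :
    inner ℂ (unitVec N j) x = mode x j := by
  have hi : ∀ i : Fin N, (i : ℕ) + 1 = j ↔ i = ⟨j - 1, by omega⟩ := fun i => by
    simp only [Fin.ext_iff]
    omega
  rw [mode, dif_pos ⟨h1, h2⟩]
  simp [PiLp.inner_apply, unitVec, hi]

lemma exists_mem_circle_dist_lt (h1 : 1 ≤ j) (h2 : j ≤ N) (hε : 0 < ε) {x : massSphere N}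
    (hpos : 0 < mass j (x : Phase N)) (hx : 1 - ε ^ 2 / 2 < mass j (x : Phase N)) :
    ∃ p ∈ circle N j, dist x p < ε := by
  have hnorm : ‖(x : Phase N)‖ = 1 := norm_eq_of_mem_sphere x
  have hmode : mode (x : Phase N) j ≠ 0 := fun h0 => hpos.ne' (mass_eq_zero.2 h0)
  let c : ℂ := mode (x : Phase N) j / ‖mode (x : Phase N) j‖
  have hc : ‖c‖ = 1 := by
    rw [norm_div, Complex.norm_real, norm_norm, div_self (norm_ne_zero_iff.2 hmode)]
  have hp : ‖c • unitVec N j‖ = 1 := by rw [norm_smul, hc, norm_unitVec h1 h2, one_mul]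
  have hinner : inner ℂ (c • unitVec N j) (x : Phase N) = ‖mode (x : Phase N) j‖ := by
    rw [inner_smul_left, inner_unitVec h1 h2, map_div₀, Complex.conj_ofReal, div_mul_eq_mul_div,
      Complex.conj_mul', pow_two, mul_self_div_self]
  refine ⟨⟨c • unitVec N j, mem_sphere_zero_iff_norm.2 hp⟩, ⟨?_, fun k hk => ?_⟩,
    lt_of_pow_lt_pow_left₀ 2 hε.le ?_⟩
  · rw [mode_smul, mode_unitVec h1 h2, if_pos rfl, mul_one, hc]
  · rw [mode_smul, mode_unitVec h1 h2, if_neg hk, mul_zero]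
  · rw [dist_comm, Subtype.dist_eq, dist_eq_norm, norm_sub_sq (𝕜 := ℂ), hinner, hp, hnorm]
    rw [RCLike.re_to_complex, Complex.ofReal_re]
    linarith [mass_le_norm_mode hnorm.le j]

lemma norm_mode_le_of_ne {x : Phase N} (hnorm : ‖x‖ = 1) (hε : 0 ≤ ε) (hx : 1 - ε ^ 2 ≤ mass j x)
    (hk : k ≠ j) : ‖mode x k‖ ≤ ε := by
  have hsum := sum_mass_le x {k, j}
  rw [Finset.sum_pair hk, hnorm, one_pow] at hsum
  exact abs_le_of_sq_le_sq' (show mass k x ≤ ε ^ 2 by linarith) hε |>.2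

lemma near_circle (h1 : 1 ≤ j) (h2 : j ≤ N) (hε : 0 < ε) {x : massSphere N}
    (hx : 1 - min 1 (ε ^ 2 / 2) < mass j (x : Phase N)) :
    (∃ p ∈ circle N j, dist x p < ε) ∧ 1 - ε ≤ ‖mode (x : Phase N) j‖ ∧
      ∀ k, k ≠ j → ‖mode (x : Phase N) k‖ ≤ ε := by
  have hnorm : ‖(x : Phase N)‖ = 1 := norm_eq_of_mem_sphere x
  have hpos : 0 < mass j (x : Phase N) := by linarith [min_le_left 1 (ε ^ 2 / 2)]
  have hmass : 1 - ε ^ 2 / 2 < mass j (x : Phase N) := by linarith [min_le_right 1 (ε ^ 2 / 2)]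
  have hμ : min 1 (ε ^ 2 / 2) ≤ ε := by
    rcases le_total 1 ε with h | h
    · exact (min_le_left _ _).trans h
    · exact (min_le_right _ _).trans (by nlinarith)
  exact ⟨exists_mem_circle_dist_lt h1 h2 hε hpos hmass,
    by linarith [mass_le_norm_mode hnorm.le j],
    fun k hk => norm_mode_le_of_ne hnorm hε.le (by linarith [sq_nonneg ε]) hk⟩

end

end ToyModel

theorem theorem3p1_general {N m n : ℕ} (hm : 2 ≤ m) (hmn : m ≤ n) (hn : n ≤ N) {ε : ℝ}
    (hε : 0 < ε) :
    ∃ (x y : ToyModel.massSphere N) (T : ℝ) (b : ℝ → ToyModel.Phase N),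
      0 ≤ T ∧ ToyModel.IsSolution b ∧
      b 0 = (x : ToyModel.Phase N) ∧ b T = (y : ToyModel.Phase N) ∧
      (∃ p ∈ ToyModel.circle N m, dist x p < ε) ∧
      (∃ q ∈ ToyModel.circle N n, dist y q < ε) ∧
      (1 - ε ≤ ‖ToyModel.mode (b 0) m‖ ∧
        ∀ j : ℕ, j ≠ m → ‖ToyModel.mode (b 0) j‖ ≤ ε) ∧
      (1 - ε ≤ ‖ToyModel.mode (b T) n‖ ∧
        ∀ j : ℕ, j ≠ n → ‖ToyModel.mode (b T) j‖ ≤ ε) ∧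
      (∀ t : ℝ, 0 ≤ t → t ≤ T →
        1 / 2 ≤ ToyModel.supNorm (b t) ∧ ToyModel.supNorm (b t) ≤ 1) := by
  obtain ⟨l, rfl⟩ := Nat.exists_eq_add_of_le' hm
  obtain ⟨k, rfl⟩ := Nat.exists_eq_add_of_le' (hm.trans hmn)
  obtain ⟨K, φ, hK, hφ⟩ := ToyModel.exists_isSphereFlow N
  have hμ : 0 < min 1 (ε ^ 2 / 2) := by positivity
  obtain ⟨y, -, _, -, hjoin⟩ :=
    ToyModel.crossing hφ hK (Nat.le_of_add_le_add_right hmn) hμ hn _ hμ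
  obtain ⟨hy, ⟨T, hT, hstart, hspread⟩, -, hend, -⟩ := hjoin.source_mem
  have hx : ‖φ (-T) y‖ = 1 := hφ.norm_eq _ _ hy
  have hb₀ : φ 0 (φ (-T) y) = φ (-T) y := φ.map_zero_apply _
  have hbT : φ T (φ (-T) y) = y := by rw [← φ.map_add, add_neg_cancel, φ.map_zero_apply]
  have hnear := ToyModel.near_circle (x := ⟨_, mem_sphere_zero_iff_norm.2 hx⟩) (by omega)
    (by omega) hε hstart
  have hnear' := ToyModel.near_circle (x := ⟨y, mem_sphere_zero_iff_norm.2 hy⟩) (by omega) hn hε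
    hend
  refine ⟨_, _, T, fun t => φ t (φ (-T) y), hT, hφ.isSolution _ hx, hb₀, hbT, hnear.1, hnear'.1,
    by simpa only [hb₀] using hnear.2, by simpa only [hbT] using hnear'.2, fun t ht htT => ⟨?_, ?_⟩⟩
  · have hback : φ (-(T - t)) y = φ t (φ (-T) y) := by rw [← φ.map_add, neg_sub, sub_eq_add_neg]
    exact (hspread (T - t) ⟨by linarith, by linarith⟩).le.trans_eq (congrArg _ hback)
  · exact (ToyModel.supNorm_le_norm _).trans (hφ.norm_eq _ _ hx).le

theorem theorem3p1 :
    ∃ c C : ℝ, 0 < c ∧ 0 < C ∧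
      ∀ N : ℕ, 6 ≤ N → ∀ ε : ℝ, 0 < ε →
        ∃ (x y : ToyModel.massSphere N) (T : ℝ) (b : ℝ → ToyModel.Phase N),
          0 ≤ T ∧ ToyModel.IsSolution b ∧
          b 0 = (x : ToyModel.Phase N) ∧ b T = (y : ToyModel.Phase N) ∧
          (∃ p ∈ ToyModel.circle N 3, dist x p < ε) ∧
          (∃ q ∈ ToyModel.circle N (N - 2), dist y q < ε) ∧
          (1 - ε ≤ ‖ToyModel.mode (b 0) 3‖ ∧
            ∀ j : ℕ, j ≠ 3 → ‖ToyModel.mode (b 0) j‖ ≤ ε) ∧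
          (1 - ε ≤ ‖ToyModel.mode (b T) (N - 2)‖ ∧
            ∀ j : ℕ, j ≠ N - 2 → ‖ToyModel.mode (b T) j‖ ≤ ε) ∧
          (∀ t : ℝ, 0 ≤ t → t ≤ T →
            c ≤ ToyModel.supNorm (b t) ∧ ToyModel.supNorm (b t) ≤ C) :=
  ⟨1 / 2, 1, by norm_num, one_pos, fun N hN ε hε =>
    theorem3p1_general (by norm_num) (by omega) (by omega) hε⟩
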